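/- Let $d\ge 2$, and let $\mathcal F\varphi(\xi)=(2\pi)^{-d/2}\int_{\mathbb R^d}e^{-ix\cdot\xi}\varphi(x)\,dx$, extended to $\mathcal S'(\mathbb R^d)$ by duality. Let $\phi_0\in\mathcal S(\mathbb R^d)$ be non-negative with $\phi_0(x)=1$ for $|x|\le 1$ and $\phi_0(x)=0$ for $|x|\ge 3/2$, and put $\phi_j(x)=\phi_0(2^{-j}x)-\phi_0(2^{-j+1}x)$ for $j\ge 1$. Let $\varphi_0\in C_0^\infty(\mathbb R)$ (complex-valued) with $\varphi_0=1$ on $[-1,1]$ and $\operatorname{supp}\varphi_0\subset[-\tfrac32,\tfrac32]$, put $\varphi_j(\xi)=\varphi_0(2^{-j}\xi)-\varphi_0(2^{-j+1}\xi)$ for $j\ge1$, and $\varphi_{\bar k}(x)=\prod_{i=1}^d\varphi_{k_i}(x_i)$ for $\bar k\in\mathbb N_0^d$, $|\bar k|_1=k_1+\dots+k_d$. For $0<p<\infty$, $0<q\le\infty$ and $s,t\in\mathbb R$ let $F^{s}_{p,q}(\mathbb R^d)$ and $S^t_{p,q}F(\mathbb R^d)$ be the collections of all $f\in\mathcal S'(\mathbb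 R^d)$ for which $$\|f|F^s_{p,q}\|=\Big\|\Big(\sum_{j=0}^\infty 2^{jsq}|\mathcal F^{-1}[\phi_j\mathcal Ff](\cdot)|^q\Big)^{1/q}\Big|L_p(\mathbb R^d)\Big\|,\qquad \|f|S^t_{p,q}F\|=\Big\|\Big(\sum_{\bar k\in\mathbb N_0^d}2^{|\bar k|_1tq}|\mathcal F^{-1}[\varphi_{\bar k}\mathcal Ff](\cdot)|^q\Big)^{1/q}\Big|L_p(\mathbb R^d)\Big\|,$$ respectively, is finite (with a supremum in place of the sum if $q=\infty$). Then, for every choice of $\phi_0$ and $\varphi_0$: (i) If $0<p<1$, $0<q\le\infty$ and $0<t\le\frac1p-1$, then $S^t_{p,q}F(\mathbb R^d)$ and $F^{td}_{p,q}(\mathbb R^d)$ are not comparable: neither of the two spaces is contained in the other (in particular, neither is continuously embedded in the other). (ii) If $0<p<\infty$, $0<q\le\infty$ and $t<0$, then $S^t_{p,q}F(\mathbb R^d)\hookrightarrow F^{td}_{p,q}(\mathbb R^d)$: the former space is contained in the latter, and there is a finite constant $C$ with $\|f|F^{td}_{p,q}\|\le C\,\|f|S^t_{p,q}F\|$ for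 all $f\in S^t_{p,q}F(\mathbb R^d)$. -/

import Mathlib

open MeasureTheory
open scoped ENNReal NNReal ContDiff SchwartzMap FourierTransform

noncomputable section

namespace LizorkinTriebel

/-- The space `ℝ^d` with its Euclidean norm and Lebesgue measure. -/
abbrev Rd (d : ℕ) : Type := EuclideanSpace ℝ (Fin d)

/-! ### The Fourier transform with the kernel `(2π)^{-d/2} e^{-i x·ξ}` -/

/-- The dilation `ξ ↦ ξ / (2π)` of `ℝ^d`. -/
def dilation (d : ℕ) : Rd d ≃L[ℝ] Rd d :=
  ContinuousLinearEquiv.smulLeft (Units.mk0 ((2 * Real.pi)⁻¹ : ℝ) (by positivity))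

/-- The Fourier transform `(𝓕φ)(ξ) = (2π)^{-d/2} ∫ e^{-i x·ξ} φ(x) dx` on the Schwartz space. -/
def fourierSchwartz (d : ℕ) : 𝓢(Rd d, ℂ) →L[ℂ] 𝓢(Rd d, ℂ) :=
  (((2 * Real.pi) ^ (-(d : ℝ) / 2) : ℝ) : ℂ) •
    (SchwartzMap.compCLMOfContinuousLinearEquiv ℂ (dilation d)).comp
      (FourierTransform.fourierCLM ℂ 𝓢(Rd d, ℂ))

theorem fourierSchwartz_apply (d : ℕ) (φ : 𝓢(Rd d, ℂ)) (ξ : Rd d) :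
    fourierSchwartz d φ ξ = (((2 * Real.pi) ^ (-(d : ℝ) / 2) : ℝ) : ℂ) *
      ∫ x : Rd d, Complex.exp (-Complex.I * ((inner ℝ x ξ : ℝ) : ℂ)) * φ x := by
  have h : fourierSchwartz d φ ξ = (((2 * Real.pi) ^ (-(d : ℝ) / 2) : ℝ) : ℂ) *
      𝓕 (φ : Rd d → ℂ) ((2 * Real.pi)⁻¹ • ξ) := rfl
  rw [h, Real.fourier_eq']
  congr 2
  funext x
  rw [inner_smul_right, smul_eq_mul]
  congr 2
  have : (Real.pi : ℂ) ≠ 0 := by exact_mod_cast Real.pi_ne_zero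
  push_cast
  field_simp

/-- The Fourier transform of a tempered distribution, `(𝓕f)(θ) = f(𝓕θ)`. -/
def fourierTempered {d : ℕ} (f : 𝓢'(Rd d, ℂ)) : 𝓢'(Rd d, ℂ) :=
  PointwiseConvergenceCLM.precomp ℂ (fourierSchwartz d) f

/-! ### Frequency-localized pieces of a tempered distribution -/

/-- The Schwartz function `ξ ↦ e^{i x·ξ} m(ξ)`, for a smooth compactly supported `m`. -/
def modulate {d : ℕ} (m : Rd d → ℂ) (hc : HasCompactSupport m) (hs : ContDiff ℝ ∞ m)
    (x : Rd d) : 𝓢(Rd d, ℂ) :=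
  HasCompactSupport.toSchwartzMap
    (f := fun ξ => Complex.exp (Complex.I * ((inner ℝ x ξ : ℝ) : ℂ)) * m ξ)
    hc.mul_left
    (by
      have h : ContDiff ℝ ∞ fun ξ : Rd d => ((inner ℝ x ξ : ℝ) : ℂ) :=
        Complex.ofRealCLM.contDiff.comp (contDiff_const.inner ℝ contDiff_id)
      exact ((contDiff_const.mul h).cexp).mul hs)

/-- The function `x ↦ 𝓕⁻¹[m 𝓕f](x)`. Since `m` is smooth with compact support, `m 𝓕f` is a
compactly supported distribution and its inverse Fourier transform is the smooth function
`x ↦ (2π)^{-d/2} (m 𝓕f)(e^{i x·ξ}) = (2π)^{-d/2} (𝓕f)(e^{i x·ξ} m(ξ))`. -/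
def piece {d : ℕ} (m : Rd d → ℂ) (hc : HasCompactSupport m) (hs : ContDiff ℝ ∞ m)
    (f : 𝓢'(Rd d, ℂ)) (x : Rd d) : ℂ :=
  (((2 * Real.pi) ^ (-(d : ℝ) / 2) : ℝ) : ℂ) * fourierTempered f (modulate m hc hs x)

/-! ### Smooth dyadic decompositions of unity -/

/-- `φ_0` itself for `j = 0`, and `φ_j(x) = φ_0(2^{-j} x) - φ_0(2^{-j+1} x)` for `j ≥ 1`. -/
def dyadic {V : Type*} [SMul ℝ V] (φ₀ : V → ℂ) (j : ℕ) (x : V) : ℂ :=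
  if j = 0 then φ₀ x
  else φ₀ ((2 : ℝ) ^ (-(j : ℤ)) • x) - φ₀ ((2 : ℝ) ^ (-(j : ℤ) + 1) • x)

theorem dyadic_contDiff {V : Type*} [NormedAddCommGroup V] [NormedSpace ℝ V] {φ₀ : V → ℂ}
    (h : ContDiff ℝ ∞ φ₀) (j : ℕ) : ContDiff ℝ ∞ (dyadic φ₀ j) := by
  by_cases hj : j = 0
  · have : dyadic φ₀ j = φ₀ := by funext x; simp [dyadic, hj]
    rwa [this]
  · have : dyadic φ₀ j = fun x =>
        φ₀ ((2 : ℝ) ^ (-(j : ℤ)) • x) - φ₀ ((2 : ℝ) ^ (-(j : ℤ) + 1) • x) := by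
      funext x; simp [dyadic, hj]
    rw [this]
    exact (h.comp (contDiff_const_smul _)).sub (h.comp (contDiff_const_smul _))

theorem dyadic_hasCompactSupport {V : Type*} [NormedAddCommGroup V] [NormedSpace ℝ V]
    {φ₀ : V → ℂ} (h : HasCompactSupport φ₀) (j : ℕ) : HasCompactSupport (dyadic φ₀ j) := by
  by_cases hj : j = 0
  · have : dyadic φ₀ j = φ₀ := by funext x; simp [dyadic, hj]
    rwa [this]
  · have : dyadic φ₀ j = (fun x => φ₀ ((2 : ℝ) ^ (-(j : ℤ)) • x)) -
        fun x => φ₀ ((2 : ℝ) ^ (-(j : ℤ) + 1) • x) := by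
      funext x; simp [dyadic, hj]
    rw [this]
    exact (h.comp_smul (by positivity)).sub (h.comp_smul (by positivity))

/-- A generator of an isotropic smooth dyadic decomposition of unity on `ℝ^d`. -/
structure IsotropicGenerator (d : ℕ) where
  φ₀ : 𝓢(Rd d, ℝ)
  nonneg : ∀ x, 0 ≤ φ₀ x
  eq_one : ∀ x, ‖x‖ ≤ 1 → φ₀ x = 1
  eq_zero : ∀ x, 3 / 2 ≤ ‖x‖ → φ₀ x = 0

/-- The functions `φ_j`, `j ∈ ℕ₀`, on `ℝ^d`. -/
def IsotropicGenerator.system {d : ℕ} (Φ : IsotropicGenerator d) (j : ℕ) : Rd d → ℂ :=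
  dyadic (fun x => (Φ.φ₀ x : ℂ)) j

theorem IsotropicGenerator.system_contDiff {d : ℕ} (Φ : IsotropicGenerator d) (j : ℕ) :
    ContDiff ℝ ∞ (Φ.system j) :=
  dyadic_contDiff (Complex.ofRealCLM.contDiff.comp (Φ.φ₀.smooth ⊤)) j

theorem IsotropicGenerator.system_hasCompactSupport {d : ℕ} (Φ : IsotropicGenerator d)
    (j : ℕ) : HasCompactSupport (Φ.system j) := by
  refine dyadic_hasCompactSupport ?_ j
  refine HasCompactSupport.intro (isCompact_closedBall (0 : Rd d) (3 / 2)) fun x hx => ?_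
  have h : 3 / 2 ≤ ‖x‖ := by
    rw [Metric.mem_closedBall, dist_zero_right, not_le] at hx
    exact hx.le
  simp [Φ.eq_zero x h]

/-- A generator of a smooth dyadic decomposition of unity on the real line. -/
structure LineGenerator where
  φ₀ : ℝ → ℂ
  smooth : ContDiff ℝ ∞ φ₀
  eq_one : ∀ ξ ∈ Set.Icc (-1 : ℝ) 1, φ₀ ξ = 1
  tsupport_subset : tsupport φ₀ ⊆ Set.Icc (-(3 / 2) : ℝ) (3 / 2)

/-- The tensor products `φ_k(x) = φ_{k_1}(x_1) ⋯ φ_{k_d}(x_d)`, `k ∈ ℕ₀^d`, on `ℝ^d`. -/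
def LineGenerator.system (Ψ : LineGenerator) {d : ℕ} (k : Fin d → ℕ) (x : Rd d) : ℂ :=
  ∏ i, dyadic Ψ.φ₀ (k i) (x i)

theorem LineGenerator.system_contDiff (Ψ : LineGenerator) {d : ℕ} (k : Fin d → ℕ) :
    ContDiff ℝ ∞ (Ψ.system k) := by
  refine contDiff_prod fun i _ => ?_
  exact (dyadic_contDiff Ψ.smooth (k i)).comp
    (EuclideanSpace.proj (𝕜 := ℝ) i : Rd d →L[ℝ] ℝ).contDiff

theorem LineGenerator.system_hasCompactSupport (Ψ : LineGenerator) {d : ℕ} (k : Fin d → ℕ) :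
    HasCompactSupport (Ψ.system k) := by
  have h (i : Fin d) : HasCompactSupport (dyadic Ψ.φ₀ (k i)) :=
    dyadic_hasCompactSupport (isCompact_Icc.of_isClosed_subset (isClosed_tsupport _)
      Ψ.tsupport_subset) _
  have hK : IsCompact ((EuclideanSpace.equiv (Fin d) ℝ).toHomeomorph ⁻¹'
      Set.univ.pi fun i => tsupport (dyadic Ψ.φ₀ (k i))) :=
    (Homeomorph.isCompact_preimage _).2 (isCompact_univ_pi h)
  refine HasCompactSupport.intro hK fun x hx => ?_
  simp only [Set.mem_preimage, Set.mem_pi, Set.mem_univ, true_implies, not_forall] at hx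
  obtain ⟨i, hi⟩ := hx
  exact Finset.prod_eq_zero (Finset.mem_univ i) (image_eq_zero_of_notMem_tsupport hi)

/-! ### The quasi-norms -/

/-- The `ℓ_q` quasi-norm of a family of complex numbers, `0 < q ≤ ∞`. -/
def lqNorm {ι : Type*} (q : ℝ≥0∞) (a : ι → ℂ) : ℝ≥0∞ :=
  if q = ⊤ then ⨆ k, ‖a k‖ₑ else (∑' k, ‖a k‖ₑ ^ q.toReal) ^ (1 / q.toReal)

/-- The quasi-norm of `L_p(ℓ_q)` on `ℝ^d`, `0 < p < ∞` and `0 < q ≤ ∞`. -/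
def LpLqNorm {d : ℕ} {ι : Type*} (p : ℝ) (q : ℝ≥0∞) (g : ι → Rd d → ℂ) : ℝ≥0∞ :=
  (∫⁻ x, lqNorm q (fun k => g k x) ^ p) ^ (1 / p)

/-- The quasi-norm of the isotropic Lizorkin-Triebel space `F^s_{p,q}(ℝ^d)`, extended by `∞` to
all tempered distributions. -/
def isoNorm {d : ℕ} (Φ : IsotropicGenerator d) (s p : ℝ) (q : ℝ≥0∞) (f : 𝓢'(Rd d, ℂ)) : ℝ≥0∞ :=
  LpLqNorm p q fun (j : ℕ) x => (((2 : ℝ) ^ ((j : ℝ) * s) : ℝ) : ℂ) *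
    piece (Φ.system j) (Φ.system_hasCompactSupport j) (Φ.system_contDiff j) f x

/-- The quasi-norm of the Lizorkin-Triebel space of dominating mixed smoothness `S^t_{p,q}F(ℝ^d)`,
extended by `∞` to all tempered distributions. -/
def mixedNorm {d : ℕ} (Ψ : LineGenerator) (t p : ℝ) (q : ℝ≥0∞) (f : 𝓢'(Rd d, ℂ)) : ℝ≥0∞ :=
  LpLqNorm p q fun (k : Fin d → ℕ) x => (((2 : ℝ) ^ (((∑ i, k i : ℕ) : ℝ) * t) : ℝ) : ℂ) *
    piece (Ψ.system k) (Ψ.system_hasCompactSupport k) (Ψ.system_contDiff k) f x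

/-- The collection of all tempered distributions with finite quasi-norm. -/
def spaceOf {d : ℕ} (N : 𝓢'(Rd d, ℂ) → ℝ≥0∞) : Set 𝓢'(Rd d, ℂ) :=
  {f | N f < ⊤}

/-- `X ↪ Y` for the quasi-normed spaces given by `NX` and `NY`: `X` is contained in `Y` and the
(linear) inclusion map is bounded, i.e. continuous. -/
def ContinuouslyEmbeds {d : ℕ} (NX NY : 𝓢'(Rd d, ℂ) → ℝ≥0∞) : Prop :=
  spaceOf NX ⊆ spaceOf NY ∧ ∃ C : ℝ≥0, ∀ f ∈ spaceOf NX, NY f ≤ C * NX f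

/-- Neither of the two spaces is contained in the other; in particular neither of them is
continuously embedded in the other. -/
def NotComparable {d : ℕ} (NX NY : 𝓢'(Rd d, ℂ) → ℝ≥0∞) : Prop :=
  ¬ spaceOf NX ⊆ spaceOf NY ∧ ¬ spaceOf NY ⊆ spaceOf NX

end LizorkinTriebel

end

/-! Embedding for t < 0. On the support of the j-th isotropic function the tensor functions with all
k_i ≤ j + 1 sum to one, so the j-th isotropic piece of f is a finite sum of isotropic multipliers
applied to tensor pieces. A tensor piece has its spectrum in a ball of radius about 2^K, where K is
the largest component of k, and K ≤ j + 1. Hence the multiplier, a convolution at scale 2^(-j),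
costs no more than the isotropic Peetre maximal function of the piece at scale 2^(-K); the product
structure of the piece is not needed here. The weights satisfy 2^(jtd) = ∏ 2^(t(j - k_i)) ·
2^(|k|t), and since t < 0 and j - k_i ≥ -1 the product is a matrix in (j, k) with uniformly bounded
row and column sums. This matrix is bounded on every ℓ_q (`exists_lq_le_of_matrix`), and it remains
to remove the Peetre maximal function in L_p(ℓ_q).

For r < min(p, q), r ≤ 1, the r-th power of that function is dominated by a convolution of |piece|^r
with a polynomially decaying kernel (`peetre_rpow_le`, a self-improvement argument). A
Fefferman-Stein inequality in L_(p/r)(ℓ_(q/r)) then applies, both exponents exceeding one. It is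
proved directly for the kernel convolutions, which are linear and self-adjoint, so that duality is
available; the only maximal theorem needed is the scalar one. To treat pieces of a distribution as
convolutions, the distribution must be taken under an integral sign (`map_convolution_eq_integral`).

Non-comparability. Take spectral densities G_M, M = 0, 1, ..., located in separate dyadic shells,
with p-th powers of the first quasi-norm bounded and of the second at least aM. The distribution
with spectral density ∑ 4^(-m) G_(4^m) has finite first quasi-norm, while its second one has p-th
power at least a · 4^(-mp) · 4^m for all m, which is unbounded as p < 1
(`exists_separating_distribution`).

Against mixed ⊆ isotropic: G_M sits at height 2^M on a coordinate axis. The mixed weight is about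
2^(Mt) and the isotropic one about 2^(Mtd), and t > 0, d ≥ 2. Against isotropic ⊆ mixed: G_M is a
bump on a box of side about 2^M that touches the hyperplane ξ_(i₁) = 0. It is one isotropic piece
but meets M tensor pieces, with k_(i₁) = 1, ..., M. Dilated annuli in the variable x_(i₁) give
disjoint sets on which the successive pieces carry a fixed amount of mass, provided t ≤ 1/p - 1. As
the sets are disjoint, the masses add up to aM whatever q is, and this linear growth persists at the
endpoint t = 1/p - 1. -/

noncomputable section

namespace LizorkinTriebel

/-! ### The dyadic Hardy-Littlewood maximal function -/

/-- The average of `h` over the closed ball of radius `2 ^ m` about `x`. -/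
def ballAverage {d : ℕ} (m : ℤ) (h : Rd d → ℝ≥0∞) (x : Rd d) : ℝ≥0∞ :=
  (volume (Metric.closedBall (0 : Rd d) ((2 : ℝ) ^ m)))⁻¹ *
    ∫⁻ y in Metric.closedBall x ((2 : ℝ) ^ m), h y

/-- The centered Hardy-Littlewood maximal function over balls with dyadic radii. -/
def maximal {d : ℕ} (h : Rd d → ℝ≥0∞) (x : Rd d) : ℝ≥0∞ := ⨆ m : ℤ, ballAverage m h x

theorem volume_closedBall_two_zpow_pos {d : ℕ} (m : ℤ) :
    0 < volume (Metric.closedBall (0 : Rd d) ((2 : ℝ) ^ m)) :=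
  Metric.measure_closedBall_pos _ _ (by positivity)

theorem volume_closedBall_two_zpow_ne_top {d : ℕ} (x : Rd d) (m : ℤ) :
    volume (Metric.closedBall x ((2 : ℝ) ^ m)) ≠ ⊤ :=
  (isCompact_closedBall _ _).measure_lt_top.ne

theorem measurable_ballAverage {d : ℕ} (m : ℤ) {h : Rd d → ℝ≥0∞} (hh : Measurable h) :
    Measurable (ballAverage m h) := by
  unfold ballAverage
  refine Measurable.const_mul ?_ _
  have e : ∀ x : Rd d, ∫⁻ y in Metric.closedBall x ((2 : ℝ) ^ m), h y =
      ∫⁻ y, {z : Rd d × Rd d | dist z.2 z.1 ≤ (2 : ℝ) ^ m}.indicator (fun z => h z.2) (x, y) := by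
    intro x
    rw [← lintegral_indicator Metric.isClosed_closedBall.measurableSet]
    refine lintegral_congr fun y => ?_
    simp [Set.indicator]
  simp_rw [e]
  refine Measurable.lintegral_prod_right' (f := {z : Rd d × Rd d |
    dist z.2 z.1 ≤ (2 : ℝ) ^ m}.indicator (fun z => h z.2)) ?_
  refine (hh.comp measurable_snd).indicator ?_
  exact (isClosed_le (continuous_snd.dist continuous_fst) continuous_const).measurableSet

theorem measurable_maximal {d : ℕ} {h : Rd d → ℝ≥0∞} (hh : Measurable h) :
    Measurable (maximal h) :=
  Measurable.iSup fun m => measurable_ballAverage m hh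

/-- Vitali covering: disjoint balls with large averages are selected whose fourfold enlargements
cover the set, and enlarging costs 4^d in volume. The bound R on the radii is what the covering
lemma requires; it is removed afterwards by monotone convergence. -/
theorem volume_lt_ballAverage_le {d : ℕ} (h : Rd d → ℝ≥0∞) (R : ℤ) (c : ℝ≥0∞) :
    c * volume {x | ∃ m ≤ R, c < ballAverage m h x} ≤
      ENNReal.ofReal (4 ^ d) * ∫⁻ y, h y := by
  set E := {x | ∃ m ≤ R, c < ballAverage m h x} with hE
  have hex : ∀ x : Rd d, ∃ m : ℤ, x ∈ E → m ≤ R ∧ c < ballAverage m h x := by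
    intro x
    by_cases hx : x ∈ E
    · obtain ⟨m, hm⟩ := hx
      exact ⟨m, fun _ => hm⟩
    · exact ⟨0, fun h => absurd h hx⟩
  choose m hm using hex
  obtain ⟨u, hu, hdisj, hcov⟩ := Vitali.exists_disjoint_subfamily_covering_enlargement_closedBall
    E (fun x : Rd d => x) (fun x => (2 : ℝ) ^ m x) ((2 : ℝ) ^ R)
    (fun a ha => zpow_le_zpow_right₀ (by norm_num) (hm a ha).1) 4 (by norm_num)
  have hcount : u.Countable := hdisj.countable_of_nonempty_interior fun i _ =>
    ⟨i, mem_interior_iff_mem_nhds.2 (Metric.closedBall_mem_nhds _ (by positivity))⟩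
  have hsub : E ⊆ ⋃ b ∈ u, Metric.closedBall b (4 * (2 : ℝ) ^ m b) := by
    intro x hx
    obtain ⟨b, hb, hb'⟩ := hcov x hx
    exact Set.mem_biUnion hb (hb' (Metric.mem_closedBall_self (by positivity)))
  have hball : ∀ b ∈ u, c * volume (Metric.closedBall b (4 * (2 : ℝ) ^ m b)) ≤
      ENNReal.ofReal (4 ^ d) * ∫⁻ y in Metric.closedBall b ((2 : ℝ) ^ m b), h y := by
    intro b hb
    rw [Measure.addHaar_closedBall_mul _ _ (by norm_num) (by positivity), finrank_euclideanSpace,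
      Fintype.card_fin, mul_left_comm]
    gcongr
    have h1 := (hm b (hu hb)).2.le
    rw [ballAverage, mul_comm, ← div_eq_mul_inv] at h1
    exact (ENNReal.le_div_iff_mul_le (Or.inl (volume_closedBall_two_zpow_pos _).ne')
      (Or.inl (volume_closedBall_two_zpow_ne_top _ _))).1 h1
  calc c * volume E ≤ c * ∑' b : u, volume (Metric.closedBall (b : Rd d) (4 * (2 : ℝ) ^ m b)) := by
        gcongr
        exact (measure_mono hsub).trans (measure_biUnion_le _ hcount _)
    _ = ∑' b : u, c * volume (Metric.closedBall (b : Rd d) (4 * (2 : ℝ) ^ m b)) :=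
        ENNReal.tsum_mul_left.symm
    _ ≤ ∑' b : u, ENNReal.ofReal (4 ^ d) *
          ∫⁻ y in Metric.closedBall (b : Rd d) ((2 : ℝ) ^ m b), h y :=
        ENNReal.tsum_le_tsum fun b => hball b b.2
    _ = ENNReal.ofReal (4 ^ d) * ∫⁻ y in ⋃ b ∈ u, Metric.closedBall b ((2 : ℝ) ^ m b), h y := by
        rw [ENNReal.tsum_mul_left, lintegral_biUnion hcount
          (fun b _ => Metric.isClosed_closedBall.measurableSet) hdisj]
    _ ≤ ENNReal.ofReal (4 ^ d) * ∫⁻ y, h y := by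
        exact mul_le_mul_right (setLIntegral_le_lintegral _ _) _

/-- The weak type `(1, 1)` inequality for the maximal function. -/
theorem volume_lt_maximal_le {d : ℕ} (h : Rd d → ℝ≥0∞) (c : ℝ≥0∞) :
    c * volume {x | c < maximal h x} ≤ ENNReal.ofReal (4 ^ d) * ∫⁻ y, h y := by
  have e : {x | c < maximal h x} = ⋃ R : ℤ, {x | ∃ m ≤ R, c < ballAverage m h x} := by
    ext x
    simp only [maximal, lt_iSup_iff, Set.mem_ofPred_eq, Set.mem_iUnion]
    exact ⟨fun ⟨m, hm⟩ => ⟨m, m, le_rfl, hm⟩, fun ⟨_, m, _, hm⟩ => ⟨m, hm⟩⟩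
  have hmono : Monotone fun R : ℤ => {x | ∃ m ≤ R, c < ballAverage m h x} :=
    fun R S hRS x ⟨m, hm, hx⟩ => ⟨m, hm.trans hRS, hx⟩
  rw [e, hmono.measure_iUnion, ENNReal.mul_iSup]
  exact iSup_le fun R => volume_lt_ballAverage_le h R c

/-- The part of h below height c adds at most c to any average. This truncation drives the
interpolation between the weak type (1, 1) bound and the trivial L_∞ bound. -/
theorem maximal_le_maximal_indicator_add {d : ℕ} {h : Rd d → ℝ≥0∞} (hh : Measurable h) (c : ℝ≥0∞)
    (x : Rd d) :
    maximal h x ≤ maximal ({y | c < h y}.indicator h) x + c := by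
  refine iSup_le fun m => ?_
  refine le_trans ?_ (add_le_add_left (le_iSup (fun m => ballAverage m _ x) m) c)
  unfold ballAverage
  have h1 : ∫⁻ y in Metric.closedBall x ((2 : ℝ) ^ m), h y ≤
      (∫⁻ y in Metric.closedBall x ((2 : ℝ) ^ m), {y | c < h y}.indicator h y) +
        c * volume (Metric.closedBall (0 : Rd d) ((2 : ℝ) ^ m)) := by
    have : c * volume (Metric.closedBall (0 : Rd d) ((2 : ℝ) ^ m)) =
        ∫⁻ y in Metric.closedBall x ((2 : ℝ) ^ m), c := by
      rw [setLIntegral_const, Measure.addHaar_closedBall_center volume x]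
    rw [this, ← lintegral_add_left (hh.indicator (measurableSet_lt measurable_const hh))]
    refine lintegral_mono fun y => ?_
    by_cases hy : c < h y
    · simp [Set.indicator, hy]
    · simp [Set.indicator, hy, not_lt.1 hy]
  calc _ ≤ (volume (Metric.closedBall (0 : Rd d) ((2 : ℝ) ^ m)))⁻¹ *
      ((∫⁻ y in Metric.closedBall x ((2 : ℝ) ^ m), {y | c < h y}.indicator h y) +
        c * volume (Metric.closedBall (0 : Rd d) ((2 : ℝ) ^ m))) := by gcongr
    _ = _ := by
      rw [mul_add, mul_left_comm, ENNReal.inv_mul_cancel (volume_closedBall_two_zpow_pos m).ne'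
        (volume_closedBall_two_zpow_ne_top 0 m), mul_one]

/-- The layer cake formula for powers of a single extended non-negative number. -/
theorem ofReal_mul_lintegral_rpow_eq_rpow (a : ℝ≥0∞) {b : ℝ} (hb : 0 < b) :
    ENNReal.ofReal b * ∫⁻ s in Set.Ioi (0 : ℝ), {s : ℝ | ENNReal.ofReal s < a}.indicator
      (fun s => ENNReal.ofReal (s ^ (b - 1))) s = a ^ b := by
  have key : ∀ a : ℝ≥0, ENNReal.ofReal b * ∫⁻ s in Set.Ioi (0 : ℝ),
      {s : ℝ | ENNReal.ofReal s < a}.indicator (fun s => ENNReal.ofReal (s ^ (b - 1))) s =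
        (a : ℝ≥0∞) ^ b := by
    intro a
    -- The usual layer cake formula for a constant function on a one-point space.
    have h := lintegral_rpow_eq_lintegral_meas_lt_mul (Measure.dirac ())
      (f := fun _ => (a : ℝ)) (by simp [Filter.EventuallyLE]) aemeasurable_const hb
    rw [lintegral_dirac] at h
    rw [← ENNReal.ofReal_coe_nnreal, ENNReal.ofReal_rpow_of_nonneg a.coe_nonneg hb.le]
    refine Eq.trans ?_ h.symm
    congr 1
    refine setLIntegral_congr_fun measurableSet_Ioi fun s (hs : 0 < s) => ?_
    by_cases hsa : s < a
    · have : ENNReal.ofReal s < ENNReal.ofReal a := (ENNReal.ofReal_lt_ofReal_iff_of_nonneg hs.le).2 hsa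
      simp only [Set.indicator, Set.mem_ofPred_eq, this, if_true, hsa, Set.ofPred_true]
      simp
    · have : ¬ ENNReal.ofReal s < ENNReal.ofReal a := by
        rw [ENNReal.ofReal_lt_ofReal_iff_of_nonneg hs.le]; exact hsa
      simp only [Set.indicator, Set.mem_ofPred_eq, this, if_false, hsa, Set.ofPred_false]
      simp
  induction a with
  | coe a => exact key a
  | top =>
    rw [ENNReal.top_rpow_of_pos hb, eq_top_iff]
    refine ENNReal.le_of_forall_nnreal_lt fun r _ => ?_
    have h1 := key (r ^ (1 / b))
    rw [← ENNReal.coe_rpow_of_nonneg _ hb.le, ← NNReal.rpow_mul, one_div_mul_cancel hb.ne',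
      NNReal.rpow_one] at h1
    rw [← h1]
    gcongr
    exact le_top

/-- The strong type inequality for the maximal function. -/
theorem exists_lintegral_maximal_rpow_le (d : ℕ) {w : ℝ} (hw : 1 < w) :
    ∃ C : ℝ≥0, ∀ h : Rd d → ℝ≥0∞, Measurable h →
      ∫⁻ x, maximal h x ^ w ≤ C * ∫⁻ x, h x ^ w := by
  have hw0 : 0 < w := by linarith
  have hw1 : 0 < w - 1 := by linarith
  refine ⟨(w.toNNReal * (2 * (4 ^ d : ℝ).toNNReal)) * ((w - 1).toNNReal⁻¹ * 2 ^ (w - 1)),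
    fun h hh => ?_⟩
  set A : ℝ≥0∞ := ENNReal.ofReal (4 ^ d) with hA
  -- Marcinkiewicz: the weak type bound at height s/2 is applied to the part of h above s/2, whose
  -- support is {s < 2h}. It absorbs one factor s, which leaves s^(w-2); integrating in s then
  -- yields (2h)^(w-1)/(w-1).
  have weak : ∀ s : ℝ, 0 < s → ENNReal.ofReal (s ^ (w - 1)) *
      volume {x | ENNReal.ofReal s < maximal h x} ≤
      ∫⁻ x, (2 * A) * (h x * {s : ℝ | ENNReal.ofReal s < 2 * h x}.indicator
        (fun s => ENNReal.ofReal (s ^ (w - 1 - 1))) s) := by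
    intro s hs
    have hs2 : ENNReal.ofReal s = ENNReal.ofReal (s / 2) + ENNReal.ofReal (s / 2) := by
      rw [← ENNReal.ofReal_add (by positivity) (by positivity)]; congr 1; ring
    set g := {y | ENNReal.ofReal (s / 2) < h y}.indicator h with hg
    have h1 : {x | ENNReal.ofReal s < maximal h x} ⊆ {x | ENNReal.ofReal (s / 2) < maximal g x} := by
      intro x hx
      simp only [Set.mem_ofPred_eq] at hx ⊢
      have := hx.trans_le (maximal_le_maximal_indicator_add hh (ENNReal.ofReal (s / 2)) x)
      rw [hs2] at this
      exact lt_of_add_lt_add_right this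
    have h2 := volume_lt_maximal_le g (ENNReal.ofReal (s / 2))
    have h3 : ENNReal.ofReal (s ^ (w - 1)) =
        (ENNReal.ofReal (s ^ (w - 1 - 1)) * 2) * ENNReal.ofReal (s / 2) := by
      rw [show (2 : ℝ≥0∞) = ENNReal.ofReal 2 by simp, ← ENNReal.ofReal_mul (by positivity),
        ← ENNReal.ofReal_mul (by positivity)]
      congr 1
      rw [mul_assoc, mul_div_cancel₀ _ two_ne_zero, Real.rpow_sub_one hs.ne' (w - 1)]
      field_simp
    have h4 : ∀ x, ENNReal.ofReal (s / 2) < h x ↔ ENNReal.ofReal s < 2 * h x := by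
      intro x
      rw [show ENNReal.ofReal s = 2 * ENNReal.ofReal (s / 2) by rw [hs2, two_mul]]
      exact (ENNReal.mul_lt_mul_iff_right (by norm_num) (by norm_num)).symm
    calc ENNReal.ofReal (s ^ (w - 1)) * volume {x | ENNReal.ofReal s < maximal h x}
        ≤ (ENNReal.ofReal (s ^ (w - 1 - 1)) * 2) * (ENNReal.ofReal (s / 2) *
            volume {x | ENNReal.ofReal (s / 2) < maximal g x}) := by
          rw [h3, mul_assoc (_ * (2 : ℝ≥0∞))]
          gcongr
      _ ≤ (ENNReal.ofReal (s ^ (w - 1 - 1)) * 2) * (A * ∫⁻ y, g y) := by gcongr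
      _ = ∫⁻ y, (2 * A) * (g y * ENNReal.ofReal (s ^ (w - 1 - 1))) := by
          have hgm : Measurable g := hh.indicator (measurableSet_lt measurable_const hh)
          rw [lintegral_const_mul _ (hgm.mul_const _), lintegral_mul_const _ hgm]
          ring
      _ = _ := by
          refine lintegral_congr fun x => ?_
          by_cases hx : ENNReal.ofReal (s / 2) < h x
          · simp [hg, Set.indicator, hx, (h4 x).1 hx]
          · simp [hg, Set.indicator, hx, (h4 x).not.1 hx]
  have meas1 : Measurable (Function.uncurry fun (x : Rd d) (s : ℝ) =>
      {s : ℝ | ENNReal.ofReal s < maximal h x}.indicator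
        (fun s => ENNReal.ofReal (s ^ (w - 1))) s) := by
    have : (Function.uncurry fun (x : Rd d) (s : ℝ) =>
      {s : ℝ | ENNReal.ofReal s < maximal h x}.indicator
        (fun s => ENNReal.ofReal (s ^ (w - 1))) s) =
      {z : Rd d × ℝ | ENNReal.ofReal z.2 < maximal h z.1}.indicator
        (fun z => ENNReal.ofReal (z.2 ^ (w - 1))) := by
      ext ⟨x, s⟩; simp [Set.indicator]
    rw [this]
    exact Measurable.indicator (by fun_prop) (measurableSet_lt (by fun_prop)
      ((measurable_maximal hh).comp measurable_fst))
  have meas2 : Measurable (Function.uncurry fun (s : ℝ) (x : Rd d) =>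
      (2 * A) * (h x * {s : ℝ | ENNReal.ofReal s < 2 * h x}.indicator
        (fun s => ENNReal.ofReal (s ^ (w - 1 - 1))) s)) := by
    have : (Function.uncurry fun (s : ℝ) (x : Rd d) =>
      (2 * A) * (h x * {s : ℝ | ENNReal.ofReal s < 2 * h x}.indicator
        (fun s => ENNReal.ofReal (s ^ (w - 1 - 1))) s)) = fun z : ℝ × Rd d => (2 * A) * (h z.2 *
      {z : ℝ × Rd d | ENNReal.ofReal z.1 < 2 * h z.2}.indicator
        (fun z => ENNReal.ofReal (z.1 ^ (w - 1 - 1))) z) := by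
      ext ⟨s, x⟩; simp [Set.indicator]
    rw [this]
    refine Measurable.const_mul (Measurable.mul (by fun_prop) (Measurable.indicator (by fun_prop) ?_)) _
    exact measurableSet_lt (by fun_prop) (by fun_prop)
  calc ∫⁻ x, maximal h x ^ w
      = ENNReal.ofReal w * ∫⁻ x, ∫⁻ s in Set.Ioi (0 : ℝ),
          {s : ℝ | ENNReal.ofReal s < maximal h x}.indicator
            (fun s => ENNReal.ofReal (s ^ (w - 1))) s := by
        refine Eq.trans ?_ (lintegral_const_mul _ (meas1.lintegral_prod_right'))
        exact lintegral_congr fun x => (ofReal_mul_lintegral_rpow_eq_rpow _ hw0).symm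
    _ = ENNReal.ofReal w * ∫⁻ s in Set.Ioi (0 : ℝ), ENNReal.ofReal (s ^ (w - 1)) *
          volume {x | ENNReal.ofReal s < maximal h x} := by
        rw [lintegral_lintegral_swap meas1.aemeasurable]
        congr 1
        refine lintegral_congr fun s => ?_
        have : ∀ x : Rd d, {s : ℝ | ENNReal.ofReal s < maximal h x}.indicator
            (fun s => ENNReal.ofReal (s ^ (w - 1))) s = {x | ENNReal.ofReal s < maximal h x}.indicator
            (fun _ => ENNReal.ofReal (s ^ (w - 1))) x := fun x => by simp [Set.indicator]
        simp_rw [this]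
        rw [lintegral_indicator_const (measurableSet_lt measurable_const (measurable_maximal hh))]
    _ ≤ ENNReal.ofReal w * ∫⁻ s in Set.Ioi (0 : ℝ), ∫⁻ x, (2 * A) *
          (h x * {s : ℝ | ENNReal.ofReal s < 2 * h x}.indicator
            (fun s => ENNReal.ofReal (s ^ (w - 1 - 1))) s) := by
        exact mul_le_mul_right (setLIntegral_mono (meas2.lintegral_prod_right')
          fun s hs => weak s hs) _
    _ = ENNReal.ofReal w * ∫⁻ x, (2 * A) * (h x * ((ENNReal.ofReal (w - 1))⁻¹ *
          (2 * h x) ^ (w - 1))) := by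
        rw [lintegral_lintegral_swap meas2.aemeasurable]
        congr 1
        refine lintegral_congr fun x => ?_
        have hm : Measurable fun s : ℝ => {s : ℝ | ENNReal.ofReal s < 2 * h x}.indicator
            (fun s => ENNReal.ofReal (s ^ (w - 1 - 1))) s :=
          Measurable.indicator (by fun_prop) (measurableSet_lt (by fun_prop) measurable_const)
        rw [lintegral_const_mul _ (hm.const_mul _), lintegral_const_mul _ hm,
          ← ofReal_mul_lintegral_rpow_eq_rpow (2 * h x) hw1, ← mul_assoc (ENNReal.ofReal (w - 1))⁻¹,
          ENNReal.inv_mul_cancel (by simpa using hw1) ENNReal.ofReal_ne_top, one_mul]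
    _ = (ENNReal.ofReal w * (2 * A)) * ((ENNReal.ofReal (w - 1))⁻¹ * 2 ^ (w - 1)) *
          ∫⁻ x, h x ^ w := by
        rw [← lintegral_const_mul _ (by fun_prop), ← lintegral_const_mul _ (by fun_prop)]
        refine lintegral_congr fun x => ?_
        rw [ENNReal.mul_rpow_of_nonneg _ _ hw1.le]
        have : h x ^ w = h x * h x ^ (w - 1) := by
          conv_lhs => rw [show w = 1 + (w - 1) by ring]
          rw [ENNReal.rpow_add_of_nonneg _ _ zero_le_one hw1.le, ENNReal.rpow_one]
        rw [this]
        ring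
    _ = _ := by
        push_cast
        rw [ENNReal.coe_inv (by simpa using hw1), ENNReal.coe_rpow_of_nonneg _ hw1.le]
        rfl

/-! ### Polynomially decaying kernels at dyadic scales -/

/-- The weight `1 + 2^n ‖y‖`. -/
def weight {d : ℕ} (n : ℕ) (y : Rd d) : ℝ≥0∞ := 1 + 2 ^ n * ‖y‖ₑ

/-- The kernel `2^(nd) (1 + 2^n ‖y‖)^(-b)`. -/
def kernel {d : ℕ} (n : ℕ) (b : ℝ) (y : Rd d) : ℝ≥0∞ := 2 ^ (n * d) * weight n y ^ (-b)

/-- The convolution of `h` with the kernel `2^(nd) (1 + 2^n ‖y‖)^(-b)`. -/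
def kernelConv {d : ℕ} (n : ℕ) (b : ℝ) (h : Rd d → ℝ≥0∞) (x : Rd d) : ℝ≥0∞ :=
  ∫⁻ y, kernel n b (x - y) * h y

theorem one_le_weight {d : ℕ} (n : ℕ) (y : Rd d) : 1 ≤ weight n y := le_self_add

theorem weight_ne_zero {d : ℕ} (n : ℕ) (y : Rd d) : weight n y ≠ 0 :=
  (zero_lt_one.trans_le (one_le_weight n y)).ne'

theorem weight_ne_top {d : ℕ} (n : ℕ) (y : Rd d) : weight n y ≠ ⊤ := by
  simp [weight, ENNReal.mul_eq_top]

theorem weight_eq_ofReal {d : ℕ} (n : ℕ) (y : Rd d) :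
    weight n y = ENNReal.ofReal (1 + 2 ^ n * ‖y‖) := by
  rw [weight, ENNReal.ofReal_add zero_le_one (by positivity), ENNReal.ofReal_mul (by positivity),
    ofReal_norm, ENNReal.ofReal_one, ENNReal.ofReal_pow (by norm_num)]
  simp

theorem weight_neg {d : ℕ} (n : ℕ) (y : Rd d) : weight n (-y) = weight n y := by
  simp [weight]

theorem weight_sub_comm {d : ℕ} (n : ℕ) (x y : Rd d) : weight n (x - y) = weight n (y - x) := by
  rw [← weight_neg, neg_sub]

theorem weight_add_le {d : ℕ} (n : ℕ) (x y : Rd d) :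
    weight n (x + y) ≤ weight n x * weight n y := by
  unfold weight
  calc 1 + 2 ^ n * ‖x + y‖ₑ ≤ 1 + 2 ^ n * (‖x‖ₑ + ‖y‖ₑ) := by gcongr; exact enorm_add_le _ _
    _ ≤ 1 + 2 ^ n * (‖x‖ₑ + ‖y‖ₑ) + (2 ^ n * ‖x‖ₑ) * (2 ^ n * ‖y‖ₑ) := le_self_add
    _ = _ := by ring

theorem measurable_weight {d : ℕ} (n : ℕ) : Measurable (weight (d := d) n) := by
  unfold weight; fun_prop

theorem measurable_kernel {d : ℕ} (n : ℕ) (b : ℝ) : Measurable (kernel (d := d) n b) :=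
  ((measurable_weight n).pow_const _).const_mul _

theorem measurable_kernel_mul {d : ℕ} (n : ℕ) (b : ℝ) {h : Rd d → ℝ≥0∞} (hh : Measurable h) :
    Measurable (Function.uncurry fun x y : Rd d => kernel n b (x - y) * h y) :=
  ((measurable_kernel n b).comp (measurable_fst.sub measurable_snd)).mul (hh.comp measurable_snd)

theorem measurable_kernelConv {d : ℕ} (n : ℕ) (b : ℝ) {h : Rd d → ℝ≥0∞} (hh : Measurable h) :
    Measurable (kernelConv n b h) :=
  (measurable_kernel_mul n b hh).lintegral_prod_right'

theorem kernelConv_mono {d : ℕ} (n : ℕ) (b : ℝ) {g h : Rd d → ℝ≥0∞} (hgh : g ≤ h) (x : Rd d) :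
    kernelConv n b g x ≤ kernelConv n b h x :=
  lintegral_mono fun y => mul_le_mul_right (hgh y) _

theorem kernel_sub_comm {d : ℕ} (n : ℕ) (b : ℝ) (x y : Rd d) :
    kernel n b (x - y) = kernel n b (y - x) := by
  rw [kernel, weight_sub_comm]; rfl

theorem lintegral_comp_two_pow_smul {d : ℕ} (n : ℕ) {f : Rd d → ℝ≥0∞} (hf : Measurable f) :
    (2 : ℝ≥0∞) ^ (n * d) * ∫⁻ y, f ((2 : ℝ) ^ n • y) = ∫⁻ y, f y := by
  have h := Measure.map_addHaar_smul (volume : Measure (Rd d)) (r := (2 : ℝ) ^ n) (by positivity)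
  have h2 : ∫⁻ y, f ((2 : ℝ) ^ n • y) = ∫⁻ y, f y ∂(Measure.map (fun x => (2 : ℝ) ^ n • x) volume) :=
    (lintegral_map hf (by fun_prop)).symm
  rw [h2, h, lintegral_smul_measure, smul_eq_mul, ← mul_assoc, finrank_euclideanSpace,
    Fintype.card_fin, abs_of_nonneg (by positivity), ENNReal.ofReal_inv_of_pos (by positivity),
    ← pow_mul, ENNReal.ofReal_pow (by norm_num), ENNReal.ofReal_ofNat,
    ENNReal.mul_inv_cancel (by positivity) (by finiteness), one_mul]

theorem weight_eq_weight_zero {d : ℕ} (n : ℕ) (y : Rd d) :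
    weight n y = weight 0 ((2 : ℝ) ^ n • y) := by
  have : ‖(2 : ℝ)‖ₑ = 2 := by rw [Real.enorm_of_nonneg zero_le_two, ENNReal.ofReal_ofNat]
  simp [weight, enorm_smul, enorm_pow, this]

theorem lintegral_kernel {d : ℕ} (n : ℕ) (b : ℝ) :
    ∫⁻ y : Rd d, kernel n b y = ∫⁻ y : Rd d, weight 0 y ^ (-b) := by
  unfold kernel
  rw [lintegral_const_mul _ ((measurable_weight n).pow_const _),
    ← lintegral_comp_two_pow_smul n ((measurable_weight 0).pow_const _)]
  simp_rw [← weight_eq_weight_zero]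

theorem lintegral_weight_rpow_lt_top {d : ℕ} {b : ℝ} (hb : d < b) :
    ∫⁻ y : Rd d, weight 0 y ^ (-b) < ⊤ := by
  refine lt_of_eq_of_lt (lintegral_congr fun y => ?_)
    (finite_integral_one_add_norm (E := Rd d) (μ := volume) (r := b) (by simpa using hb))
  rw [weight_eq_ofReal, ENNReal.ofReal_rpow_of_pos (by positivity)]
  simp

theorem lintegral_kernel_sub {d : ℕ} (n : ℕ) (b : ℝ) (x : Rd d) :
    ∫⁻ y : Rd d, kernel n b (x - y) = ∫⁻ y : Rd d, weight 0 y ^ (-b) := by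
  rw [lintegral_sub_left_eq_self (kernel n b) x, lintegral_kernel]

/-- The kernel is even, so Tonelli gives self-adjointness. The maximal function has no such
property, which is why the vector-valued inequality is stated for convolutions. -/
theorem lintegral_kernelConv_mul {d : ℕ} (n : ℕ) (b : ℝ) {g h : Rd d → ℝ≥0∞} (hg : Measurable g)
    (hh : Measurable h) :
    ∫⁻ x, kernelConv n b g x * h x = ∫⁻ x, g x * kernelConv n b h x := by
  unfold kernelConv
  have e1 : ∀ x, (∫⁻ y, kernel n b (x - y) * g y) * h x = ∫⁻ y, kernel n b (x - y) * g y * h x :=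
    fun x => (lintegral_mul_const _ (by have := measurable_kernel (d := d) n b; fun_prop)).symm
  have e2 : ∀ y, g y * (∫⁻ x, kernel n b (y - x) * h x) = ∫⁻ x, kernel n b (x - y) * g y * h x := by
    intro y
    rw [← lintegral_const_mul _ (by have := measurable_kernel (d := d) n b; fun_prop)]
    refine lintegral_congr fun x => ?_
    rw [kernel_sub_comm]; ring
  simp_rw [e1, e2]
  refine lintegral_lintegral_swap (Measurable.aemeasurable ?_)
  exact (measurable_kernel_mul n b hg).mul (hh.comp measurable_fst)

theorem lintegral_kernelConv {d : ℕ} (n : ℕ) (b : ℝ) {g : Rd d → ℝ≥0∞} (hg : Measurable g) :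
    ∫⁻ x, kernelConv n b g x = (∫⁻ y : Rd d, weight 0 y ^ (-b)) * ∫⁻ x, g x := by
  have h := lintegral_kernelConv_mul n b hg (h := fun _ => 1) measurable_const
  simp only [mul_one] at h
  rw [h]
  have : ∀ x : Rd d, kernelConv n b (fun _ => 1) x = ∫⁻ y : Rd d, weight 0 y ^ (-b) := by
    intro x; simp only [kernelConv, mul_one]; exact lintegral_kernel_sub n b x
  simp_rw [this]
  rw [lintegral_mul_const _ hg, mul_comm]

/-- Jensen's inequality for the convolution with a kernel. -/
theorem kernelConv_rpow_le {d : ℕ} (n : ℕ) (b : ℝ) {g : Rd d → ℝ≥0∞} (hg : Measurable g) {v : ℝ}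
    (hv : 1 ≤ v) (x : Rd d) :
    kernelConv n b g x ^ v ≤
      (∫⁻ y : Rd d, weight 0 y ^ (-b)) ^ (v - 1) * kernelConv n b (fun y => g y ^ v) x := by
  rcases hv.eq_or_lt with rfl | hv
  · simp
  have hv0 : 0 < v := by linarith
  have hconj : (v / (v - 1)).HolderConjugate v :=
    (Real.HolderConjugate.conjExponent hv).symm
  have hw0 : 0 < v / (v - 1) := hconj.pos
  have mk : Measurable fun y : Rd d => kernel n b (x - y) := by
    have := measurable_kernel (d := d) n b; fun_prop
  -- Hölder with the kernel split as K = K^(1/v') K^(1/v); the first factor produces the power of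
  -- the total mass.
  have h1 := ENNReal.lintegral_mul_le_Lp_mul_Lq (volume : Measure (Rd d)) hconj
    (f := fun y => kernel n b (x - y) ^ (1 / (v / (v - 1))))
    (g := fun y => kernel n b (x - y) ^ (1 / v) * g y) (mk.pow_const _).aemeasurable
    ((mk.pow_const _).mul hg).aemeasurable
  have e1 : ∫⁻ y, ((fun y : Rd d => kernel n b (x - y) ^ (1 / (v / (v - 1)))) *
      (fun y : Rd d => kernel n b (x - y) ^ (1 / v) * g y) : Rd d → ℝ≥0∞) y =
        kernelConv n b g x := by
    refine lintegral_congr fun y => ?_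
    simp only [Pi.mul_apply]
    rw [← mul_assoc, ← ENNReal.rpow_add_of_nonneg _ _ (by positivity) (by positivity)]
    have := hconj.inv_add_inv_eq_one
    rw [one_div, one_div, this, ENNReal.rpow_one]
  have e2 : ∀ y, (kernel n b (x - y) ^ (1 / (v / (v - 1)))) ^ (v / (v - 1)) = kernel n b (x - y) := by
    intro y; rw [← ENNReal.rpow_mul, one_div_mul_cancel hw0.ne', ENNReal.rpow_one]
  have e3 : ∀ y, (kernel n b (x - y) ^ (1 / v) * g y) ^ v = kernel n b (x - y) * g y ^ v := by
    intro y
    rw [ENNReal.mul_rpow_of_nonneg _ _ hv0.le, ← ENNReal.rpow_mul, one_div_mul_cancel hv0.ne',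
      ENNReal.rpow_one]
  rw [e1] at h1
  simp_rw [e2, e3] at h1
  rw [lintegral_kernel_sub] at h1
  calc kernelConv n b g x ^ v ≤ ((∫⁻ y : Rd d, weight 0 y ^ (-b)) ^ (1 / (v / (v - 1))) *
        (kernelConv n b (fun y => g y ^ v) x) ^ (1 / v)) ^ v := by
        gcongr
        exact h1
    _ = _ := by
      rw [ENNReal.mul_rpow_of_nonneg _ _ hv0.le, ← ENNReal.rpow_mul, ← ENNReal.rpow_mul,
        one_div_mul_cancel hv0.ne', ENNReal.rpow_one]
      congr 2
      field_simp

/-- A single term suffices: the least m for which y lies in the ball of radius 2^(m-n) about x.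
Minimality gives weight at least 2^(m-1); for m = 0 the trivial lower bound 1 is more than enough.
-/
theorem kernel_le_tsum_indicator {d : ℕ} (n : ℕ) {b : ℝ} (hb : 0 ≤ b) (x y : Rd d) :
    kernel n b (x - y) ≤ ∑' m : ℕ, (2 : ℝ≥0∞) ^ (n * d) * (2 : ℝ≥0∞) ^ (-((m : ℝ) - 1) * b) *
      (Metric.closedBall x ((2 : ℝ) ^ ((m : ℤ) - n))).indicator 1 y := by
  have hex : ∃ m : ℕ, 2 ^ n * ‖x - y‖ ≤ 2 ^ m := pow_unbounded_of_one_lt _ one_lt_two |>.imp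
    fun m hm => hm.le
  set m := Nat.find hex with hm
  have h1 : 2 ^ n * ‖x - y‖ ≤ 2 ^ m := Nat.find_spec hex
  refine le_trans ?_ (ENNReal.le_tsum m)
  have hy : y ∈ Metric.closedBall x ((2 : ℝ) ^ ((m : ℤ) - n)) := by
    rw [Metric.mem_closedBall, dist_comm, dist_eq_norm, zpow_sub₀ two_ne_zero, zpow_natCast,
      zpow_natCast, le_div_iff₀ (by positivity), mul_comm]
    exact h1
  rw [Set.indicator_of_mem hy, Pi.one_apply, mul_one, kernel]
  gcongr
  have h2 : (2 : ℝ≥0∞) ^ ((m : ℝ) - 1) ≤ weight n (x - y) := by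
    rcases Nat.eq_zero_or_pos m with h0 | h0
    · refine le_trans ?_ (one_le_weight n _)
      rw [h0]
      exact ENNReal.rpow_le_one_of_one_le_of_neg one_le_two (by norm_num)
    · have h3 := Nat.find_min hex (m := m - 1) (by omega)
      rw [not_le] at h3
      have h4 : (m : ℝ) - 1 = ((m - 1 : ℕ) : ℝ) := by rw [Nat.cast_sub h0]; simp
      have h5 : (2 : ℝ≥0∞) ^ (m - 1) = ENNReal.ofReal (2 ^ (m - 1)) := by
        rw [ENNReal.ofReal_pow (by norm_num), ENNReal.ofReal_ofNat]
      rw [h4, ENNReal.rpow_natCast, weight_eq_ofReal, h5]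
      exact ENNReal.ofReal_le_ofReal (by linarith)
  rw [neg_mul, ENNReal.rpow_neg, ENNReal.rpow_neg, ENNReal.inv_le_inv, ENNReal.rpow_mul]
  exact ENNReal.rpow_le_rpow h2 hb

/-- Convolutions with the kernels are dominated by the maximal function, uniformly in the scale. -/
theorem exists_kernelConv_le_maximal (d : ℕ) {b : ℝ} (hb : d < b) :
    ∃ C : ℝ≥0, ∀ (n : ℕ) (h : Rd d → ℝ≥0∞), Measurable h → ∀ x,
      kernelConv n b h x ≤ C * maximal h x := by
  have hb0 : 0 ≤ b := (Nat.cast_nonneg d).trans hb.le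
  set V := volume (Metric.closedBall (0 : Rd d) 1) with hV
  have hVtop : V ≠ ⊤ := (isCompact_closedBall _ _).measure_lt_top.ne
  set C : ℝ≥0∞ := ∑' m : ℕ, 2 ^ b * V * (2 ^ ((d : ℝ) - b)) ^ m with hC
  -- The ball of index m has volume growing like 2^(md) against the kernel's decay 2^(-mb), so b > d
  -- makes the series geometric.
  have hCtop : C ≠ ⊤ := by
    rw [hC, ENNReal.tsum_mul_left, ENNReal.tsum_geometric]
    refine ENNReal.mul_ne_top (ENNReal.mul_ne_top (by finiteness) hVtop) ?_
    rw [ENNReal.inv_ne_top]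
    have : (2 : ℝ≥0∞) ^ ((d : ℝ) - b) < 1 :=
      ENNReal.rpow_lt_one_of_one_lt_of_neg ENNReal.one_lt_two (by linarith)
    exact (tsub_pos_iff_lt.2 this).ne'
  refine ⟨C.toNNReal, fun n h hh x => ?_⟩
  rw [ENNReal.coe_toNNReal hCtop]
  have hvol : ∀ m : ℕ, volume (Metric.closedBall (0 : Rd d) ((2 : ℝ) ^ ((m : ℤ) - n))) =
      (2 : ℝ≥0∞) ^ (m * (d : ℝ)) * ((2 : ℝ≥0∞) ^ (n * d))⁻¹ * V := by
    intro m
    rw [← mul_one ((2 : ℝ) ^ ((m : ℤ) - n)), Measure.addHaar_closedBall_mul _ _ (by positivity)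
      zero_le_one, finrank_euclideanSpace, Fintype.card_fin, zpow_sub₀ two_ne_zero, zpow_natCast,
      zpow_natCast, div_pow, ENNReal.ofReal_div_of_pos (by positivity), ← pow_mul, ← pow_mul,
      ENNReal.ofReal_pow (by norm_num), ENNReal.ofReal_pow (by norm_num), ENNReal.ofReal_ofNat,
      ← Nat.cast_mul, ENNReal.rpow_natCast, div_eq_mul_inv]
  calc kernelConv n b h x
      ≤ ∫⁻ y, ∑' m : ℕ, (2 : ℝ≥0∞) ^ (n * d) * (2 : ℝ≥0∞) ^ (-((m : ℝ) - 1) * b) *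
          (Metric.closedBall x ((2 : ℝ) ^ ((m : ℤ) - n))).indicator h y := by
        refine lintegral_mono fun y => ?_
        refine (mul_le_mul_left (kernel_le_tsum_indicator n hb0 x y) _).trans ?_
        rw [← ENNReal.tsum_mul_right]
        refine ENNReal.tsum_le_tsum fun m => ?_
        rw [mul_assoc]
        gcongr
        by_cases hy : y ∈ Metric.closedBall x ((2 : ℝ) ^ ((m : ℤ) - n))
        · rw [Set.indicator_of_mem hy, Set.indicator_of_mem hy]; simp
        · rw [Set.indicator_of_notMem hy, Set.indicator_of_notMem hy]; simp
    _ = ∑' m : ℕ, (2 : ℝ≥0∞) ^ (n * d) * (2 : ℝ≥0∞) ^ (-((m : ℝ) - 1) * b) *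
          ∫⁻ y in Metric.closedBall x ((2 : ℝ) ^ ((m : ℤ) - n)), h y := by
        rw [lintegral_tsum]
        · refine tsum_congr fun m => ?_
          rw [lintegral_const_mul _ (hh.indicator Metric.isClosed_closedBall.measurableSet),
            lintegral_indicator Metric.isClosed_closedBall.measurableSet]
        · intro m
          exact ((hh.indicator Metric.isClosed_closedBall.measurableSet).const_mul _).aemeasurable
    _ ≤ ∑' m : ℕ, 2 ^ b * V * (2 ^ ((d : ℝ) - b)) ^ m * maximal h x := by
        refine ENNReal.tsum_le_tsum fun m => ?_
        have h1 : ∫⁻ y in Metric.closedBall x ((2 : ℝ) ^ ((m : ℤ) - n)), h y ≤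
            (2 : ℝ≥0∞) ^ (m * (d : ℝ)) * ((2 : ℝ≥0∞) ^ (n * d))⁻¹ * V * maximal h x := by
          rw [← hvol]
          have h2 : ballAverage ((m : ℤ) - n) h x ≤ maximal h x := le_iSup (fun m => ballAverage m h x) _
          rw [ballAverage] at h2
          rw [mul_comm, ← ENNReal.div_le_iff_le_mul (Or.inl (volume_closedBall_two_zpow_pos _).ne')
            (Or.inl (volume_closedBall_two_zpow_ne_top _ _)), div_eq_mul_inv, mul_comm]
          exact h2
        refine (mul_le_mul_right h1 _).trans (le_of_eq ?_)
        have e1 : (2 : ℝ≥0∞) ^ (n * d) * ((2 : ℝ≥0∞) ^ (n * d))⁻¹ = 1 :=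
          ENNReal.mul_inv_cancel (by positivity) (by finiteness)
        have e2 : (2 : ℝ≥0∞) ^ (-((m : ℝ) - 1) * b) * (2 : ℝ≥0∞) ^ (m * (d : ℝ)) =
            2 ^ b * (2 ^ ((d : ℝ) - b)) ^ m := by
          rw [← ENNReal.rpow_natCast, ← ENNReal.rpow_mul, ← ENNReal.rpow_add _ _ two_ne_zero
            ENNReal.ofNat_ne_top, ← ENNReal.rpow_add _ _ two_ne_zero ENNReal.ofNat_ne_top]
          congr 1; ring
        calc _ = ((2 : ℝ≥0∞) ^ (n * d) * ((2 : ℝ≥0∞) ^ (n * d))⁻¹) *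
              ((2 : ℝ≥0∞) ^ (-((m : ℝ) - 1) * b) * (2 : ℝ≥0∞) ^ (m * (d : ℝ))) * V * maximal h x := by
              ring
          _ = _ := by rw [e1, e2]; ring
    _ = C * maximal h x := by rw [ENNReal.tsum_mul_right]

/-! ### A vector-valued maximal inequality of Fefferman-Stein type -/

/-- Absorption: the factor I^(1/u') is divided out, which is legitimate only because I is finite.
Both duality arguments below end this way. -/
theorem le_rpow_of_le_mul_rpow {I B : ℝ≥0∞} {u u' : ℝ} (huu : u.HolderConjugate u') (hI : I ≠ ⊤)
    (h : I ≤ B * I ^ (1 / u')) : I ≤ B ^ u := by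
  rcases eq_or_ne I 0 with rfl | hI0
  · exact zero_le
  have hu := huu.pos
  have hu' := huu.symm.pos
  have h1 : I ^ (1 / u) ≤ B := by
    have h2 : I ^ (1 / u) * I ^ (1 / u') ≤ B * I ^ (1 / u') := by
      rw [← ENNReal.rpow_add_of_nonneg _ _ (by positivity) (by positivity), one_div, one_div,
        huu.inv_add_inv_eq_one, ENNReal.rpow_one]
      simpa using h
    exact (ENNReal.mul_le_mul_iff_left (by simp [hI0, hI]) (by
      exact ENNReal.rpow_ne_top_of_nonneg (by positivity) hI)).1 h2
  calc I = (I ^ (1 / u)) ^ u := by rw [← ENNReal.rpow_mul, one_div_mul_cancel hu.ne', ENNReal.rpow_one]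
    _ ≤ B ^ u := ENNReal.rpow_le_rpow h1 hu.le

theorem sum_rpow_le {ι : Type*} (A : Finset ι) (y : ι → ℝ≥0∞) {s : ℝ} (hs : 0 < s) :
    (∑ k ∈ A, y k) ^ s ≤ (A.card : ℝ≥0∞) ^ s * ∑ k ∈ A, y k ^ s := by
  rcases A.eq_empty_or_nonempty with rfl | hA
  · simp [hs]
  obtain ⟨m, hm, hmax⟩ := A.exists_max_image y hA
  calc (∑ k ∈ A, y k) ^ s ≤ (A.card * y m) ^ s := by
        gcongr
        simpa using Finset.sum_le_card_nsmul A y (y m) hmax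
    _ = (A.card : ℝ≥0∞) ^ s * y m ^ s := ENNReal.mul_rpow_of_nonneg _ _ hs.le
    _ ≤ _ := by
        gcongr
        exact Finset.single_le_sum (f := fun k => y k ^ s) (fun _ _ => zero_le) hm

theorem lintegral_kernelConv_rpow_le {d : ℕ} (n : ℕ) (b : ℝ) {g : Rd d → ℝ≥0∞} (hg : Measurable g)
    {v : ℝ} (hv : 1 ≤ v) :
    ∫⁻ x, kernelConv n b g x ^ v ≤ (∫⁻ y : Rd d, weight 0 y ^ (-b)) ^ v * ∫⁻ x, g x ^ v := by
  have hgv : Measurable fun x => g x ^ v := hg.pow_const _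
  calc _ ≤ ∫⁻ x, (∫⁻ y : Rd d, weight 0 y ^ (-b)) ^ (v - 1) *
        kernelConv n b (fun y => g y ^ v) x := lintegral_mono fun x => kernelConv_rpow_le n b hg hv x
    _ = (∫⁻ y : Rd d, weight 0 y ^ (-b)) ^ v * ∫⁻ x, g x ^ v := by
      rw [lintegral_const_mul _ (measurable_kernelConv n b hgv), lintegral_kernelConv n b hgv,
        ← mul_assoc]
      congr 1
      nth_rewrite 2 [← ENNReal.rpow_one (∫⁻ y : Rd d, weight 0 y ^ (-b))]
      rw [← ENNReal.rpow_add_of_nonneg _ _ (by linarith) zero_le_one]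
      congr 1; ring

/-- Qualitative only: the implied bound depends on the number of terms. It supplies the finiteness
needed for absorption. -/
theorem lintegral_sum_kernelConv_lt_top {d : ℕ} {b u v : ℝ} (hb : d < b) (hu : 1 ≤ u) (hv : 0 < v)
    {ι : Type*} (A : Finset ι) (n : ι → ℕ) {g : ι → Rd d → ℝ≥0∞} (hg : ∀ k, Measurable (g k))
    (hfin : ∫⁻ x, (∑ k ∈ A, g k x ^ v) ^ (u / v) < ⊤) :
    ∫⁻ x, (∑ k ∈ A, kernelConv (n k) b (g k) x ^ v) ^ (u / v) < ⊤ := by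
  have hu0 : 0 < u := by linarith
  have hmeas : ∀ k, Measurable fun x => kernelConv (n k) b (g k) x ^ u :=
    fun k => (measurable_kernelConv (n k) b (hg k)).pow_const _
  have e : ∀ a : ℝ≥0∞, (a ^ v) ^ (u / v) = a ^ u := by
    intro a; rw [← ENNReal.rpow_mul, mul_div_cancel₀ _ hv.ne']
  calc _ ≤ ∫⁻ x, (A.card : ℝ≥0∞) ^ (u / v) * ∑ k ∈ A, kernelConv (n k) b (g k) x ^ u := by
        refine lintegral_mono fun x => (sum_rpow_le A _ (by positivity)).trans (le_of_eq ?_)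
        simp_rw [e]
    _ = (A.card : ℝ≥0∞) ^ (u / v) * ∑ k ∈ A, ∫⁻ x, kernelConv (n k) b (g k) x ^ u := by
        rw [lintegral_const_mul _ (Finset.measurable_fun_sum _ fun k _ => hmeas k),
          lintegral_finsetSum _ fun k _ => hmeas k]
    _ < ⊤ := by
        refine ENNReal.mul_lt_top (by simp [ENNReal.rpow_lt_top_of_nonneg, hu0.le, hv.le, div_nonneg]) ?_
        refine ENNReal.sum_lt_top.2 fun k hk => ?_
        refine (lintegral_kernelConv_rpow_le (n k) b (hg k) hu).trans_lt ?_
        refine ENNReal.mul_lt_top (ENNReal.rpow_lt_top_of_nonneg hu0.le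
          (lintegral_weight_rpow_lt_top hb).ne) (lt_of_le_of_lt ?_ hfin)
        refine lintegral_mono fun x => ?_
        rw [← e]
        gcongr
        exact Finset.single_le_sum (f := fun k => g k x ^ v) (fun _ _ => zero_le) hk

/-- The sum S of v-th powers is tested in L_(u/v) against its own extremal function S^(s-1), s = u/v
> 1. Jensen moves the power v inside the convolution, self-adjointness moves the convolution onto
the test function, and there it is bounded by the scalar maximal function, independently of k. -/
theorem exists_lintegral_sum_kernelConv_le_of_gt (d : ℕ) {b u v : ℝ} (hb : d < b) (hv : 1 ≤ v)
    (huv : v < u) :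
    ∃ C : ℝ≥0∞, C ≠ ⊤ ∧ ∀ {ι : Type} (A : Finset ι) (n : ι → ℕ) (g : ι → Rd d → ℝ≥0∞),
      (∀ k, Measurable (g k)) →
      ∫⁻ x, (∑ k ∈ A, kernelConv (n k) b (g k) x ^ v) ^ (u / v) ≤
        C * ∫⁻ x, (∑ k ∈ A, g k x ^ v) ^ (u / v) := by
  have hv0 : 0 < v := by linarith
  set s := u / v with hs_def
  have hs : 1 < s := (one_lt_div hv0).2 huv
  have hs0 : 0 < s := by linarith
  set s' := s.conjExponent with hs'_def
  have hconj : s.HolderConjugate s' := Real.HolderConjugate.conjExponent hs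
  have hs'1 : 1 < s' := hconj.symm.lt
  have hs'0 : 0 < s' := by linarith
  obtain ⟨C₁, hC₁⟩ := exists_kernelConv_le_maximal d hb
  obtain ⟨C₂, hC₂⟩ := exists_lintegral_maximal_rpow_le d hs'1
  set W := (∫⁻ y : Rd d, weight 0 y ^ (-b)) with hW
  have hWtop : W ≠ ⊤ := (lintegral_weight_rpow_lt_top hb).ne
  set D : ℝ≥0∞ := W ^ (v - 1) * C₁ * (C₂ : ℝ≥0∞) ^ (1 / s') with hD
  have hDtop : D ≠ ⊤ := by
    refine ENNReal.mul_ne_top (ENNReal.mul_ne_top ?_ ENNReal.coe_ne_top) ?_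
    · exact ENNReal.rpow_ne_top_of_nonneg (by linarith) hWtop
    · exact ENNReal.rpow_ne_top_of_nonneg (by positivity) ENNReal.coe_ne_top
  -- The summand 1 keeps the constant nonzero, so that the case of an infinite right-hand integral
  -- is trivial.
  refine ⟨(D ^ s) + 1, by simp [hDtop, ENNReal.rpow_eq_top_iff, hs0.not_gt], ?_⟩
  intro ι A n g hg
  by_cases hfin : ∫⁻ x, (∑ k ∈ A, g k x ^ v) ^ s = ⊤
  · rw [hfin, ENNReal.mul_top (by simp)]; exact le_top
  have hIfin := lintegral_sum_kernelConv_lt_top hb (hv.trans huv.le) hv0 A n hg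
    (lt_top_iff_ne_top.2 hfin)
  set S : Rd d → ℝ≥0∞ := fun x => ∑ k ∈ A, kernelConv (n k) b (g k) x ^ v with hS
  have hSm : Measurable S := Finset.measurable_fun_sum _ fun k _ =>
    (measurable_kernelConv (n k) b (hg k)).pow_const _
  have hgv : ∀ k, Measurable fun x => g k x ^ v := fun k => (hg k).pow_const _
  have hGm : Measurable fun x => ∑ k ∈ A, g k x ^ v := Finset.measurable_fun_sum _ fun k _ => hgv k
  set h : Rd d → ℝ≥0∞ := fun x => S x ^ (s - 1) with hh
  have hhm : Measurable h := hSm.pow_const _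
  have key : ∫⁻ x, S x ^ s ≤ (D * (∫⁻ x, (∑ k ∈ A, g k x ^ v) ^ s) ^ (1 / s)) *
      (∫⁻ x, S x ^ s) ^ (1 / s') := by
    calc ∫⁻ x, S x ^ s = ∫⁻ x, S x * h x := by
          refine lintegral_congr fun x => ?_
          nth_rewrite 2 [← ENNReal.rpow_one (S x)]
          rw [hh, ← ENNReal.rpow_add_of_nonneg _ _ zero_le_one (by linarith)]
          congr 1; ring
      _ ≤ ∫⁻ x, ∑ k ∈ A, W ^ (v - 1) * (kernelConv (n k) b (fun y => g k y ^ v) x * h x) := by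
          refine lintegral_mono fun x => ?_
          simp only [hS]
          rw [Finset.sum_mul]
          refine Finset.sum_le_sum fun k _ => ?_
          rw [← mul_assoc]
          gcongr
          exact kernelConv_rpow_le (n k) b (hg k) hv x
      _ = ∑ k ∈ A, W ^ (v - 1) * ∫⁻ x, g k x ^ v * kernelConv (n k) b h x := by
          rw [lintegral_finsetSum]
          · refine Finset.sum_congr rfl fun k _ => ?_
            rw [lintegral_const_mul _ ((measurable_kernelConv (n k) b (hgv k)).fun_mul hhm),
              lintegral_kernelConv_mul _ _ (hgv k) hhm]
          · intro k _
            exact ((measurable_kernelConv (n k) b (hgv k)).mul hhm).const_mul _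
      _ ≤ ∑ k ∈ A, W ^ (v - 1) * ∫⁻ x, C₁ * (g k x ^ v * maximal h x) := by
          refine Finset.sum_le_sum fun k _ => mul_le_mul_right (lintegral_mono fun x => ?_) _
          rw [mul_left_comm]
          exact mul_le_mul_right (hC₁ (n k) h hhm x) _
      _ = W ^ (v - 1) * C₁ * ∫⁻ x, ((fun x => ∑ k ∈ A, g k x ^ v) * maximal h : Rd d → ℝ≥0∞) x := by
          have hmm := measurable_maximal hhm
          simp only [Pi.mul_apply, Finset.sum_mul]
          rw [lintegral_finsetSum _ fun k _ => (hgv k).fun_mul hmm, Finset.mul_sum]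
          refine Finset.sum_congr rfl fun k _ => ?_
          rw [lintegral_const_mul _ ((hgv k).fun_mul hmm), mul_assoc]
      _ ≤ W ^ (v - 1) * C₁ * ((∫⁻ x, (∑ k ∈ A, g k x ^ v) ^ s) ^ (1 / s) *
            (∫⁻ x, maximal h x ^ s') ^ (1 / s')) := by
          gcongr
          exact ENNReal.lintegral_mul_le_Lp_mul_Lq _ hconj hGm.aemeasurable
            (measurable_maximal hhm).aemeasurable
      _ ≤ W ^ (v - 1) * C₁ * ((∫⁻ x, (∑ k ∈ A, g k x ^ v) ^ s) ^ (1 / s) *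
            (C₂ * ∫⁻ x, S x ^ s) ^ (1 / s')) := by
          have h1 := hC₂ h hhm
          have h2 : ∀ x, h x ^ s' = S x ^ s := by
            intro x
            rw [hh, ← ENNReal.rpow_mul]
            congr 1
            exact hconj.sub_one_mul_conj
          simp_rw [h2] at h1
          gcongr
      _ = _ := by
          rw [ENNReal.mul_rpow_of_nonneg _ _ (by positivity)]
          ring
  have h3 := le_rpow_of_le_mul_rpow hconj hIfin.ne key
  rw [ENNReal.mul_rpow_of_nonneg _ _ hs0.le, ← ENNReal.rpow_mul, one_div_mul_cancel hs0.ne',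
    ENNReal.rpow_one] at h3
  exact h3.trans (mul_le_mul_left le_self_add _)

/-- On the diagonal, sum and integral commute and Young's inequality applies term by term. -/
theorem exists_lintegral_sum_kernelConv_le_of_eq (d : ℕ) {b v : ℝ} (hb : d < b) (hv : 1 ≤ v) :
    ∃ C : ℝ≥0∞, C ≠ ⊤ ∧ ∀ {ι : Type} (A : Finset ι) (n : ι → ℕ) (g : ι → Rd d → ℝ≥0∞),
      (∀ k, Measurable (g k)) →
      ∫⁻ x, (∑ k ∈ A, kernelConv (n k) b (g k) x ^ v) ^ (v / v) ≤
        C * ∫⁻ x, (∑ k ∈ A, g k x ^ v) ^ (v / v) := by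
  have hv0 : 0 < v := by linarith
  refine ⟨(∫⁻ y : Rd d, weight 0 y ^ (-b)) ^ v, ENNReal.rpow_ne_top_of_nonneg hv0.le
    (lintegral_weight_rpow_lt_top hb).ne, fun A n g hg => ?_⟩
  simp only [div_self hv0.ne', ENNReal.rpow_one]
  rw [lintegral_finsetSum _ fun k _ => (measurable_kernelConv (n k) b (hg k)).pow_const _,
    lintegral_finsetSum _ fun k _ => (hg k).pow_const _, Finset.mul_sum]
  exact Finset.sum_le_sum fun k _ => lintegral_kernelConv_rpow_le (n k) b (hg k) hv

/-- Duality: u < v turns into u' > v' for the conjugate exponents, a case already settled, and the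
convolutions are their own adjoints. -/
theorem exists_lintegral_sum_kernelConv_le_of_lt (d : ℕ) {b u v : ℝ} (hb : d < b) (hu : 1 < u)
    (huv : u < v) :
    ∃ C : ℝ≥0∞, C ≠ ⊤ ∧ ∀ {ι : Type} (A : Finset ι) (n : ι → ℕ) (g : ι → Rd d → ℝ≥0∞),
      (∀ k, Measurable (g k)) →
      ∫⁻ x, (∑ k ∈ A, kernelConv (n k) b (g k) x ^ v) ^ (u / v) ≤
        C * ∫⁻ x, (∑ k ∈ A, g k x ^ v) ^ (u / v) := by
  have hv : 1 < v := hu.trans huv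
  have hu0 : 0 < u := by linarith
  have hv0 : 0 < v := by linarith
  set u' := u.conjExponent with hu'_def
  set v' := v.conjExponent with hv'_def
  have hcu : u.HolderConjugate u' := Real.HolderConjugate.conjExponent hu
  have hcv : v.HolderConjugate v' := Real.HolderConjugate.conjExponent hv
  have hu'0 : 0 < u' := hcu.symm.pos
  have hv'0 : 0 < v' := hcv.symm.pos
  have hlt : v' < u' := by
    rw [hu'_def, hv'_def, Real.conjExponent, Real.conjExponent,
      div_lt_div_iff₀ (by linarith) (by linarith)]
    nlinarith
  obtain ⟨C₁, hC₁, hfs⟩ := exists_lintegral_sum_kernelConv_le_of_gt d hb hcv.symm.lt.le hlt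
  set D : ℝ≥0∞ := C₁ ^ (1 / u') with hD
  have hDtop : D ≠ ⊤ := ENNReal.rpow_ne_top_of_nonneg (by positivity) hC₁
  refine ⟨(D ^ u) + 1, by simp [hDtop, ENNReal.rpow_eq_top_iff, hu0.not_gt], ?_⟩
  intro ι A n g hg
  by_cases hfin : ∫⁻ x, (∑ k ∈ A, g k x ^ v) ^ (u / v) = ⊤
  · rw [hfin, ENNReal.mul_top (by simp)]; exact le_top
  have hIfin := lintegral_sum_kernelConv_lt_top hb hu.le hv0 A n hg (lt_top_iff_ne_top.2 hfin)
  set G : ι → Rd d → ℝ≥0∞ := fun k => kernelConv (n k) b (g k) with hG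
  have hGm : ∀ k, Measurable (G k) := fun k => measurable_kernelConv (n k) b (hg k)
  set S : Rd d → ℝ≥0∞ := fun x => ∑ k ∈ A, G k x ^ v with hS
  have hSm : Measurable S := Finset.measurable_fun_sum _ fun k _ => (hGm k).pow_const _
  -- The extremal element of L_(u')(ℓ_(v')): its pairing with G and the u'-th power of its ℓ_(v')
  -- norm are both S^(u/v), up to the degenerate values. The exponent (u - v)/v is negative, so S =
  -- 0 and S = ∞ are treated apart.
  set h : ι → Rd d → ℝ≥0∞ := fun k x => G k x ^ (v - 1) * S x ^ ((u - v) / v) with hh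
  have hhm : ∀ k, Measurable (h k) := fun k => ((hGm k).pow_const _).mul (hSm.pow_const _)
  have hneg : (u - v) / v < 0 := div_neg_of_neg_of_pos (by linarith) hv0
  have hpair : ∀ x, S x ≠ ⊤ → S x ^ (u / v) = ∑ k ∈ A, G k x * h k x := by
    intro x hx
    have e1 : ∀ k, G k x * h k x = G k x ^ v * S x ^ ((u - v) / v) := by
      intro k
      rw [hh, ← mul_assoc]
      congr 1
      nth_rewrite 1 [← ENNReal.rpow_one (G k x)]
      rw [← ENNReal.rpow_add_of_nonneg _ _ zero_le_one (by linarith)]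
      congr 1; ring
    simp_rw [e1]
    rw [← Finset.sum_mul]
    change S x ^ (u / v) = S x * S x ^ ((u - v) / v)
    rcases eq_or_ne (S x) 0 with h0 | h0
    · rw [h0, zero_mul, ENNReal.zero_rpow_of_pos (by positivity)]
    · nth_rewrite 2 [← ENNReal.rpow_one (S x)]
      rw [← ENNReal.rpow_add _ _ h0 hx]
      congr 1; field_simp; ring
  have hdual : ∀ x, (∑ k ∈ A, h k x ^ v') ^ (u' / v') ≤ S x ^ (u / v) := by
    intro x
    have e1 : ∀ k, h k x ^ v' = G k x ^ v * S x ^ ((u - v) / v * v') := by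
      intro k
      rw [hh, ENNReal.mul_rpow_of_nonneg _ _ hv'0.le, ← ENNReal.rpow_mul, ← ENNReal.rpow_mul,
        hcv.sub_one_mul_conj]
    simp_rw [e1]
    rw [← Finset.sum_mul]
    change (S x * S x ^ ((u - v) / v * v')) ^ (u' / v') ≤ S x ^ (u / v)
    rcases eq_or_ne (S x) 0 with h0 | h0
    · rw [h0, zero_mul, ENNReal.zero_rpow_of_pos (by positivity)]; exact zero_le
    rcases eq_or_ne (S x) ⊤ with ht | ht
    · rw [ht, ENNReal.top_rpow_of_neg (mul_neg_of_neg_of_pos hneg hv'0), mul_zero,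
        ENNReal.zero_rpow_of_pos (by positivity)]
      exact zero_le
    · nth_rewrite 1 [← ENNReal.rpow_one (S x)]
      rw [← ENNReal.rpow_add _ _ h0 ht, ← ENNReal.rpow_mul]
      refine le_of_eq ?_
      congr 1
      have h1 := hcv.sub_one_mul_conj
      have h2 := hcu.sub_one_mul_conj
      have h3 : v + (u - v) * v' = v' * (u - 1) := by linear_combination -h1
      have : 1 + (u - v) / v * v' = v' * (u - 1) / v := by rw [← h3]; field_simp
      rw [this, show v' * (u - 1) / v * (u' / v') = (u - 1) * u' / v by field_simp, h2]
  have hsum : Measurable fun x => ∑ k ∈ A, g k x ^ v :=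
    Finset.measurable_fun_sum _ fun k _ => (hg k).pow_const _
  have hKm : ∀ k, Measurable (kernelConv (n k) b (h k)) := fun k =>
    measurable_kernelConv (n k) b (hhm k)
  have hsum' : Measurable fun x => ∑ k ∈ A, kernelConv (n k) b (h k) x ^ v' :=
    Finset.measurable_fun_sum _ fun k _ => (hKm k).pow_const _
  have key : ∫⁻ x, S x ^ (u / v) ≤ (D * (∫⁻ x, (∑ k ∈ A, g k x ^ v) ^ (u / v)) ^ (1 / u)) *
      (∫⁻ x, S x ^ (u / v)) ^ (1 / u') := by
    calc ∫⁻ x, S x ^ (u / v) = ∫⁻ x, ∑ k ∈ A, G k x * h k x := by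
          refine lintegral_congr_ae ?_
          filter_upwards [ae_lt_top (hSm.pow_const _) hIfin.ne] with x hx
          refine hpair x fun h => ?_
          rw [h, ENNReal.top_rpow_of_pos (by positivity)] at hx
          exact lt_irrefl _ hx
      _ = ∫⁻ x, ∑ k ∈ A, g k x * kernelConv (n k) b (h k) x := by
          rw [lintegral_finsetSum _ fun k _ => (hGm k).fun_mul (hhm k),
            lintegral_finsetSum _ fun k _ => (hg k).fun_mul (hKm k)]
          exact Finset.sum_congr rfl fun k _ => lintegral_kernelConv_mul (n k) b (hg k) (hhm k)
      _ ≤ ∫⁻ x, ((fun x => (∑ k ∈ A, g k x ^ v) ^ (1 / v)) *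
            (fun x => (∑ k ∈ A, kernelConv (n k) b (h k) x ^ v') ^ (1 / v')) : Rd d → ℝ≥0∞) x :=
          lintegral_mono fun x => ENNReal.inner_le_Lp_mul_Lq A _ _ hcv
      _ ≤ (∫⁻ x, ((∑ k ∈ A, g k x ^ v) ^ (1 / v)) ^ u) ^ (1 / u) *
            (∫⁻ x, ((∑ k ∈ A, kernelConv (n k) b (h k) x ^ v') ^ (1 / v')) ^ u') ^ (1 / u') :=
          ENNReal.lintegral_mul_le_Lp_mul_Lq _ hcu (hsum.pow_const _).aemeasurable
            (hsum'.pow_const _).aemeasurable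
      _ = (∫⁻ x, (∑ k ∈ A, g k x ^ v) ^ (u / v)) ^ (1 / u) *
            (∫⁻ x, (∑ k ∈ A, kernelConv (n k) b (h k) x ^ v') ^ (u' / v')) ^ (1 / u') := by
          simp_rw [← ENNReal.rpow_mul, one_div_mul_eq_div]
      _ ≤ (∫⁻ x, (∑ k ∈ A, g k x ^ v) ^ (u / v)) ^ (1 / u) *
            (C₁ * ∫⁻ x, S x ^ (u / v)) ^ (1 / u') := by
          have h1 : ∫⁻ x, (∑ k ∈ A, kernelConv (n k) b (h k) x ^ v') ^ (u' / v') ≤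
              C₁ * ∫⁻ x, S x ^ (u / v) :=
            (hfs A n h hhm).trans (mul_le_mul_right (lintegral_mono hdual) _)
          gcongr
      _ = _ := by
          rw [ENNReal.mul_rpow_of_nonneg _ _ (by positivity)]
          ring
  have h3 := le_rpow_of_le_mul_rpow hcu hIfin.ne key
  rw [ENNReal.mul_rpow_of_nonneg _ _ hu0.le, ← ENNReal.rpow_mul _ (1 / u) u,
    one_div_mul_cancel hu0.ne',
    ENNReal.rpow_one] at h3
  exact h3.trans (mul_le_mul_left le_self_add _)

/-- Monotone convergence along finite subfamilies, which transfers any bound for finite sums whose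
constant does not depend on the subfamily. -/
theorem lintegral_tsum_rpow_eq_iSup {d : ℕ} {ι : Type*} [Countable ι] {f : ι → Rd d → ℝ≥0∞}
    (hf : ∀ k, Measurable (f k)) {s : ℝ} (hs : 0 < s) :
    ∫⁻ x, (∑' k, f k x) ^ s = ⨆ A : Finset ι, ∫⁻ x, (∑ k ∈ A, f k x) ^ s := by
  have e : ∀ x, (∑' k, f k x) ^ s = ⨆ A : Finset ι, (∑ k ∈ A, f k x) ^ s := by
    intro x
    rw [ENNReal.tsum_eq_iSup_sum]
    exact (ENNReal.orderIsoRpow s hs).map_iSup _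
  simp_rw [e]
  refine lintegral_iSup_directed (fun A =>
    ((Finset.measurable_fun_sum A fun k _ => hf k).pow_const s).aemeasurable) ?_
  refine Monotone.directed_le fun A B hAB x => ?_
  exact ENNReal.rpow_le_rpow (Finset.sum_le_sum_of_subset hAB) hs.le

/-- The vector-valued maximal inequality in `L_u(ℓ_v)` for `1 < u, v < ∞`. -/
theorem exists_lintegral_tsum_kernelConv_le (d : ℕ) {b u v : ℝ} (hb : d < b) (hu : 1 < u)
    (hv : 1 < v) :
    ∃ C : ℝ≥0∞, C ≠ ⊤ ∧ ∀ {ι : Type} [Countable ι] (n : ι → ℕ) (g : ι → Rd d → ℝ≥0∞),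
      (∀ k, Measurable (g k)) →
      ∫⁻ x, (∑' k, kernelConv (n k) b (g k) x ^ v) ^ (u / v) ≤
        C * ∫⁻ x, (∑' k, g k x ^ v) ^ (u / v) := by
  obtain ⟨C, hC, h⟩ : ∃ C : ℝ≥0∞, C ≠ ⊤ ∧ ∀ {ι : Type} (A : Finset ι) (n : ι → ℕ)
      (g : ι → Rd d → ℝ≥0∞), (∀ k, Measurable (g k)) →
      ∫⁻ x, (∑ k ∈ A, kernelConv (n k) b (g k) x ^ v) ^ (u / v) ≤
        C * ∫⁻ x, (∑ k ∈ A, g k x ^ v) ^ (u / v) := by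
    rcases lt_trichotomy u v with h | rfl | h
    · exact exists_lintegral_sum_kernelConv_le_of_lt d hb hu h
    · exact exists_lintegral_sum_kernelConv_le_of_eq d hb hv.le
    · exact exists_lintegral_sum_kernelConv_le_of_gt d hb hv.le h
  have hs : 0 < u / v := by positivity
  refine ⟨C, hC, fun n g hg => ?_⟩
  rw [lintegral_tsum_rpow_eq_iSup (fun k => (measurable_kernelConv (n k) b (hg k)).pow_const _) hs,
    lintegral_tsum_rpow_eq_iSup (fun k => (hg k).pow_const _) hs]
  exact iSup_le fun A => (h A n g hg).trans (mul_le_mul_right (le_iSup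
    (fun A : Finset _ => ∫⁻ x, (∑ k ∈ A, g k x ^ v) ^ (u / v)) A) _)

/-- The vector-valued maximal inequality in `L_u(ℓ_∞)` for `1 < u < ∞`. -/
theorem exists_lintegral_iSup_kernelConv_le (d : ℕ) {b u : ℝ} (hb : d < b) (hu : 1 < u) :
    ∃ C : ℝ≥0∞, C ≠ ⊤ ∧ ∀ {ι : Type} [Countable ι] (n : ι → ℕ) (g : ι → Rd d → ℝ≥0∞),
      (∀ k, Measurable (g k)) →
      ∫⁻ x, (⨆ k, kernelConv (n k) b (g k) x) ^ u ≤ C * ∫⁻ x, (⨆ k, g k x) ^ u := by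
  have hu0 : 0 < u := by linarith
  obtain ⟨C₁, hC₁⟩ := exists_kernelConv_le_maximal d hb
  obtain ⟨C₂, hC₂⟩ := exists_lintegral_maximal_rpow_le d hu
  refine ⟨C₁ ^ u * C₂, ENNReal.mul_ne_top (ENNReal.rpow_ne_top_of_nonneg hu0.le
    ENNReal.coe_ne_top) ENNReal.coe_ne_top, fun n g hg => ?_⟩
  have hm : Measurable fun x => ⨆ k, g k x := Measurable.iSup hg
  calc ∫⁻ x, (⨆ k, kernelConv (n k) b (g k) x) ^ u
      ≤ ∫⁻ x, (C₁ : ℝ≥0∞) ^ u * maximal (fun x => ⨆ k, g k x) x ^ u := by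
        refine lintegral_mono fun x => ?_
        rw [← ENNReal.mul_rpow_of_nonneg _ _ hu0.le]
        gcongr
        refine iSup_le fun k => ?_
        exact (kernelConv_mono _ _ (fun y => le_iSup (fun k => g k y) k) x).trans
          (hC₁ (n k) _ hm x)
    _ = (C₁ : ℝ≥0∞) ^ u * ∫⁻ x, maximal (fun x => ⨆ k, g k x) x ^ u :=
        lintegral_const_mul _ ((measurable_maximal hm).pow_const _)
    _ ≤ _ := by
        rw [mul_assoc]
        exact mul_le_mul_right (hC₂ _ hm) _

/-! ### Translations of Schwartz functions and convolutions with tempered distributions -/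

theorem exists_one_add_norm_pow_mul_iteratedFDeriv_le {d : ℕ} (ψ : 𝓢(Rd d, ℂ)) (k n : ℕ) :
    ∃ A : ℝ, 0 ≤ A ∧ ∀ x, (1 + ‖x‖) ^ k * ‖iteratedFDeriv ℝ n ψ x‖ ≤ A :=
  ⟨_, by positivity, fun x => SchwartzMap.one_add_le_sup_seminorm_apply (𝕜 := ℂ) (m := (k, n))
    le_rfl le_rfl ψ x⟩

theorem exists_seminorm_translate_le {d : ℕ} (ψ : 𝓢(Rd d, ℂ)) (k n : ℕ) :
    ∃ A : ℝ, 0 ≤ A ∧ ∀ y, SchwartzMap.seminorm ℂ k n (SchwartzMap.compSubConstCLM ℂ y ψ) ≤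
      A * (1 + ‖y‖) ^ k := by
  obtain ⟨A, hA0, hA⟩ := exists_one_add_norm_pow_mul_iteratedFDeriv_le ψ k n
  refine ⟨A, hA0, fun y => SchwartzMap.seminorm_le_bound ℂ k n _ (by positivity) fun x => ?_⟩
  have e : iteratedFDeriv ℝ n (SchwartzMap.compSubConstCLM ℂ y ψ) x =
      iteratedFDeriv ℝ n ψ (x - y) := iteratedFDeriv_comp_sub n y x
  rw [e]
  have h1 : ‖x‖ ≤ (1 + ‖x - y‖) * (1 + ‖y‖) := by
    have : ‖x‖ ≤ ‖x - y‖ + ‖y‖ := by simpa using norm_add_le (x - y) y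
    nlinarith [norm_nonneg (x - y), norm_nonneg y, mul_nonneg (norm_nonneg (x - y)) (norm_nonneg y)]
  calc ‖x‖ ^ k * ‖iteratedFDeriv ℝ n ψ (x - y)‖
      ≤ ((1 + ‖x - y‖) * (1 + ‖y‖)) ^ k * ‖iteratedFDeriv ℝ n ψ (x - y)‖ := by gcongr
    _ = ((1 + ‖x - y‖) ^ k * ‖iteratedFDeriv ℝ n ψ (x - y)‖) * (1 + ‖y‖) ^ k := by
        rw [mul_pow]; ring
    _ ≤ A * (1 + ‖y‖) ^ k := by gcongr; exact hA _

/-- Translates of a Schwartz function grow at most polynomially under a continuous linear map. -/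
theorem exists_norm_map_translate_le {d : ℕ} {G : Type*} [NormedAddCommGroup G] [NormedSpace ℂ G]
    (L : 𝓢(Rd d, ℂ) →L[ℂ] G) (ψ : 𝓢(Rd d, ℂ)) :
    ∃ (A : ℝ) (N : ℕ), 0 ≤ A ∧ ∀ y, ‖L (SchwartzMap.compSubConstCLM ℂ y ψ)‖ ≤
      A * (1 + ‖y‖) ^ N := by
  obtain ⟨s, C, -, hC⟩ := Seminorm.bound_of_continuous (schwartz_withSeminorms ℂ (Rd d) ℂ)
    ((normSeminorm ℂ G).comp L.toLinearMap) (continuous_norm.comp L.continuous)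
  choose A hA0 hA using fun i : ℕ × ℕ => exists_seminorm_translate_le ψ i.1 i.2
  refine ⟨C * ∑ i ∈ s, A i, s.sup Prod.fst, mul_nonneg C.2 (Finset.sum_nonneg fun i _ => hA0 i),
    fun y => ?_⟩
  have h1 := hC (SchwartzMap.compSubConstCLM ℂ y ψ)
  refine h1.trans ?_
  rw [mul_assoc]
  change (C : ℝ) * _ ≤ _
  gcongr
  refine Seminorm.finset_sup_apply_le (mul_nonneg (Finset.sum_nonneg fun i _ => hA0 i)
    (by positivity)) fun i hi => (hA i y).trans ?_
  gcongr
  · exact Finset.sum_nonneg fun i _ => hA0 i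
  · exact Finset.single_le_sum (fun i _ => hA0 i) hi
  · linarith [norm_nonneg y]
  · exact Finset.le_sup (f := Prod.fst) hi

/-- By the group law it suffices to look at small y. There the mean value inequality for the n-th
derivative applies on the unit ball about x; the weight ‖x‖^k is frozen, and ‖x‖ ≤ 1 + ‖z‖ lets the
decay of the next derivative at z absorb it. -/
theorem continuous_translate {d : ℕ} (ψ : 𝓢(Rd d, ℂ)) :
    Continuous fun y : Rd d => SchwartzMap.compSubConstCLM ℂ y ψ := by
  have key : ∀ ψ : 𝓢(Rd d, ℂ), ∀ k n : ℕ, ∃ A : ℝ, ∀ y : Rd d, ‖y‖ ≤ 1 →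
      SchwartzMap.seminorm ℂ k n (SchwartzMap.compSubConstCLM ℂ y ψ - ψ) ≤ A * ‖y‖ := by
    intro ψ k n
    obtain ⟨A, hA0, hA⟩ := exists_one_add_norm_pow_mul_iteratedFDeriv_le ψ k (n + 1)
    refine ⟨A, fun y hy => SchwartzMap.seminorm_le_bound ℂ k n _ (by positivity) fun x => ?_⟩
    have e : iteratedFDeriv ℝ n (SchwartzMap.compSubConstCLM ℂ y ψ - ψ : 𝓢(Rd d, ℂ)) x =
        iteratedFDeriv ℝ n ψ (x - y) - iteratedFDeriv ℝ n ψ x := by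
      have e1 : ((SchwartzMap.compSubConstCLM ℂ y ψ - ψ : 𝓢(Rd d, ℂ)) : Rd d → ℂ) =
          (SchwartzMap.compSubConstCLM ℂ y ψ : Rd d → ℂ) - (ψ : Rd d → ℂ) := by
        ext z; simp
      rw [e1, iteratedFDeriv_sub_apply ((SchwartzMap.smooth _ n).contDiffAt)
        (ψ.smooth n).contDiffAt]
      congr 1
      exact iteratedFDeriv_comp_sub n y x
    have hd : Differentiable ℝ (iteratedFDeriv ℝ n ψ) :=
      (ψ.smooth ⊤).differentiable_iteratedFDeriv (by exact_mod_cast WithTop.coe_lt_top n)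
    have h1 := Convex.norm_image_sub_le_of_norm_fderiv_le (𝕜 := ℝ)
      (f := fun z => ‖x‖ ^ k • iteratedFDeriv ℝ n ψ z) (C := A) (s := Metric.closedBall x 1)
      (x := x) (y := x - y) (fun z _ => (hd z).fun_const_smul _) (fun z hz => ?_)
      (convex_closedBall _ _) (Metric.mem_closedBall_self zero_le_one) (by simpa using hy)
    · rw [← smul_sub, norm_smul, norm_pow, norm_norm] at h1
      rw [e]
      simpa using h1
    · rw [fderiv_fun_const_smul (hd z), norm_smul, norm_pow, norm_norm, norm_fderiv_iteratedFDeriv]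
      refine le_trans ?_ (hA z)
      gcongr
      have : ‖x - z‖ ≤ 1 := by rw [← dist_eq_norm, dist_comm]; exact hz
      linarith [norm_le_insert' x z]
  rw [continuous_iff_continuousAt]
  intro y₀
  rw [ContinuousAt, (schwartz_withSeminorms ℂ (Rd d) ℂ).tendsto_nhds]
  rintro ⟨k, n⟩ ε hε
  obtain ⟨A, hA⟩ := key (SchwartzMap.compSubConstCLM ℂ y₀ ψ) k n
  have hlim : Filter.Tendsto (fun y : Rd d => A * ‖y - y₀‖) (nhds y₀) (nhds 0) := by
    have : Continuous fun y : Rd d => A * ‖y - y₀‖ := by fun_prop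
    simpa using this.tendsto y₀
  filter_upwards [hlim.eventually (gt_mem_nhds hε), Metric.closedBall_mem_nhds y₀ one_pos]
    with y hy hy1
  refine lt_of_le_of_lt ?_ hy
  have h2 := hA (y - y₀) (by rw [← dist_eq_norm]; exact hy1)
  rw [SchwartzMap.compSubConstCLM_comp, add_sub_cancel] at h2
  exact h2

/-! ### Derivatives of convolutions of Schwartz functions. -/

theorem integrable_smul_translate {d : ℕ} {F : Type} [NormedAddCommGroup F] [NormedSpace ℝ F]
    [NormedSpace ℂ F] [IsScalarTower ℝ ℂ F] (κ : 𝓢(Rd d, ℂ)) (ψ : 𝓢(Rd d, F)) (z : Rd d) :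
    Integrable fun y => κ y • ψ (z - y) := by
  refine (κ.integrable (μ := volume)).norm.mul_const (SchwartzMap.seminorm ℝ 0 0 ψ) |>.mono'
    (Continuous.aestronglyMeasurable (by fun_prop)) (Filter.Eventually.of_forall fun y => ?_)
  rw [norm_smul]
  gcongr
  exact SchwartzMap.norm_le_seminorm ℝ ψ _

theorem hasFDerivAt_integral_smul_translate {d : ℕ} {F : Type} [NormedAddCommGroup F]
    [NormedSpace ℝ F] [NormedSpace ℂ F] [IsScalarTower ℝ ℂ F] (κ : 𝓢(Rd d, ℂ)) (ψ : 𝓢(Rd d, F))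
    (z : Rd d) :
    HasFDerivAt (fun z => ∫ y, κ y • ψ (z - y))
      (∫ y, κ y • SchwartzMap.fderivCLM ℝ (Rd d) F ψ (z - y)) z := by
  refine hasFDerivAt_integral_of_dominated_of_fderiv_le (𝕜 := ℝ)
    (F' := fun z y => κ y • SchwartzMap.fderivCLM ℝ (Rd d) F ψ (z - y))
    (bound := fun y => ‖κ y‖ * SchwartzMap.seminorm ℝ 0 0 (SchwartzMap.fderivCLM ℝ (Rd d) F ψ))
    Filter.univ_mem ?_ ?_ ?_ ?_ ?_ ?_
  · exact Filter.Eventually.of_forall fun z => Continuous.aestronglyMeasurable (by fun_prop)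
  · exact integrable_smul_translate κ ψ z
  · exact Continuous.aestronglyMeasurable (by fun_prop)
  · refine Filter.Eventually.of_forall fun y z _ => ?_
    rw [norm_smul]
    gcongr
    exact SchwartzMap.norm_le_seminorm ℝ _ _
  · exact (κ.integrable (μ := volume)).norm.mul_const _
  · refine Filter.Eventually.of_forall fun y z _ => ?_
    have h := (ψ.hasFDerivAt (z - y)).comp z ((hasFDerivAt_id z).sub_const y)
    rw [ContinuousLinearMap.comp_id] at h
    exact h.const_smul (κ y)

theorem integrable_smul_iteratedFDeriv_translate {d : ℕ} {F : Type} [NormedAddCommGroup F]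
    [NormedSpace ℝ F] [NormedSpace ℂ F] [IsScalarTower ℝ ℂ F] (κ : 𝓢(Rd d, ℂ)) (ψ : 𝓢(Rd d, F))
    (n : ℕ) (z : Rd d) (v : Fin n → Rd d) :
    Integrable fun y => κ y • iteratedFDeriv ℝ n ψ (z - y) v := by
  have hc : Continuous (iteratedFDeriv ℝ n ψ) :=
    (ψ.smooth ⊤).continuous_iteratedFDeriv (by exact_mod_cast le_top)
  have hc' : Continuous fun y => iteratedFDeriv ℝ n ψ (z - y) v :=
    (ContinuousMultilinearMap.apply ℝ (fun _ : Fin n => Rd d) F v).continuous.comp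
      (hc.comp (continuous_const.sub continuous_id))
  refine (κ.integrable (μ := volume)).norm.mul_const
    (SchwartzMap.seminorm ℝ 0 n ψ * ∏ i, ‖v i‖) |>.mono'
    (Continuous.aestronglyMeasurable (by fun_prop)) (Filter.Eventually.of_forall fun y => ?_)
  rw [norm_smul]
  gcongr
  refine (ContinuousMultilinearMap.le_opNorm _ _).trans ?_
  gcongr
  exact SchwartzMap.norm_iteratedFDeriv_le_seminorm ℝ ψ n _

/-- The target space F is quantified inside the induction because one differentiation replaces ψ by
a Schwartz function with values in the linear maps from ℝ^d to F. -/
theorem iteratedFDeriv_integral_smul_translate {d : ℕ} (κ : 𝓢(Rd d, ℂ)) (n : ℕ) :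
    ∀ {F : Type} [NormedAddCommGroup F] [NormedSpace ℝ F] [NormedSpace ℂ F]
      [IsScalarTower ℝ ℂ F] [CompleteSpace F] (ψ : 𝓢(Rd d, F)) (z : Rd d) (v : Fin n → Rd d),
      iteratedFDeriv ℝ n (fun z => ∫ y, κ y • ψ (z - y)) z v =
        ∫ y, κ y • iteratedFDeriv ℝ n ψ (z - y) v := by
  induction n with
  | zero =>
    intro F _ _ _ _ _ ψ z v
    simp
  | succ n ih =>
    intro F _ _ _ _ _ ψ z v
    have e2 : (fun y => fderiv ℝ (fun z => ∫ y, κ y • ψ (z - y)) y) =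
        fun z => ∫ y, κ y • SchwartzMap.fderivCLM ℝ (Rd d) F ψ (z - y) :=
      funext fun z => (hasFDerivAt_integral_smul_translate κ ψ z).fderiv
    rw [iteratedFDeriv_succ_apply_right, e2, ih, ContinuousLinearMap.integral_apply
      (integrable_smul_iteratedFDeriv_translate κ _ n z _)]
    refine integral_congr_ae (Filter.Eventually.of_forall fun y => ?_)
    simp only
    rw [iteratedFDeriv_succ_apply_right]
    rfl

/-! ### Factorization of tempered distributions through a Banach space. -/

/-- The index set for the values `‖x‖^k ψ⁽ⁿ⁾(x)(v)`, `(k, n) ∈ s`, as a discrete space. -/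
structure JetPoint (d : ℕ) (s : Finset (ℕ × ℕ)) where
  index : s
  point : Rd d
  dir : Fin (index : ℕ × ℕ).2 → Rd d

instance (d : ℕ) (s : Finset (ℕ × ℕ)) : TopologicalSpace (JetPoint d s) := ⊥

instance (d : ℕ) (s : Finset (ℕ × ℕ)) : DiscreteTopology (JetPoint d s) := ⟨rfl⟩

/-- The value `‖x‖^k ψ⁽ⁿ⁾(x)(v) / ∏ ‖v j‖`. -/
def jetValue {d : ℕ} {s : Finset (ℕ × ℕ)} (ψ : 𝓢(Rd d, ℂ)) (a : JetPoint d s) : ℂ :=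
  ((‖a.point‖ ^ (a.index : ℕ × ℕ).1 / ∏ j, ‖a.dir j‖ : ℝ) : ℂ) *
    iteratedFDeriv ℝ (a.index : ℕ × ℕ).2 ψ a.point a.dir

theorem norm_jetValue_le {d : ℕ} {s : Finset (ℕ × ℕ)} (ψ : 𝓢(Rd d, ℂ)) (a : JetPoint d s) :
    ‖jetValue ψ a‖ ≤ s.sup (schwartzSeminormFamily ℂ (Rd d) ℂ) ψ := by
  have h1 : SchwartzMap.seminorm ℂ (a.index : ℕ × ℕ).1 (a.index : ℕ × ℕ).2 ψ ≤
      s.sup (schwartzSeminormFamily ℂ (Rd d) ℂ) ψ :=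
    Seminorm.le_finset_sup_apply (p := schwartzSeminormFamily ℂ (Rd d) ℂ) a.index.2
  refine le_trans ?_ h1
  have h2 := (iteratedFDeriv ℝ (a.index : ℕ × ℕ).2 ψ a.point).le_opNorm a.dir
  have h3 := SchwartzMap.le_seminorm ℂ (a.index : ℕ × ℕ).1 (a.index : ℕ × ℕ).2 ψ a.point
  have h4 : 0 ≤ ∏ j, ‖a.dir j‖ := Finset.prod_nonneg fun j _ => norm_nonneg _
  rw [jetValue, norm_mul, Complex.norm_real, Real.norm_of_nonneg (by positivity)]
  -- If some direction is zero, the quotient in `jetValue` is a division by zero and has the value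
  -- 0.
  rcases h4.eq_or_lt with h0 | h0
  · rw [← h0, div_zero, zero_mul]
    exact apply_nonneg _ _
  · rw [div_mul_eq_mul_div, div_le_iff₀ h0]
    calc _ ≤ ‖a.point‖ ^ (a.index : ℕ × ℕ).1 *
          (‖iteratedFDeriv ℝ (a.index : ℕ × ℕ).2 ψ a.point‖ * ∏ j, ‖a.dir j‖) := by gcongr
      _ ≤ _ := by rw [← mul_assoc]; gcongr

/-- The values of finitely many weighted derivatives of a Schwartz function, as a bounded
function. -/
def jetCLM (d : ℕ) (s : Finset (ℕ × ℕ)) :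
    𝓢(Rd d, ℂ) →L[ℂ] BoundedContinuousFunction (JetPoint d s) ℂ :=
  SchwartzMap.mkCLMtoNormedSpace (σ := RingHom.id ℂ)
    (fun ψ => BoundedContinuousFunction.ofNormedAddCommGroup (jetValue ψ)
      continuous_of_discreteTopology _ (norm_jetValue_le ψ))
    (fun ψ φ => by
      ext a
      have e1 : ((ψ + φ : 𝓢(Rd d, ℂ)) : Rd d → ℂ) = (ψ : Rd d → ℂ) + (φ : Rd d → ℂ) := by
        ext z; simp
      simp [jetValue, e1, iteratedFDeriv_add_apply (ψ.smooth _).contDiffAt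
        (φ.smooth _).contDiffAt, mul_add])
    (fun c ψ => by
      ext a
      have e1 : ((c • ψ : 𝓢(Rd d, ℂ)) : Rd d → ℂ) = c • (ψ : Rd d → ℂ) := by
        ext z; simp
      simp only [BoundedContinuousFunction.coe_ofNormedAddCommGroup, jetValue, e1,
        iteratedFDeriv_const_smul_apply (ψ.smooth _).contDiffAt, RingHom.id_apply,
        smul_apply, smul_eq_mul, BoundedContinuousFunction.coe_smul]
      ring)
    ⟨s, 1, zero_le_one, fun ψ => by
      rw [one_mul]
      exact BoundedContinuousFunction.norm_ofNormedAddCommGroup_le _ (apply_nonneg _ _) _⟩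

/-- The operator norm of a multilinear map is recovered from its normalized values, so the sup norm
of the jets controls every seminorm indexed by s. Hence a functional bounded by these seminorms is
bounded by the norm of the jets. -/
theorem seminorm_le_norm_jetCLM {d : ℕ} {s : Finset (ℕ × ℕ)} (ψ : 𝓢(Rd d, ℂ)) {i : ℕ × ℕ}
    (hi : i ∈ s) : SchwartzMap.seminorm ℂ i.1 i.2 ψ ≤ ‖jetCLM d s ψ‖ := by
  refine SchwartzMap.seminorm_le_bound ℂ i.1 i.2 ψ (norm_nonneg _) fun x => ?_
  set M : ℝ := ‖jetCLM d s ψ‖ with hM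
  have hM0 : 0 ≤ M := norm_nonneg _
  set c : ℝ := ‖x‖ ^ i.1 with hc
  have hc0 : 0 ≤ c := by positivity
  rcases hc0.eq_or_lt with h0 | hcpos
  · rw [← h0, zero_mul]; exact hM0
  rw [mul_comm, ← le_div_iff₀ hcpos]
  refine ContinuousMultilinearMap.opNorm_le_bound (div_nonneg hM0 hc0) fun v => ?_
  have h : ‖jetValue ψ (⟨⟨i, hi⟩, x, v⟩ : JetPoint d s)‖ ≤ M :=
    (jetCLM d s ψ).norm_coe_le_norm _
  have h4 : 0 ≤ ∏ j, ‖v j‖ := Finset.prod_nonneg fun j _ => norm_nonneg _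
  rw [jetValue, norm_mul, Complex.norm_real, Real.norm_of_nonneg (div_nonneg hc0 h4)] at h
  change c / (∏ j, ‖v j‖) * ‖iteratedFDeriv ℝ i.2 ψ x v‖ ≤ M at h
  rcases h4.eq_or_lt with h0 | h0
  · obtain ⟨j, -, hj⟩ := Finset.prod_eq_zero_iff.1 h0.symm
    rw [(iteratedFDeriv ℝ i.2 ψ x).map_coord_zero j (norm_eq_zero.1 hj), norm_zero]
    exact mul_nonneg (div_nonneg hM0 hc0) h4
  · rw [div_mul_eq_mul_div, div_le_iff₀ h0] at h
    rw [div_mul_eq_mul_div, le_div_iff₀ hcpos, mul_comm]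
    exact h

/-- A tempered distribution factors through finitely many weighted derivatives. -/
theorem exists_factor_jetCLM {d : ℕ} (f : 𝓢(Rd d, ℂ) →L[ℂ] ℂ) :
    ∃ (s : Finset (ℕ × ℕ)) (g : BoundedContinuousFunction (JetPoint d s) ℂ →L[ℂ] ℂ),
      ∀ ψ, f ψ = g (jetCLM d s ψ) := by
  classical
  obtain ⟨s₀, C, -, hC⟩ := Seminorm.bound_of_continuous (schwartz_withSeminorms ℂ (Rd d) ℂ)
    ((normSeminorm ℂ ℂ).comp f.toLinearMap) (continuous_norm.comp f.continuous)
  -- The index (0, 0) contributes the sup norm of ψ itself, which makes the jet map injective.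
  set s := insert (0, 0) s₀ with hs
  set T := jetCLM d s with hT
  have hbound : ∀ ψ, ‖f ψ‖ ≤ C * ‖T ψ‖ := by
    intro ψ
    refine (hC ψ).trans ?_
    change (C : ℝ) * _ ≤ _
    gcongr
    exact Seminorm.finset_sup_apply_le (norm_nonneg _) fun i hi =>
      seminorm_le_norm_jetCLM ψ (Finset.mem_insert_of_mem hi)
  have hinj : Function.Injective T.toLinearMap := by
    refine (injective_iff_map_eq_zero T).2 fun ψ hψ => ?_
    have h := seminorm_le_norm_jetCLM (s := s) ψ (Finset.mem_insert_self (0, 0) s₀)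
    rw [← hT, hψ, norm_zero] at h
    ext x
    have := (SchwartzMap.norm_le_seminorm ℂ ψ x).trans h
    simpa using this
  set e := LinearEquiv.ofInjective T.toLinearMap hinj with he
  have hg₀ : ∀ w : LinearMap.range T.toLinearMap,
      ‖(f.toLinearMap.comp e.symm.toLinearMap) w‖ ≤ C * ‖w‖ := by
    intro w
    obtain ⟨ψ, rfl⟩ := e.surjective w
    have h1 : ‖e ψ‖ = ‖T ψ‖ := rfl
    rw [h1]
    simpa using hbound ψ
  -- Hahn-Banach, from the range of the jet map to all bounded functions.
  obtain ⟨g, hg, -⟩ := exists_extension_norm_eq (LinearMap.range T.toLinearMap)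
    ((f.toLinearMap.comp e.symm.toLinearMap).mkContinuous C hg₀)
  refine ⟨s, g, fun ψ => ?_⟩
  have h := hg (e ψ)
  have h1 : ((e ψ : LinearMap.range T.toLinearMap) : BoundedContinuousFunction (JetPoint d s) ℂ) =
    T ψ := rfl
  rw [h1] at h
  rw [h]
  simp

/-- A tempered distribution may be applied under the integral sign of a convolution. -/
theorem map_convolution_eq_integral {d : ℕ} (f : 𝓢(Rd d, ℂ) →L[ℂ] ℂ) (κ ψ Θ : 𝓢(Rd d, ℂ))
    (hΘ : ∀ z, Θ z = ∫ y, κ y * ψ (z - y)) :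
    f Θ = ∫ y, κ y * f (SchwartzMap.compSubConstCLM ℂ y ψ) := by
  obtain ⟨s, g, hg⟩ := exists_factor_jetCLM f
  set T := jetCLM d s with hT
  obtain ⟨A, N, hA0, hA⟩ := exists_norm_map_translate_le T ψ
  -- A Bochner integral in the Banach space of jets: translates grow polynomially in y and κ decays
  -- rapidly.
  have hInt : Integrable fun y => κ y • T (SchwartzMap.compSubConstCLM ℂ y ψ) := by
    have hcont : Continuous fun y => κ y • T (SchwartzMap.compSubConstCLM ℂ y ψ) :=
      κ.continuous.smul (T.continuous.comp (continuous_translate ψ))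
    have hb : Integrable fun y : Rd d => A * (2 ^ N * (‖κ y‖ + ‖y‖ ^ N * ‖κ y‖)) :=
      (((κ.integrable (μ := volume)).norm.add (κ.integrable_pow_mul volume N)).const_mul _).const_mul _
    refine hb.mono' hcont.aestronglyMeasurable (Filter.Eventually.of_forall fun y => ?_)
    rw [norm_smul]
    have h1 : (1 + ‖y‖) ^ N ≤ 2 ^ N * (1 + ‖y‖ ^ N) := by
      rcases le_total ‖y‖ 1 with h | h
      · calc (1 + ‖y‖) ^ N ≤ 2 ^ N := by gcongr; linarith
          _ ≤ _ := le_mul_of_one_le_right (by positivity) (by linarith [pow_nonneg (norm_nonneg y) N])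
      · calc (1 + ‖y‖) ^ N ≤ (2 * ‖y‖) ^ N := by gcongr; linarith
          _ = 2 ^ N * ‖y‖ ^ N := mul_pow _ _ _
          _ ≤ _ := by gcongr; linarith
    calc ‖κ y‖ * ‖T (SchwartzMap.compSubConstCLM ℂ y ψ)‖
        ≤ ‖κ y‖ * (A * (2 ^ N * (1 + ‖y‖ ^ N))) := by
          gcongr
          exact (hA y).trans (by gcongr)
      _ = _ := by ring
  -- Evaluation at a jet point is continuous, so this can be checked pointwise, where it is
  -- differentiation under the integral sign.
  have hTΘ : T Θ = ∫ y, κ y • T (SchwartzMap.compSubConstCLM ℂ y ψ) := by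
    ext a
    have h1 := (BoundedContinuousFunction.evalCLM ℂ a).integral_comp_comm hInt
    refine Eq.trans ?_ h1
    have e1 : ∀ y, BoundedContinuousFunction.evalCLM ℂ a
        (κ y • T (SchwartzMap.compSubConstCLM ℂ y ψ)) =
        ((‖a.point‖ ^ (a.index : ℕ × ℕ).1 / ∏ j, ‖a.dir j‖ : ℝ) : ℂ) *
          (κ y • iteratedFDeriv ℝ (a.index : ℕ × ℕ).2 ψ (a.point - y) a.dir) := by
      intro y
      have e2 : iteratedFDeriv ℝ (a.index : ℕ × ℕ).2 (SchwartzMap.compSubConstCLM ℂ y ψ) a.point =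
        iteratedFDeriv ℝ (a.index : ℕ × ℕ).2 ψ (a.point - y) := iteratedFDeriv_comp_sub _ y _
      change κ y * jetValue (SchwartzMap.compSubConstCLM ℂ y ψ) a = _
      rw [jetValue, e2, smul_eq_mul]
      ring
    simp_rw [e1]
    rw [integral_const_mul, ← iteratedFDeriv_integral_smul_translate κ _ ψ a.point a.dir]
    change jetValue Θ a = _
    have e3 : (Θ : Rd d → ℂ) = fun z => ∫ y, κ y • ψ (z - y) := funext hΘ
    rw [jetValue, e3]
  rw [hg, hTΘ, ← g.integral_comp_comm hInt]
  refine integral_congr_ae (Filter.Eventually.of_forall fun y => ?_)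
  simp only [map_smul, smul_eq_mul]
  rw [hg]

/-! ### Frequency-localized pieces as convolutions -/

/-- The continuous linear functional underlying a tempered distribution. -/
def functional {d : ℕ} (f : 𝓢'(Rd d, ℂ)) : 𝓢(Rd d, ℂ) →L[ℂ] ℂ where
  toFun := f
  map_add' := map_add f
  map_smul' := map_smul f
  cont := map_continuous f

/-- Modulation becomes translation. A piece at x is thereby f tested on the x-translate of one fixed
Schwartz function, which gives its continuity and polynomial growth. -/
theorem fourierSchwartz_modulate {d : ℕ} (m : Rd d → ℂ) (hc : HasCompactSupport m)
    (hs : ContDiff ℝ ∞ m) (x : Rd d) :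
    fourierSchwartz d (modulate m hc hs x) =
      SchwartzMap.compSubConstCLM ℂ x (fourierSchwartz d (hc.toSchwartzMap hs)) := by
  ext z
  rw [SchwartzMap.compSubConstCLM_apply, fourierSchwartz_apply, fourierSchwartz_apply]
  congr 2
  funext ξ
  change Complex.exp (-Complex.I * ((inner ℝ ξ z : ℝ) : ℂ)) *
    (Complex.exp (Complex.I * ((inner ℝ x ξ : ℝ) : ℂ)) * m ξ) =
    Complex.exp (-Complex.I * ((inner ℝ ξ (z - x) : ℝ) : ℂ)) * m ξ
  rw [← mul_assoc, ← Complex.exp_add, inner_sub_right, real_inner_comm x ξ]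
  congr 2
  push_cast
  ring

theorem piece_eq {d : ℕ} (m : Rd d → ℂ) (hc : HasCompactSupport m) (hs : ContDiff ℝ ∞ m)
    (f : 𝓢'(Rd d, ℂ)) (x : Rd d) :
    piece m hc hs f x = (((2 * Real.pi) ^ (-(d : ℝ) / 2) : ℝ) : ℂ) *
      functional f (SchwartzMap.compSubConstCLM ℂ x (fourierSchwartz d (hc.toSchwartzMap hs))) := by
  rw [← fourierSchwartz_modulate]
  rfl

theorem continuous_piece {d : ℕ} (m : Rd d → ℂ) (hc : HasCompactSupport m) (hs : ContDiff ℝ ∞ m)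
    (f : 𝓢'(Rd d, ℂ)) : Continuous (piece m hc hs f) := by
  have : piece m hc hs f = fun x => (((2 * Real.pi) ^ (-(d : ℝ) / 2) : ℝ) : ℂ) *
      functional f (SchwartzMap.compSubConstCLM ℂ x (fourierSchwartz d (hc.toSchwartzMap hs))) :=
    funext fun x => piece_eq m hc hs f x
  rw [this]
  exact continuous_const.mul ((functional f).continuous.comp (continuous_translate _))

theorem measurable_enorm_piece {d : ℕ} (m : Rd d → ℂ) (hc : HasCompactSupport m)
    (hs : ContDiff ℝ ∞ m) (f : 𝓢'(Rd d, ℂ)) : Measurable fun x => ‖piece m hc hs f x‖ₑ :=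
  (continuous_piece m hc hs f).measurable.enorm

theorem exists_enorm_piece_le {d : ℕ} (m : Rd d → ℂ) (hc : HasCompactSupport m)
    (hs : ContDiff ℝ ∞ m) (f : 𝓢'(Rd d, ℂ)) :
    ∃ (A : ℝ≥0∞) (N : ℕ), A ≠ ⊤ ∧ ∀ x, ‖piece m hc hs f x‖ₑ ≤ A * weight 0 x ^ N := by
  obtain ⟨A, N, hA0, hA⟩ := exists_norm_map_translate_le (functional f)
    (fourierSchwartz d (hc.toSchwartzMap hs))
  set c : ℝ := (2 * Real.pi) ^ (-(d : ℝ) / 2) with hcdef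
  refine ⟨ENNReal.ofReal (|c| * A), N, ENNReal.ofReal_ne_top, fun x => ?_⟩
  rw [weight_eq_ofReal, ← ENNReal.ofReal_pow (by positivity), ← ENNReal.ofReal_mul (by positivity),
    ← ofReal_norm]
  refine ENNReal.ofReal_le_ofReal ?_
  rw [piece_eq, norm_mul, Complex.norm_real, Real.norm_eq_abs, mul_assoc]
  simpa using mul_le_mul_of_nonneg_left (hA x) (abs_nonneg c)

/-- The inversion formula: every Schwartz function is an inverse Fourier integral. -/
theorem exists_eq_integral_exp {d : ℕ} (M : 𝓢(Rd d, ℂ)) :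
    ∃ κ : 𝓢(Rd d, ℂ), ∀ ξ, M ξ =
      ∫ y, Complex.exp (Complex.I * ((inner ℝ y ξ : ℝ) : ℂ)) * κ y := by
  set M' : 𝓢(Rd d, ℂ) := SchwartzMap.compCLMOfContinuousLinearEquiv ℂ (dilation d).symm M with hM'
  refine ⟨𝓕 M', fun ξ => ?_⟩
  have h1 : M ξ = M' (dilation d ξ) := by
    rw [hM', SchwartzMap.compCLMOfContinuousLinearEquiv_apply]
    simp
  have h2 : M' = 𝓕⁻ (𝓕 M') := (FourierTransform.fourierInv_fourier_eq M').symm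
  rw [h1]
  nth_rewrite 1 [h2]
  rw [SchwartzMap.fourierInv_coe, Real.fourierInv_eq']
  refine integral_congr_ae (Filter.Eventually.of_forall fun y => ?_)
  have h3 : dilation d ξ = (2 * Real.pi)⁻¹ • ξ := rfl
  simp only [smul_eq_mul, h3, inner_smul_right]
  congr 2
  have : (Real.pi : ℂ) ≠ 0 := by exact_mod_cast Real.pi_ne_zero
  push_cast
  field_simp

/-- By Fubini the transform of m' is the convolution of κ with the transform of m. Applying f under
that integral turns the multiplier into an average of translates of the piece of m. -/
theorem piece_mul_eq_integral {d : ℕ} {m m' : Rd d → ℂ} (hc : HasCompactSupport m)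
    (hs : ContDiff ℝ ∞ m) (hc' : HasCompactSupport m') (hs' : ContDiff ℝ ∞ m')
    (κ : 𝓢(Rd d, ℂ))
    (hκ : ∀ ξ, m' ξ = m ξ * ∫ y, Complex.exp (Complex.I * ((inner ℝ y ξ : ℝ) : ℂ)) * κ y)
    (f : 𝓢'(Rd d, ℂ)) (x : Rd d) :
    piece m' hc' hs' f x = ∫ y, κ y * piece m hc hs f (x + y) := by
  set ψ := fourierSchwartz d (hc.toSchwartzMap hs) with hψ
  set ψ' := fourierSchwartz d (hc'.toSchwartzMap hs') with hψ'
  have hmS : Integrable m := (hc.toSchwartzMap hs).integrable (μ := volume)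
  have hconv : ∀ z, ψ' z = ∫ y, κ y * ψ (z - y) := by
    intro z
    rw [hψ', fourierSchwartz_apply]
    have e1 : ∀ y, κ y * ψ (z - y) = (((2 * Real.pi) ^ (-(d : ℝ) / 2) : ℝ) : ℂ) *
        ∫ ξ, Complex.exp (-Complex.I * ((inner ℝ ξ (z - y) : ℝ) : ℂ)) * m ξ * κ y := by
      intro y
      rw [integral_mul_const, hψ, fourierSchwartz_apply]
      change κ y * (_ * ∫ ξ, Complex.exp (-Complex.I * ((inner ℝ ξ (z - y) : ℝ) : ℂ)) * m ξ) = _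
      ring
    simp_rw [e1]
    rw [integral_const_mul]
    congr 1
    have hInt : Integrable (Function.uncurry fun (y ξ : Rd d) =>
        Complex.exp (-Complex.I * ((inner ℝ ξ (z - y) : ℝ) : ℂ)) * m ξ * κ y)
        (volume.prod volume) := by
      have h1 : Integrable (fun w : Rd d × Rd d => κ w.1 * m w.2) (volume.prod volume) :=
        (κ.integrable (μ := volume)).mul_prod hmS
      have hcm : Continuous m := hs.continuous
      refine h1.norm.mono' (Continuous.aestronglyMeasurable ?_)
        (Filter.Eventually.of_forall fun w => ?_)
      · have := κ.continuous
        simp only [Function.uncurry_def]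
        fun_prop
      · simp only [Function.uncurry_def, norm_mul]
        rw [show -Complex.I * ((inner ℝ w.2 (z - w.1) : ℝ) : ℂ) =
          ((-(inner ℝ w.2 (z - w.1)) : ℝ) : ℂ) * Complex.I by push_cast; ring,
          Complex.norm_exp_ofReal_mul_I, one_mul, mul_comm]
    rw [integral_integral_swap hInt]
    refine integral_congr_ae (Filter.Eventually.of_forall fun ξ => ?_)
    change Complex.exp (-Complex.I * ((inner ℝ ξ z : ℝ) : ℂ)) * m' ξ = _
    simp only
    rw [hκ ξ, ← mul_assoc, ← integral_const_mul]
    refine integral_congr_ae (Filter.Eventually.of_forall fun y => ?_)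
    simp only
    rw [inner_sub_right, real_inner_comm y ξ]
    rw [show -Complex.I * (((inner ℝ ξ z - inner ℝ y ξ : ℝ)) : ℂ) =
      -Complex.I * ((inner ℝ ξ z : ℝ) : ℂ) + Complex.I * ((inner ℝ y ξ : ℝ) : ℂ) by push_cast; ring,
      Complex.exp_add]
    ring
  have h := map_convolution_eq_integral (functional f) κ (SchwartzMap.compSubConstCLM ℂ x ψ)
    (SchwartzMap.compSubConstCLM ℂ x ψ') (fun z => by
      rw [SchwartzMap.compSubConstCLM_apply, hconv]
      refine integral_congr_ae (Filter.Eventually.of_forall fun y => ?_)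
      simp only [SchwartzMap.compSubConstCLM_apply]
      rw [sub_right_comm])
  rw [piece_eq, h, ← integral_const_mul]
  refine integral_congr_ae (Filter.Eventually.of_forall fun y => ?_)
  simp only [piece_eq, SchwartzMap.compSubConstCLM_comp]
  ring

theorem exists_enorm_schwartz_le_weight {d : ℕ} (κ : 𝓢(Rd d, ℂ)) (b : ℝ) :
    ∃ A : ℝ≥0∞, A ≠ ⊤ ∧ ∀ y, ‖κ y‖ₑ ≤ A * weight 0 y ^ (-b) := by
  obtain ⟨N, hN⟩ := exists_nat_ge b
  obtain ⟨A, hA0, hA⟩ := exists_one_add_norm_pow_mul_iteratedFDeriv_le κ N 0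
  refine ⟨ENNReal.ofReal A, ENNReal.ofReal_ne_top, fun y => ?_⟩
  have h := hA y
  rw [norm_iteratedFDeriv_zero] at h
  have hw := one_le_weight 0 y
  rw [ENNReal.rpow_neg, ← div_eq_mul_inv, ENNReal.le_div_iff_mul_le
    (Or.inl (by simp [weight_ne_zero, weight_ne_top, ENNReal.rpow_eq_zero_iff]))
    (Or.inl (by simp [weight_ne_zero, weight_ne_top, ENNReal.rpow_eq_top_iff]))]
  calc ‖κ y‖ₑ * weight 0 y ^ b ≤ ‖κ y‖ₑ * weight 0 y ^ (N : ℝ) := by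
        gcongr
    _ = ENNReal.ofReal ((1 + ‖y‖) ^ N * ‖κ y‖) := by
        rw [ENNReal.rpow_natCast, weight_eq_ofReal, ENNReal.ofReal_mul (by positivity), mul_comm,
          ofReal_norm, ENNReal.ofReal_pow (by positivity)]
        simp
    _ ≤ ENNReal.ofReal A := ENNReal.ofReal_le_ofReal h

/-- A Fourier multiplier `M (2^(-j) ·)` acts as a convolution at scale `2^(-j)`. -/
theorem exists_enorm_piece_mul_le {d : ℕ} {M : Rd d → ℂ} (hMc : HasCompactSupport M)
    (hMs : ContDiff ℝ ∞ M) (b : ℝ) :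
    ∃ A : ℝ≥0∞, A ≠ ⊤ ∧ ∀ (j : ℕ) (m m' : Rd d → ℂ) (hc : HasCompactSupport m)
      (hs : ContDiff ℝ ∞ m) (hc' : HasCompactSupport m') (hs' : ContDiff ℝ ∞ m'),
      (∀ ξ, m' ξ = m ξ * M ((2 : ℝ) ^ (-(j : ℤ)) • ξ)) → ∀ (f : 𝓢'(Rd d, ℂ)) (x : Rd d),
        ‖piece m' hc' hs' f x‖ₑ ≤ A * kernelConv j b (fun y => ‖piece m hc hs f y‖ₑ) x := by
  obtain ⟨κ, hκ⟩ := exists_eq_integral_exp (hMc.toSchwartzMap hMs)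
  obtain ⟨A, hA, hAκ⟩ := exists_enorm_schwartz_le_weight κ b
  refine ⟨A, hA, fun j m m' hc hs hc' hs' hm f x => ?_⟩
  set D : Rd d ≃L[ℝ] Rd d :=
    ContinuousLinearEquiv.smulLeft (Units.mk0 ((2 : ℝ) ^ j) (by positivity)) with hD
  -- The L_1-normalized dilate 2^(jd) κ(2^j ·), which represents M(2^(-j) ·).
  set κ' : 𝓢(Rd d, ℂ) := (((2 : ℝ) ^ (j * d) : ℝ) : ℂ) •
    SchwartzMap.compCLMOfContinuousLinearEquiv ℂ D κ with hκ'
  have hκ'_apply : ∀ y, κ' y = (((2 : ℝ) ^ (j * d) : ℝ) : ℂ) * κ ((2 : ℝ) ^ j • y) := fun y => rfl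
  have hdil : ∀ ξ, M ((2 : ℝ) ^ (-(j : ℤ)) • ξ) =
      ∫ y, Complex.exp (Complex.I * ((inner ℝ y ξ : ℝ) : ℂ)) * κ' y := by
    intro ξ
    have h1 := Measure.integral_comp_smul (volume : Measure (Rd d))
      (fun y => Complex.exp (Complex.I * ((inner ℝ y ((2 : ℝ) ^ (-(j : ℤ)) • ξ) : ℝ) : ℂ)) * κ y)
      ((2 : ℝ) ^ j)
    have h2 : M ((2 : ℝ) ^ (-(j : ℤ)) • ξ) = ∫ y, Complex.exp (Complex.I *
        ((inner ℝ y ((2 : ℝ) ^ (-(j : ℤ)) • ξ) : ℝ) : ℂ)) * κ y := hκ _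
    have h3 : ∀ y : Rd d, inner ℝ ((2 : ℝ) ^ j • y) ((2 : ℝ) ^ (-(j : ℤ)) • ξ) =
        (inner ℝ y ξ : ℝ) := by
      intro y
      rw [inner_smul_left, inner_smul_right, ← mul_assoc]
      simp
    simp_rw [h3] at h1
    rw [← h2, finrank_euclideanSpace, Fintype.card_fin, abs_of_nonneg (by positivity), ← pow_mul]
      at h1
    simp_rw [hκ'_apply, mul_left_comm _ (((2 : ℝ) ^ (j * d) : ℝ) : ℂ)]
    rw [integral_const_mul, h1, Complex.real_smul, ← mul_assoc, ← Complex.ofReal_mul,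
      mul_inv_cancel₀ (by positivity), Complex.ofReal_one, one_mul]
  rw [piece_mul_eq_integral hc hs hc' hs' κ' (fun ξ => by rw [hm ξ, hdil]) f x]
  refine (enorm_integral_le_lintegral_enorm _).trans ?_
  have hswap : kernelConv j b (fun y => ‖piece m hc hs f y‖ₑ) x =
      ∫⁻ y, kernel j b y * ‖piece m hc hs f (x + y)‖ₑ := by
    rw [kernelConv, ← lintegral_add_left_eq_self _ x]
    refine lintegral_congr fun y => ?_
    rw [kernel_sub_comm, add_sub_cancel_left]
  rw [hswap, ← lintegral_const_mul _ (by
    exact (measurable_kernel j b).mul ((measurable_enorm_piece m hc hs f).comp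
      (measurable_const.add measurable_id)))]
  refine lintegral_mono fun y => ?_
  rw [enorm_mul, ← mul_assoc]
  gcongr
  rw [hκ'_apply, enorm_mul, kernel, weight_eq_weight_zero]
  have h4 : ‖(((2 : ℝ) ^ (j * d) : ℝ) : ℂ)‖ₑ = 2 ^ (j * d) := by
    rw [← ofReal_norm, Complex.norm_real, Real.norm_of_nonneg (by positivity),
      ENNReal.ofReal_pow (by norm_num), ENNReal.ofReal_ofNat]
  rw [h4, mul_left_comm]
  gcongr
  exact hAκ _

/-! ### The Peetre maximal function -/

theorem measurable_kernel_const_sub {d : ℕ} (n : ℕ) (b : ℝ) (x : Rd d) :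
    Measurable fun y => kernel n b (x - y) :=
  (measurable_kernel n b).comp (measurable_const.sub measurable_id)

/-- The Peetre maximal function `sup_z g(z) / (1 + 2^n ‖x - z‖)^a`. -/
def peetre {d : ℕ} (n : ℕ) (a : ℝ) (g : Rd d → ℝ≥0∞) (x : Rd d) : ℝ≥0∞ :=
  ⨆ z, g z * weight n (x - z) ^ (-a)

theorem le_peetre_mul {d : ℕ} (n : ℕ) (a : ℝ) (g : Rd d → ℝ≥0∞) (x z : Rd d) :
    g z ≤ peetre n a g x * weight n (x - z) ^ a := by
  have h : g z * weight n (x - z) ^ (-a) ≤ peetre n a g x :=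
    le_iSup (fun z => g z * weight n (x - z) ^ (-a)) z
  calc g z = g z * weight n (x - z) ^ (-a) * weight n (x - z) ^ a := by
        rw [mul_assoc, ← ENNReal.rpow_add _ _ (weight_ne_zero _ _) (weight_ne_top _ _),
          neg_add_cancel, ENNReal.rpow_zero, mul_one]
    _ ≤ _ := by gcongr

theorem le_peetre {d : ℕ} (n : ℕ) (a : ℝ) (g : Rd d → ℝ≥0∞) (x : Rd d) :
    g x ≤ peetre n a g x := by
  simpa [weight] using le_peetre_mul n a g x x

theorem weight_rpow_neg_mul_le {d : ℕ} (n : ℕ) {a : ℝ} (ha : 0 ≤ a) (x y z : Rd d) :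
    weight n (z - y) ^ (-a) * weight n (x - z) ^ (-a) ≤ weight n (x - y) ^ (-a) := by
  rw [← ENNReal.mul_rpow_of_ne_top (weight_ne_top _ _) (weight_ne_top _ _), ENNReal.rpow_neg,
    ENNReal.rpow_neg, ENNReal.inv_le_inv]
  refine ENNReal.rpow_le_rpow ?_ ha
  have := weight_add_le n (x - z) (z - y)
  rwa [sub_add_sub_cancel, mul_comm] at this

/-- A pointwise bound by a convolution extends to the Peetre maximal function. -/
theorem peetre_le_of_le_kernelConv {d : ℕ} (n : ℕ) {a : ℝ} (ha : 0 ≤ a) {g h : Rd d → ℝ≥0∞}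
    (hh : Measurable h) {B : ℝ≥0∞} (hB : ∀ x, g x ≤ B * kernelConv n a h x) (x : Rd d) :
    peetre n a g x ≤ B * kernelConv n a h x := by
  refine iSup_le fun z => ?_
  calc g z * weight n (x - z) ^ (-a)
      ≤ (B * kernelConv n a h z) * weight n (x - z) ^ (-a) := by gcongr; exact hB z
    _ = B * ∫⁻ y, kernel n a (z - y) * h y * weight n (x - z) ^ (-a) := by
        rw [mul_assoc, kernelConv, lintegral_mul_const]
        exact (measurable_kernel_const_sub n a z).mul hh
    _ ≤ B * kernelConv n a h x := by
        refine mul_le_mul_right (lintegral_mono fun y => ?_) _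
        rw [kernel, kernel]
        calc 2 ^ (n * d) * weight n (z - y) ^ (-a) * h y * weight n (x - z) ^ (-a)
            = 2 ^ (n * d) * (weight n (z - y) ^ (-a) * weight n (x - z) ^ (-a)) * h y := by ring
          _ ≤ _ := by gcongr; exact weight_rpow_neg_mul_le n ha x y z

/-- The fraction 1 - r of g(y) (1 + 2^n ‖x - y‖)^(-a) is replaced by the supremum; the fraction r
remains, with decay a r. -/
theorem kernelConv_le_peetre_rpow_mul {d : ℕ} (n : ℕ) {a r : ℝ} (hr0 : 0 < r)
    (hr1 : r ≤ 1) {g : Rd d → ℝ≥0∞} (hg : Measurable g) (x : Rd d) :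
    kernelConv n a g x ≤
      peetre n a g x ^ (1 - r) * kernelConv n (a * r) (fun y => g y ^ r) x := by
  rw [kernelConv, kernelConv, ← lintegral_const_mul _
    ((measurable_kernel_const_sub n _ x).fun_mul (hg.pow_const _))]
  refine lintegral_mono fun y => ?_
  have h1 : g y * weight n (x - y) ^ (-a) ≤ peetre n a g x :=
    le_iSup (fun z => g z * weight n (x - z) ^ (-a)) y
  set P := peetre n a g x
  rw [kernel, kernel]
  have e : ∀ c : ℝ≥0∞, c = c ^ (1 - r) * c ^ r := by
    intro c
    rw [← ENNReal.rpow_add_of_nonneg _ _ (by linarith) hr0.le, sub_add_cancel, ENNReal.rpow_one]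
  calc 2 ^ (n * d) * weight n (x - y) ^ (-a) * g y
      = 2 ^ (n * d) * ((g y * weight n (x - y) ^ (-a)) ^ (1 - r) *
          (g y * weight n (x - y) ^ (-a)) ^ r) := by rw [← e]; ring
    _ ≤ 2 ^ (n * d) * (P ^ (1 - r) * (g y * weight n (x - y) ^ (-a)) ^ r) := by
        gcongr
    _ = _ := by
        rw [ENNReal.mul_rpow_of_nonneg _ _ hr0.le, ← ENNReal.rpow_mul, neg_mul]
        ring

/-- With P the Peetre function, the reproducing inequality gives P ≤ B P^(1-r) · (convolution of
g^r). Dividing by P^(1-r) requires P to be finite, and this is the only obstacle. -/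
theorem peetre_rpow_le_of_ne_top {d : ℕ} (n : ℕ) {a r : ℝ} (ha : 0 ≤ a) (hr0 : 0 < r) (hr1 : r ≤ 1)
    {g : Rd d → ℝ≥0∞} (hg : Measurable g) {B : ℝ≥0∞} (hB : ∀ x, g x ≤ B * kernelConv n a g x)
    {x : Rd d} (hP : peetre n a g x ≠ ⊤) :
    peetre n a g x ^ r ≤ B * kernelConv n (a * r) (fun y => g y ^ r) x := by
  set P := peetre n a g x with hPdef
  rcases eq_or_ne P 0 with h0 | h0
  · rw [h0, ENNReal.zero_rpow_of_pos hr0]; exact zero_le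
  have h1 : P ≤ B * (P ^ (1 - r) * kernelConv n (a * r) (fun y => g y ^ r) x) :=
    (peetre_le_of_le_kernelConv n ha hg hB x).trans
      (mul_le_mul_right (kernelConv_le_peetre_rpow_mul n hr0 hr1 hg x) _)
  have h2 : P ^ (1 - r) * P ^ r ≤ P ^ (1 - r) *
      (B * kernelConv n (a * r) (fun y => g y ^ r) x) := by
    rw [← ENNReal.rpow_add_of_nonneg _ _ (by linarith) hr0.le, sub_add_cancel, ENNReal.rpow_one]
    refine h1.trans (le_of_eq (by ring))
  refine (ENNReal.mul_le_mul_iff_right ?_ ?_).1 h2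
  · simp [ENNReal.rpow_eq_zero_iff, h0, hP]
  · exact ENNReal.rpow_ne_top_of_nonneg (by linarith) hP

theorem weight_zero_le_weight {d : ℕ} (n : ℕ) (y : Rd d) : weight 0 y ≤ weight n y := by
  unfold weight
  gcongr
  · norm_num
  · exact Nat.zero_le n

theorem peetre_ne_top_of_le_weight {d : ℕ} (n : ℕ) {a : ℝ} (ha : 0 ≤ a) {g : Rd d → ℝ≥0∞}
    {A : ℝ≥0∞} (hA : A ≠ ⊤) (hgA : ∀ x, g x ≤ A * weight 0 x ^ a) (x : Rd d) :
    peetre n a g x ≠ ⊤ := by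
  refine ne_top_of_le_ne_top (ENNReal.mul_ne_top hA
    (ENNReal.rpow_ne_top_of_nonneg ha (weight_ne_top 0 x))) (iSup_le fun z => ?_)
  calc g z * weight n (x - z) ^ (-a)
      ≤ (A * (weight 0 x * weight n (x - z)) ^ a) * weight n (x - z) ^ (-a) := by
        gcongr
        refine (hgA z).trans ?_
        gcongr
        have h1 := weight_add_le 0 x (z - x)
        rw [add_sub_cancel] at h1
        refine h1.trans (mul_le_mul_right ?_ _)
        rw [weight_sub_comm]
        exact weight_zero_le_weight n _
    _ = A * weight 0 x ^ a := by
        rw [ENNReal.mul_rpow_of_nonneg _ _ ha, mul_assoc, mul_assoc,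
          ← ENNReal.rpow_add _ _ (weight_ne_zero _ _) (weight_ne_top _ _), add_neg_cancel,
          ENNReal.rpow_zero, mul_one]

theorem kernel_antitone {d : ℕ} (n : ℕ) {a b : ℝ} (hab : a ≤ b) (y : Rd d) :
    kernel n b y ≤ kernel n a y := by
  unfold kernel
  gcongr
  · exact one_le_weight n y

/-- The Peetre maximal function of a band-limited function of polynomial growth is controlled by
convolutions of powers of the function. -/
theorem peetre_rpow_le {d : ℕ} (n : ℕ) {a r : ℝ} (ha : 0 ≤ a) (hr0 : 0 < r) (hr1 : r ≤ 1)
    {g : Rd d → ℝ≥0∞} (hg : Measurable g) {B : ℝ≥0∞} (hB0 : B ≠ 0)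
    (hB : ∀ x, g x ≤ B * kernelConv n a g x)
    (hall : ∀ a' : ℝ, ∃ B' : ℝ≥0∞, B' ≠ ⊤ ∧ ∀ x, g x ≤ B' * kernelConv n a' g x)
    (hgrowth : ∃ (A : ℝ≥0∞) (N : ℕ), A ≠ ⊤ ∧ ∀ x, g x ≤ A * weight 0 x ^ N) (x : Rd d) :
    peetre n a g x ^ r ≤ B * kernelConv n (a * r) (fun y => g y ^ r) x := by
  by_cases hI : kernelConv n (a * r) (fun y => g y ^ r) x = ⊤
  · rw [hI, ENNReal.mul_top hB0]; exact le_top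
  refine peetre_rpow_le_of_ne_top n ha hr0 hr1 hg hB ?_
  obtain ⟨A, N, hA, hgA⟩ := hgrowth
  -- With the exponent raised to the growth order N the Peetre function is finite and the division
  -- is allowed. Since kernels decrease in their exponent, the resulting bound on g^r also holds
  -- with the kernel of exponent a r.
  set a' : ℝ := max a N with ha'
  have haa' : a ≤ a' := le_max_left _ _
  have ha'0 : 0 ≤ a' := ha.trans haa'
  obtain ⟨B', hB', hgB'⟩ := hall a'
  have hgr : Measurable fun y => g y ^ r := hg.pow_const _
  have h1 : ∀ x, g x ^ r ≤ B' * kernelConv n (a * r) (fun y => g y ^ r) x := by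
    intro x
    have hfin : peetre n a' g x ≠ ⊤ := by
      refine peetre_ne_top_of_le_weight n ha'0 hA (fun x => (hgA x).trans ?_) x
      rw [← ENNReal.rpow_natCast]
      gcongr
      · exact one_le_weight 0 x
      · exact le_max_right _ _
    calc g x ^ r ≤ peetre n a' g x ^ r := ENNReal.rpow_le_rpow (le_peetre n a' g x) hr0.le
      _ ≤ B' * kernelConv n (a' * r) (fun y => g y ^ r) x :=
          peetre_rpow_le_of_ne_top n ha'0 hr0 hr1 hg hgB' hfin
      _ ≤ _ := by
          refine mul_le_mul_right (lintegral_mono fun y => mul_le_mul_left ?_ _) _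
          exact kernel_antitone n (by gcongr) _
  -- Passing to the Peetre supremum keeps the right-hand side, so the function with the original
  -- exponent a is finite too. The constant B' may depend on g through N; it serves for finiteness
  -- only and does not enter the result.
  have h2 := peetre_le_of_le_kernelConv n (mul_nonneg ha hr0.le) hgr h1 x
  have h3 : peetre n a g x ^ r ≤ peetre n (a * r) (fun y => g y ^ r) x := by
    rw [peetre, show (⨆ z, g z * weight n (x - z) ^ (-a)) ^ r =
      ⨆ z, (g z * weight n (x - z) ^ (-a)) ^ r from (ENNReal.orderIsoRpow r hr0).map_iSup _]
    refine iSup_mono fun z => ?_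
    rw [ENNReal.mul_rpow_of_nonneg _ _ hr0.le, ← ENNReal.rpow_mul, neg_mul]
  have h4 : peetre n a g x ^ r ≠ ⊤ :=
    ne_top_of_le_ne_top (ENNReal.mul_ne_top hB' hI) (h3.trans h2)
  intro h5
  rw [h5, ENNReal.top_rpow_of_pos hr0] at h4
  exact h4 rfl

/-- Convolutions at a comparable or finer scale are dominated by the Peetre maximal function. -/
theorem kernelConv_le_peetre {d : ℕ} {n j : ℕ} (hnj : n ≤ j + 1) {a : ℝ} (ha : 0 ≤ a) (b : ℝ)
    (g : Rd d → ℝ≥0∞) (x : Rd d) :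
    kernelConv j (a + b) g x ≤
      (2 ^ a * ∫⁻ y : Rd d, weight 0 y ^ (-b)) * peetre n a g x := by
  have hw : ∀ y : Rd d, weight n y ≤ 2 * weight j y := by
    intro y
    unfold weight
    calc 1 + 2 ^ n * ‖y‖ₑ ≤ 1 + 2 ^ (j + 1) * ‖y‖ₑ := by
          gcongr; norm_num
      _ ≤ 2 + 2 ^ (j + 1) * ‖y‖ₑ := by gcongr; norm_num
      _ = _ := by ring
  calc kernelConv j (a + b) g x
      ≤ ∫⁻ y, kernel j b (x - y) * (2 ^ a * peetre n a g x) := by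
        refine lintegral_mono fun y => ?_
        calc kernel j (a + b) (x - y) * g y
            ≤ kernel j (a + b) (x - y) * (peetre n a g x * (2 * weight j (x - y)) ^ a) := by
              gcongr
              refine (le_peetre_mul n a g x y).trans ?_
              gcongr
              exact hw _
          _ = kernel j b (x - y) * (2 ^ a * peetre n a g x) := by
              rw [ENNReal.mul_rpow_of_nonneg _ _ ha, kernel, kernel]
              have : weight j (x - y) ^ (-(a + b)) * weight j (x - y) ^ a =
                  weight j (x - y) ^ (-b) := by
                rw [← ENNReal.rpow_add _ _ (weight_ne_zero _ _) (weight_ne_top _ _)]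
                congr 1; ring
              rw [← this]; ring
    _ = _ := by
        rw [lintegral_mul_const _ (measurable_kernel_const_sub j b x), lintegral_kernel_sub]
        ring

/-! ### Sequence quasi-norms -/

/-- The `ℓ_q` quasi-norm of a family of extended non-negative numbers. -/
def lq {ι : Type*} (q : ℝ≥0∞) (a : ι → ℝ≥0∞) : ℝ≥0∞ :=
  if q = ⊤ then ⨆ k, a k else (∑' k, a k ^ q.toReal) ^ (1 / q.toReal)

theorem lqNorm_eq_lq {ι : Type*} (q : ℝ≥0∞) (a : ι → ℂ) : lqNorm q a = lq q fun k => ‖a k‖ₑ := rfl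

theorem lq_top {ι : Type*} (a : ι → ℝ≥0∞) : lq ⊤ a = ⨆ k, a k := by simp [lq]

theorem lq_of_ne_top {ι : Type*} {q : ℝ≥0∞} (hq : q ≠ ⊤) (a : ι → ℝ≥0∞) :
    lq q a = (∑' k, a k ^ q.toReal) ^ (1 / q.toReal) := by simp [lq, hq]

theorem lq_mono {ι : Type*} (q : ℝ≥0∞) {a b : ι → ℝ≥0∞} (h : ∀ k, a k ≤ b k) :
    lq q a ≤ lq q b := by
  by_cases hq : q = ⊤
  · subst hq; rw [lq_top, lq_top]; exact iSup_mono h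
  · rw [lq_of_ne_top hq, lq_of_ne_top hq]
    gcongr
    exact h _

theorem lq_const_mul {ι : Type*} {q : ℝ≥0∞} (hq : q ≠ 0) (c : ℝ≥0∞) (a : ι → ℝ≥0∞) :
    lq q (fun k => c * a k) = c * lq q a := by
  by_cases hqt : q = ⊤
  · subst hqt; rw [lq_top, lq_top, ENNReal.mul_iSup]
  · have hpos : 0 < q.toReal := ENNReal.toReal_pos hq hqt
    rw [lq_of_ne_top hqt, lq_of_ne_top hqt]
    simp_rw [ENNReal.mul_rpow_of_nonneg _ _ hpos.le]
    rw [ENNReal.tsum_mul_left, ENNReal.mul_rpow_of_nonneg _ _ (by positivity), ← ENNReal.rpow_mul,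
      mul_one_div_cancel hpos.ne', ENNReal.rpow_one]

theorem le_lq {ι : Type*} {q : ℝ≥0∞} (hq : q ≠ 0) (a : ι → ℝ≥0∞) (k : ι) : a k ≤ lq q a := by
  by_cases hqt : q = ⊤
  · subst hqt; rw [lq_top]; exact le_iSup a k
  · have hpos : 0 < q.toReal := ENNReal.toReal_pos hq hqt
    rw [lq_of_ne_top hqt]
    calc a k = (a k ^ q.toReal) ^ (1 / q.toReal) := by
          rw [← ENNReal.rpow_mul, mul_one_div_cancel hpos.ne', ENNReal.rpow_one]
      _ ≤ _ := by
          gcongr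
          exact ENNReal.le_tsum (f := fun k => a k ^ q.toReal) k

/-- A matrix all of whose powers have bounded row and column sums is bounded on every `ℓ_q`. -/
theorem exists_lq_le_of_matrix {J K : Type*} (W : J → K → ℝ≥0∞)
    (hW : ∀ e : ℝ, 0 < e → ∃ S : ℝ≥0∞, S ≠ ⊤ ∧ (∀ j, ∑' k, W j k ^ e ≤ S) ∧
      ∀ k, ∑' j, W j k ^ e ≤ S) {q : ℝ≥0∞} (hq : q ≠ 0) :
    ∃ C : ℝ≥0∞, C ≠ ⊤ ∧ ∀ (c : J → ℝ≥0∞) (b : K → ℝ≥0∞), (∀ j, c j ≤ ∑' k, W j k * b k) →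
      lq q c ≤ C * lq q b := by
  by_cases hqt : q = ⊤
  · subst hqt
    obtain ⟨S, hS, hrow, -⟩ := hW 1 one_pos
    refine ⟨S, hS, fun c b hcb => ?_⟩
    rw [lq_top, lq_top]
    refine iSup_le fun j => (hcb j).trans ?_
    calc ∑' k, W j k * b k ≤ ∑' k, W j k * ⨆ k, b k := by
          gcongr with k
          exact le_iSup b k
      _ ≤ S * ⨆ k, b k := by
          rw [ENNReal.tsum_mul_right]
          gcongr
          simpa using hrow j
  have hpos : 0 < q.toReal := ENNReal.toReal_pos hq hqt
  obtain ⟨S, hS, hrow, -⟩ := hW (1 / 2) (by norm_num)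
  obtain ⟨S', hS', -, hcol⟩ := hW (q.toReal / 2) (by positivity)
  refine ⟨S * S' ^ (1 / q.toReal), ENNReal.mul_ne_top hS
    (ENNReal.rpow_ne_top_of_nonneg (by positivity) hS'), fun c b hcb => ?_⟩
  rw [lq_of_ne_top hqt, lq_of_ne_top hqt]
  set ρ := q.toReal with hρ
  have h1 : ∀ j, c j ^ ρ ≤ S ^ ρ * ∑' k, W j k ^ (ρ / 2) * b k ^ ρ := by
    intro j
    -- Half of each matrix entry is kept for the summation over k; the other half stays with b k and
    -- is bounded by the whole ℓ_ρ sum. No convexity is involved, so ρ < 1 is allowed.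
    have h2 : c j ≤ S * (∑' k, W j k ^ (ρ / 2) * b k ^ ρ) ^ (1 / ρ) := by
      refine (hcb j).trans ?_
      refine le_trans (ENNReal.tsum_le_tsum (g := fun k => W j k ^ (1 / 2 : ℝ) *
        (∑' k, W j k ^ (ρ / 2) * b k ^ ρ) ^ (1 / ρ)) fun k => ?_) ?_
      · have e1 : W j k = W j k ^ (1 / 2 : ℝ) * W j k ^ (1 / 2 : ℝ) := by
          rw [← ENNReal.rpow_add_of_nonneg _ _ (by norm_num) (by norm_num)]
          norm_num
        nth_rewrite 1 [e1]
        rw [mul_assoc]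
        gcongr
        calc W j k ^ (1 / 2 : ℝ) * b k = (W j k ^ (ρ / 2) * b k ^ ρ) ^ (1 / ρ) := by
              rw [ENNReal.mul_rpow_of_nonneg _ _ (by positivity), ← ENNReal.rpow_mul,
                ← ENNReal.rpow_mul, mul_one_div_cancel hpos.ne', ENNReal.rpow_one]
              congr 2
              field_simp
          _ ≤ _ := by
              gcongr
              exact ENNReal.le_tsum (f := fun k => W j k ^ (ρ / 2) * b k ^ ρ) k
      · rw [ENNReal.tsum_mul_right]
        gcongr
        exact hrow j
    calc c j ^ ρ ≤ (S * (∑' k, W j k ^ (ρ / 2) * b k ^ ρ) ^ (1 / ρ)) ^ ρ := by gcongr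
      _ = _ := by
          rw [ENNReal.mul_rpow_of_nonneg _ _ hpos.le, ← ENNReal.rpow_mul,
            one_div_mul_cancel hpos.ne', ENNReal.rpow_one]
  calc (∑' j, c j ^ ρ) ^ (1 / ρ)
      ≤ (∑' j, S ^ ρ * ∑' k, W j k ^ (ρ / 2) * b k ^ ρ) ^ (1 / ρ) := by
        gcongr with j
        exact h1 j
    _ = (S ^ ρ * ∑' k, (∑' j, W j k ^ (ρ / 2)) * b k ^ ρ) ^ (1 / ρ) := by
        rw [ENNReal.tsum_mul_left, ENNReal.tsum_comm]
        simp_rw [ENNReal.tsum_mul_right]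
    _ ≤ (S ^ ρ * ∑' k, S' * b k ^ ρ) ^ (1 / ρ) := by
        gcongr with k
        exact hcol k
    _ = _ := by
        rw [ENNReal.tsum_mul_left, ENNReal.mul_rpow_of_nonneg _ _ (by positivity),
          ENNReal.mul_rpow_of_nonneg _ _ (by positivity), ← ENNReal.rpow_mul,
          mul_one_div_cancel hpos.ne', ENNReal.rpow_one, mul_assoc]

/-- Families dominated by convolutions of powers are bounded in `L_p(ℓ_q)`. -/
theorem exists_lintegral_lq_le_of_rpow_le_kernelConv (d : ℕ) {p r b : ℝ} (hb : d < b) {q : ℝ≥0∞}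
    (hr : 0 < r) (hrp : r < p) (hrq : ENNReal.ofReal r < q) {B : ℝ≥0∞} (hB : B ≠ ⊤) :
    ∃ C : ℝ≥0∞, C ≠ ⊤ ∧ ∀ {ι : Type} [Countable ι] (n : ι → ℕ) (P G : ι → Rd d → ℝ≥0∞),
      (∀ k, Measurable (G k)) →
      (∀ k x, P k x ^ r ≤ B * kernelConv (n k) b (fun y => G k y ^ r) x) →
      ∫⁻ x, lq q (fun k => P k x) ^ p ≤ C * ∫⁻ x, lq q (fun k => G k x) ^ p := by
  have hp : 0 < p := hr.trans hrp
  -- Raising to the power r moves the problem to L_(p/r)(ℓ_(q/r)), where the vector-valued maximal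
  -- inequality is available.
  have hu : 1 < p / r := (one_lt_div hr).2 hrp
  have er : ∀ c : ℝ≥0∞, ∀ s : ℝ, (c ^ r) ^ (s / r) = c ^ s := by
    intro c s; rw [← ENNReal.rpow_mul, mul_div_cancel₀ _ hr.ne']
  by_cases hqt : q = ⊤
  · subst hqt
    obtain ⟨C, hC, h⟩ := exists_lintegral_iSup_kernelConv_le d hb hu
    refine ⟨B ^ (p / r) * C, ENNReal.mul_ne_top (ENNReal.rpow_ne_top_of_nonneg (by positivity) hB) hC,
      fun {ι} _ n P G hG hP => ?_⟩
    have e : ∀ a : ι → ℝ≥0∞, (⨆ k, a k) ^ p = (⨆ k, a k ^ r) ^ (p / r) := by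
      intro a
      rw [← er (⨆ k, a k) p]
      congr 1
      exact (ENNReal.orderIsoRpow r hr).map_iSup _
    simp_rw [lq_top, e]
    calc _ ≤ ∫⁻ x, B ^ (p / r) * (⨆ k, kernelConv (n k) b (fun y => G k y ^ r) x) ^ (p / r) := by
          refine lintegral_mono fun x => ?_
          rw [← ENNReal.mul_rpow_of_nonneg _ _ (by positivity), ENNReal.mul_iSup]
          gcongr with k
          exact hP k x
      _ = B ^ (p / r) * ∫⁻ x, (⨆ k, kernelConv (n k) b (fun y => G k y ^ r) x) ^ (p / r) := by
          refine lintegral_const_mul _ (Measurable.pow_const ?_ _)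
          exact Measurable.iSup fun k => measurable_kernelConv (n k) b ((hG k).pow_const _)
      _ ≤ _ := by
          rw [mul_assoc]
          exact mul_le_mul_right (h n _ fun k => (hG k).pow_const _) _
  · set ρ := q.toReal with hρ
    have hrρ : r < ρ := (ENNReal.ofReal_lt_iff_lt_toReal hr.le hqt).1 hrq
    have hρ0 : 0 < ρ := hr.trans hrρ
    have hv : 1 < ρ / r := (one_lt_div hr).2 hrρ
    obtain ⟨C, hC, h⟩ := exists_lintegral_tsum_kernelConv_le d hb hu hv
    refine ⟨B ^ (p / r) * C, ENNReal.mul_ne_top (ENNReal.rpow_ne_top_of_nonneg (by positivity) hB) hC,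
      fun {ι} _ n P G hG hP => ?_⟩
    have huv : p / r / (ρ / r) = p / ρ := by field_simp
    have e : ∀ a : ι → ℝ≥0∞, lq q a ^ p = (∑' k, (a k ^ r) ^ (ρ / r)) ^ (p / r / (ρ / r)) := by
      intro a
      rw [lq_of_ne_top hqt, ← ENNReal.rpow_mul, huv, one_div_mul_eq_div]
      simp_rw [er]
      rfl
    simp_rw [e]
    calc _ ≤ ∫⁻ x, B ^ (p / r) * (∑' k, kernelConv (n k) b (fun y => G k y ^ r) x ^ (ρ / r)) ^
            (p / r / (ρ / r)) := by
          refine lintegral_mono fun x => ?_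
          have e2 : B ^ (p / r) = (B ^ (ρ / r)) ^ (p / r / (ρ / r)) := by
            rw [← ENNReal.rpow_mul, mul_div_cancel₀ _ (by positivity)]
          rw [e2, ← ENNReal.mul_rpow_of_nonneg _ _ (by positivity), ← ENNReal.tsum_mul_left]
          refine ENNReal.rpow_le_rpow (ENNReal.tsum_le_tsum fun k => ?_) (by positivity)
          rw [← ENNReal.mul_rpow_of_nonneg _ _ (by positivity)]
          exact ENNReal.rpow_le_rpow (hP k x) (by positivity)
      _ = B ^ (p / r) * ∫⁻ x, (∑' k, kernelConv (n k) b (fun y => G k y ^ r) x ^ (ρ / r)) ^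
            (p / r / (ρ / r)) := by
          refine lintegral_const_mul _ (Measurable.pow_const (Measurable.tsum fun k => ?_) _)
          exact (measurable_kernelConv (n k) b ((hG k).pow_const _)).pow_const _
      _ ≤ _ := by
          rw [mul_assoc]
          exact mul_le_mul_right (h n _ fun k => (hG k).pow_const _) _

/-! ### The embedding for negative smoothness -/

theorem piece_eq_sum {d : ℕ} {ι : Type*} (S : Finset ι) {m : Rd d → ℂ} {μ : ι → Rd d → ℂ}
    (hc : HasCompactSupport m) (hs : ContDiff ℝ ∞ m) (hcμ : ∀ k, HasCompactSupport (μ k))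
    (hsμ : ∀ k, ContDiff ℝ ∞ (μ k)) (h : ∀ ξ, m ξ = ∑ k ∈ S, μ k ξ) (f : 𝓢'(Rd d, ℂ)) (x : Rd d) :
    piece m hc hs f x = ∑ k ∈ S, piece (μ k) (hcμ k) (hsμ k) f x := by
  have e : modulate m hc hs x = ∑ k ∈ S, modulate (μ k) (hcμ k) (hsμ k) x := by
    ext ξ
    rw [sum_apply]
    change Complex.exp (Complex.I * ((inner ℝ x ξ : ℝ) : ℂ)) * m ξ =
      ∑ k ∈ S, Complex.exp (Complex.I * ((inner ℝ x ξ : ℝ) : ℂ)) * μ k ξ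
    rw [h, Finset.mul_sum]
  unfold piece
  rw [e, map_sum, Finset.mul_sum]

theorem sum_dyadic {V : Type*} [AddCommGroup V] [Module ℝ V] (φ₀ : V → ℂ) (J : ℕ) (x : V) :
    ∑ j ∈ Finset.range (J + 1), dyadic φ₀ j x = φ₀ ((2 : ℝ) ^ (-(J : ℤ)) • x) := by
  induction J with
  | zero => simp [dyadic]
  | succ J ih =>
    rw [Finset.sum_range_succ, ih, dyadic, if_neg (Nat.succ_ne_zero J)]
    have : (-((J + 1 : ℕ) : ℤ) + 1) = -(J : ℤ) := by push_cast; ring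
    rw [this]
    ring

theorem LineGenerator.eq_zero (Ψ : LineGenerator) {ξ : ℝ} (hξ : 3 / 2 < |ξ|) : Ψ.φ₀ ξ = 0 := by
  refine image_eq_zero_of_notMem_tsupport fun h => ?_
  have := Ψ.tsupport_subset h
  rw [Set.mem_Icc, ← abs_le] at this
  linarith

theorem LineGenerator.dyadic_eq_zero (Ψ : LineGenerator) (j : ℕ) {ξ : ℝ}
    (hξ : 3 / 2 * 2 ^ j < |ξ|) : dyadic Ψ.φ₀ j ξ = 0 := by
  have h1 : 3 / 2 < |(2 : ℝ) ^ (-(j : ℤ)) • ξ| := by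
    rw [smul_eq_mul, abs_mul, abs_of_pos (by positivity), zpow_neg, zpow_natCast,
      inv_mul_eq_div, lt_div_iff₀ (by positivity)]
    exact hξ
  have h2 : 3 / 2 < |(2 : ℝ) ^ (-(j : ℤ) + 1) • ξ| := by
    refine h1.trans_le ?_
    rw [smul_eq_mul, smul_eq_mul, abs_mul, abs_mul,
      abs_of_pos (zpow_pos (two_pos : (0 : ℝ) < 2) _), abs_of_pos (zpow_pos (two_pos : (0 : ℝ) < 2) _)]
    gcongr
    · norm_num
    · omega
  unfold dyadic
  split_ifs with hj
  · subst hj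
    exact Ψ.eq_zero (by simpa using hξ)
  · rw [Ψ.eq_zero h1, Ψ.eq_zero h2, sub_zero]

theorem IsotropicGenerator.system_eq_zero {d : ℕ} (Φ : IsotropicGenerator d) (j : ℕ) {ξ : Rd d}
    (hξ : 3 / 2 * 2 ^ j ≤ ‖ξ‖) : Φ.system j ξ = 0 := by
  have h1 : 3 / 2 ≤ ‖(2 : ℝ) ^ (-(j : ℤ)) • ξ‖ := by
    rw [norm_smul, Real.norm_of_nonneg (by positivity), zpow_neg, zpow_natCast,
      inv_mul_eq_div, le_div_iff₀ (by positivity)]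
    exact hξ
  have h2 : 3 / 2 ≤ ‖(2 : ℝ) ^ (-(j : ℤ) + 1) • ξ‖ := by
    refine h1.trans ?_
    rw [norm_smul, norm_smul, Real.norm_of_nonneg (by positivity),
      Real.norm_of_nonneg (by positivity)]
    gcongr
    · norm_num
    · omega
  unfold IsotropicGenerator.system dyadic
  split_ifs with hj
  · subst hj
    change ((Φ.φ₀ ξ : ℝ) : ℂ) = 0
    rw [Φ.eq_zero _ (by simpa using hξ), Complex.ofReal_zero]
  · simp only [Φ.eq_zero _ h1, Φ.eq_zero _ h2, Complex.ofReal_zero, sub_zero]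

/-- The tensor system sums to one on the support of the `j`-th isotropic function. -/
theorem system_eq_sum {d : ℕ} (Φ : IsotropicGenerator d) (Ψ : LineGenerator) (j : ℕ) (ξ : Rd d) :
    Φ.system j ξ = ∑ k ∈ Fintype.piFinset fun _ : Fin d => Finset.range (j + 1 + 1),
      Ψ.system k ξ * Φ.system j ξ := by
  by_cases h0 : Φ.system j ξ = 0
  · simp [h0]
  have hξ : ‖ξ‖ < 3 / 2 * 2 ^ j := by
    by_contra h
    exact h0 (Φ.system_eq_zero j (not_lt.1 h))
  rw [← Finset.sum_mul]
  -- The sum factors over coordinates and telescopes in each. The range must reach j + 1, because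
  -- |ξ_i| may be as large as (3/2) 2^j, which exceeds 2^j but not 2^(j+1).
  have : ∑ k ∈ Fintype.piFinset fun _ : Fin d => Finset.range (j + 1 + 1), Ψ.system k ξ = 1 := by
    unfold LineGenerator.system
    rw [← Finset.prod_univ_sum (fun _ : Fin d => Finset.range (j + 1 + 1))
      (fun i κ => dyadic Ψ.φ₀ κ (ξ i))]
    refine Finset.prod_eq_one fun i _ => ?_
    rw [sum_dyadic]
    refine Ψ.eq_one _ (abs_le.1 ?_)
    rw [smul_eq_mul, abs_mul, abs_of_pos (by positivity), zpow_neg, zpow_natCast, inv_mul_eq_div,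
      div_le_one (by positivity), pow_succ]
    have h1 : |ξ i| ≤ ‖ξ‖ := PiLp.norm_apply_le ξ i
    nlinarith [pow_pos (two_pos : (0 : ℝ) < 2) j]
  rw [this, one_mul]

/-- The largest component of a multi-index. -/
def maxIndex {d : ℕ} (k : Fin d → ℕ) : ℕ := Finset.univ.sup k

theorem norm_le_sum_abs {d : ℕ} (ξ : Rd d) : ‖ξ‖ ≤ ∑ i, |ξ i| := by
  have h : ξ = ∑ i, EuclideanSpace.single i (ξ i) := by
    ext j; simp
  conv_lhs => rw [h]
  refine (norm_sum_le _ _).trans (le_of_eq ?_)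
  simp

theorem LineGenerator.norm_le_of_system_ne_zero (Ψ : LineGenerator) {d : ℕ} {k : Fin d → ℕ}
    {ξ : Rd d} (h : Ψ.system k ξ ≠ 0) : ‖ξ‖ ≤ (d : ℝ) * (3 / 2 * 2 ^ maxIndex k) := by
  have hi : ∀ i, |ξ i| ≤ 3 / 2 * 2 ^ maxIndex k := by
    intro i
    have h1 : |ξ i| ≤ 3 / 2 * 2 ^ k i := by
      by_contra hlt
      exact h (Finset.prod_eq_zero (Finset.mem_univ i) (Ψ.dyadic_eq_zero (k i) (not_le.1 hlt)))
    refine h1.trans ?_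
    gcongr
    · norm_num
    · exact Finset.le_sup (Finset.mem_univ i)
  calc ‖ξ‖ ≤ ∑ i, |ξ i| := norm_le_sum_abs ξ
    _ ≤ ∑ _i : Fin d, 3 / 2 * 2 ^ maxIndex k := Finset.sum_le_sum fun i _ => hi i
    _ = _ := by simp

/-- A smooth compactly supported function which is one on a given ball. -/
theorem exists_cutoff (d : ℕ) (R : ℝ) : ∃ θ : Rd d → ℂ, HasCompactSupport θ ∧ ContDiff ℝ ∞ θ ∧
    ∀ ξ, ‖ξ‖ ≤ R → θ ξ = 1 := by
  set β : ContDiffBump (0 : Rd d) := ⟨max R 0 + 1, max R 0 + 2, by positivity, by linarith⟩ with hβ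
  refine ⟨fun ξ => ((β ξ : ℝ) : ℂ), ?_, ?_, fun ξ hξ => ?_⟩
  · exact β.hasCompactSupport.comp_left (g := fun r : ℝ => (r : ℂ)) Complex.ofReal_zero
  · exact Complex.ofRealCLM.contDiff.comp β.contDiff
  · simp only
    rw [β.one_of_mem_closedBall, Complex.ofReal_one]
    rw [mem_closedBall_zero_iff]
    change ‖ξ‖ ≤ max R 0 + 1
    linarith [le_max_left R 0]

/-- The pieces of the tensor system satisfy the Peetre inequality uniformly. -/
theorem exists_peetre_piece_rpow_le {d : ℕ} (Ψ : LineGenerator) {a r : ℝ} (ha : 0 ≤ a) (hr0 : 0 < r)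
    (hr1 : r ≤ 1) :
    ∃ B : ℝ≥0∞, B ≠ ⊤ ∧ ∀ (f : 𝓢'(Rd d, ℂ)) (k : Fin d → ℕ) (x : Rd d),
      peetre (maxIndex k) a (fun y => ‖piece (Ψ.system k) (Ψ.system_hasCompactSupport k)
        (Ψ.system_contDiff k) f y‖ₑ) x ^ r ≤
      B * kernelConv (maxIndex k) (a * r) (fun y => ‖piece (Ψ.system k)
        (Ψ.system_hasCompactSupport k) (Ψ.system_contDiff k) f y‖ₑ ^ r) x := by
  -- The support of the k-th tensor function lies in the ball of radius (3d/2) 2^(max k). The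
  -- dilated cutoff is one there, so it reproduces the piece by a convolution at scale 2^(-max k).
  obtain ⟨θ, hθc, hθs, hθ⟩ := exists_cutoff d (d * (3 / 2))
  have hrep : ∀ (k : Fin d → ℕ) (ξ : Rd d), Ψ.system k ξ =
      Ψ.system k ξ * θ ((2 : ℝ) ^ (-(maxIndex k : ℤ)) • ξ) := by
    intro k ξ
    by_cases h0 : Ψ.system k ξ = 0
    · simp [h0]
    · rw [hθ, mul_one]
      have h1 := Ψ.norm_le_of_system_ne_zero h0
      rw [norm_smul, Real.norm_of_nonneg (by positivity), zpow_neg, zpow_natCast, inv_mul_eq_div,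
        div_le_iff₀ (by positivity)]
      linarith
  have hbd : ∀ b : ℝ, ∃ B : ℝ≥0∞, B ≠ ⊤ ∧ ∀ (f : 𝓢'(Rd d, ℂ)) (k : Fin d → ℕ) (x : Rd d),
      ‖piece (Ψ.system k) (Ψ.system_hasCompactSupport k) (Ψ.system_contDiff k) f x‖ₑ ≤
      B * kernelConv (maxIndex k) b (fun y => ‖piece (Ψ.system k)
        (Ψ.system_hasCompactSupport k) (Ψ.system_contDiff k) f y‖ₑ) x := by
    intro b
    obtain ⟨A, hA, h⟩ := exists_enorm_piece_mul_le hθc hθs b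
    exact ⟨A, hA, fun f k x => h (maxIndex k) _ _ _ _ _ _ (hrep k) f x⟩
  obtain ⟨B, hB, hBk⟩ := hbd a
  -- `peetre_rpow_le` needs a nonzero constant.
  refine ⟨B + 1, by simp [hB], fun f k x => ?_⟩
  refine peetre_rpow_le _ ha hr0 hr1 (measurable_enorm_piece _ _ _ f) (by simp) (fun x => ?_) ?_ ?_ x
  · exact (hBk f k x).trans (mul_le_mul_left le_self_add _)
  · intro a'
    obtain ⟨B', hB', h⟩ := hbd a'
    exact ⟨B', hB', h f k⟩
  · exact exists_enorm_piece_le _ _ _ f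

theorem system_mul_hasCompactSupport {d : ℕ} (Φ : IsotropicGenerator d) (Ψ : LineGenerator) (j : ℕ)
    (k : Fin d → ℕ) : HasCompactSupport fun ξ : Rd d => Ψ.system k ξ * Φ.system j ξ :=
  (Φ.system_hasCompactSupport j).mul_left

theorem system_mul_contDiff {d : ℕ} (Φ : IsotropicGenerator d) (Ψ : LineGenerator) (j : ℕ)
    (k : Fin d → ℕ) : ContDiff ℝ ∞ fun ξ : Rd d => Ψ.system k ξ * Φ.system j ξ :=
  (Ψ.system_contDiff k).mul (Φ.system_contDiff j)

/-- The isotropic multipliers act on the tensor pieces within the Peetre maximal function. -/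
theorem exists_enorm_piece_system_mul_le {d : ℕ} (Φ : IsotropicGenerator d) (Ψ : LineGenerator)
    {a : ℝ} (ha : 0 ≤ a) :
    ∃ A : ℝ≥0∞, A ≠ ⊤ ∧ ∀ (f : 𝓢'(Rd d, ℂ)) (j : ℕ) (k : Fin d → ℕ), maxIndex k ≤ j + 1 →
      ∀ x : Rd d, ‖piece _ (system_mul_hasCompactSupport Φ Ψ j k) (system_mul_contDiff Φ Ψ j k) f x‖ₑ ≤
        A * peetre (maxIndex k) a (fun y => ‖piece (Ψ.system k) (Ψ.system_hasCompactSupport k)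
          (Ψ.system_contDiff k) f y‖ₑ) x := by
  set b : ℝ := d + 1 with hb
  set W := ∫⁻ y : Rd d, weight 0 y ^ (-b) with hW
  have hWtop : W ≠ ⊤ := (lintegral_weight_rpow_lt_top (by linarith)).ne
  -- Two multipliers serve all j: φ_0 itself, and for j ≥ 1 the dilations by 2^(-j) of φ_1(2 ·). The
  -- decay a + b leaves an integrable kernel after a powers are given to the Peetre function.
  obtain ⟨A₀, hA₀, h₀⟩ := exists_enorm_piece_mul_le (Φ.system_hasCompactSupport 0)
    (Φ.system_contDiff 0) (a + b)
  have hχc : HasCompactSupport fun ξ => Φ.system 1 ((2 : ℝ) • ξ) :=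
    (Φ.system_hasCompactSupport 1).comp_smul two_ne_zero
  have hχs : ContDiff ℝ ∞ fun ξ => Φ.system 1 ((2 : ℝ) • ξ) :=
    (Φ.system_contDiff 1).comp (contDiff_const_smul _)
  obtain ⟨A₁, hA₁, h₁⟩ := exists_enorm_piece_mul_le hχc hχs (a + b)
  have hfin : (2 : ℝ≥0∞) ^ a * W ≠ ⊤ := ENNReal.mul_ne_top (by finiteness) hWtop
  refine ⟨(A₀ + A₁) * (2 ^ a * W), ENNReal.mul_ne_top (by simp [hA₀, hA₁]) hfin,
    fun f j k hk x => ?_⟩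
  set g : Rd d → ℝ≥0∞ := fun y => ‖piece (Ψ.system k) (Ψ.system_hasCompactSupport k)
          (Ψ.system_contDiff k) f y‖ₑ with hg
  have key : ‖piece _ (system_mul_hasCompactSupport Φ Ψ j k) (system_mul_contDiff Φ Ψ j k) f x‖ₑ ≤
      (A₀ + A₁) * kernelConv j (a + b) g x := by
    rcases Nat.eq_zero_or_pos j with rfl | hj
    · refine (h₀ 0 _ _ (Ψ.system_hasCompactSupport k) (Ψ.system_contDiff k)
        (system_mul_hasCompactSupport Φ Ψ 0 k) (system_mul_contDiff Φ Ψ 0 k) (fun ξ => by simp) f x).trans ?_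
      exact mul_le_mul_left le_self_add _
    · refine (h₁ j _ _ (Ψ.system_hasCompactSupport k) (Ψ.system_contDiff k)
        (system_mul_hasCompactSupport Φ Ψ j k) (system_mul_contDiff Φ Ψ j k) (fun ξ => ?_) f x).trans ?_
      · congr 1
        unfold IsotropicGenerator.system dyadic
        rw [if_neg hj.ne', if_neg one_ne_zero]
        have e1 : (2 : ℝ) ^ (-((1 : ℕ) : ℤ)) • (2 : ℝ) • (2 : ℝ) ^ (-(j : ℤ)) • ξ =
            (2 : ℝ) ^ (-(j : ℤ)) • ξ := by
          rw [smul_smul]; simp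
        have e2 : (2 : ℝ) ^ (-((1 : ℕ) : ℤ) + 1) • (2 : ℝ) • (2 : ℝ) ^ (-(j : ℤ)) • ξ =
            (2 : ℝ) ^ (-(j : ℤ) + 1) • ξ := by
          rw [smul_smul, smul_smul, zpow_add₀ two_ne_zero (-(j : ℤ))]
          simp [mul_comm]
        rw [e1, e2]
      · exact mul_le_mul_left le_add_self _
  refine key.trans ?_
  rw [mul_assoc]
  exact mul_le_mul_right (kernelConv_le_peetre hk ha b g x) _

/-! ### Row and column sums of the decay matrix. -/

/-- The factors `2^(t (j - κ))`, `κ ≤ j + 1`, written as a function of `j + 1 - κ`. -/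
def decayFactor (t : ℝ) (j κ : ℕ) : ℝ≥0∞ :=
  if κ ≤ j + 1 then (2 : ℝ≥0∞) ^ (t * (((j + 1 - κ : ℕ) : ℝ) - 1)) else 0

theorem tsum_two_rpow_ne_top {t : ℝ} (ht : t < 0) :
    ∑' i : ℕ, (2 : ℝ≥0∞) ^ (t * ((i : ℝ) - 1)) ≠ ⊤ := by
  have e : ∀ i : ℕ, (2 : ℝ≥0∞) ^ (t * ((i : ℝ) - 1)) = 2 ^ (-t) * (2 ^ t) ^ i := by
    intro i
    rw [← ENNReal.rpow_natCast, ← ENNReal.rpow_mul, ← ENNReal.rpow_add _ _ two_ne_zero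
      ENNReal.ofNat_ne_top]
    congr 1; ring
  simp_rw [e]
  rw [ENNReal.tsum_mul_left, ENNReal.tsum_geometric]
  refine ENNReal.mul_ne_top (by finiteness) ?_
  rw [ENNReal.inv_ne_top]
  exact (tsub_pos_iff_lt.2 (ENNReal.rpow_lt_one_of_one_lt_of_neg ENNReal.one_lt_two ht)).ne'

theorem tsum_decayFactor_right_le (t : ℝ) (j : ℕ) :
    ∑' κ, decayFactor t j κ ≤ ∑' i : ℕ, (2 : ℝ≥0∞) ^ (t * ((i : ℝ) - 1)) := by
  have e : ∀ κ, decayFactor t j κ = {κ : ℕ | κ ≤ j + 1}.indicator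
      (fun κ => (2 : ℝ≥0∞) ^ (t * (((j + 1 - κ : ℕ) : ℝ) - 1))) κ := fun κ => by
    simp [decayFactor, Set.indicator]
  simp_rw [e]
  rw [← tsum_subtype]
  refine ENNReal.tsum_comp_le_tsum_of_injective (f := fun κ : {κ : ℕ | κ ≤ j + 1} => j + 1 - (κ : ℕ))
    (fun a b hab => ?_) (fun i : ℕ => (2 : ℝ≥0∞) ^ (t * ((i : ℝ) - 1)))
  have ha : (a : ℕ) ≤ j + 1 := a.2
  have hb : (b : ℕ) ≤ j + 1 := b.2
  simp only at hab
  exact Subtype.ext (by omega)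

theorem tsum_decayFactor_left_le (t : ℝ) (κ : ℕ) :
    ∑' j, decayFactor t j κ ≤ ∑' i : ℕ, (2 : ℝ≥0∞) ^ (t * ((i : ℝ) - 1)) := by
  have e : ∀ j, decayFactor t j κ = {j : ℕ | κ ≤ j + 1}.indicator
      (fun j => (2 : ℝ≥0∞) ^ (t * (((j + 1 - κ : ℕ) : ℝ) - 1))) j := fun j => by
    simp [decayFactor, Set.indicator]
  simp_rw [e]
  rw [← tsum_subtype]
  refine ENNReal.tsum_comp_le_tsum_of_injective (f := fun j : {j : ℕ | κ ≤ j + 1} => (j : ℕ) + 1 - κ)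
    (fun a b hab => ?_) (fun i : ℕ => (2 : ℝ≥0∞) ^ (t * ((i : ℝ) - 1)))
  have ha : κ ≤ (a : ℕ) + 1 := a.2
  have hb : κ ≤ (b : ℕ) + 1 := b.2
  simp only at hab
  exact Subtype.ext (by omega)

/-- Row sums factor into d geometric series. In a column sum only j varies, so one factor supplies
the geometric series and the remaining ones are merely bounded. -/
theorem exists_decay_matrix_bound {d : ℕ} (hd : 0 < d) {t : ℝ} (ht : t < 0) :
    ∃ S : ℝ≥0∞, S ≠ ⊤ ∧ (∀ j, ∑' k : Fin d → ℕ, ∏ i, decayFactor t j (k i) ≤ S) ∧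
      ∀ k : Fin d → ℕ, ∑' j, ∏ i, decayFactor t j (k i) ≤ S := by
  set G := ∑' i : ℕ, (2 : ℝ≥0∞) ^ (t * ((i : ℝ) - 1)) with hG
  have hGtop : G ≠ ⊤ := tsum_two_rpow_ne_top ht
  refine ⟨G ^ d, by finiteness, fun j => ?_, fun k => ?_⟩
  · rw [tsum_eq_sum (s := Fintype.piFinset fun _ : Fin d => Finset.range (j + 1 + 1))]
    · rw [← Finset.prod_univ_sum (fun _ : Fin d => Finset.range (j + 1 + 1))
        (fun _ κ => decayFactor t j κ)]
      calc _ ≤ ∏ _i : Fin d, G := Finset.prod_le_prod' fun i _ =>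
            (ENNReal.sum_le_tsum _).trans (tsum_decayFactor_right_le t j)
        _ = G ^ d := by simp
    · intro k hk
      rw [Fintype.mem_piFinset, not_forall] at hk
      obtain ⟨i, hi⟩ := hk
      refine Finset.prod_eq_zero (Finset.mem_univ i) ?_
      rw [decayFactor, if_neg]
      simpa using hi
  · have hle : ∀ j κ, decayFactor t j κ ≤ G := fun j κ =>
      (ENNReal.le_tsum κ).trans (tsum_decayFactor_right_le t j)
    obtain ⟨d, rfl⟩ : ∃ d', d = d' + 1 := ⟨d - 1, by omega⟩
    calc ∑' j, ∏ i, decayFactor t j (k i) ≤ ∑' j, decayFactor t j (k 0) * G ^ d := by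
          refine ENNReal.tsum_le_tsum fun j => ?_
          rw [Fin.prod_univ_succ]
          gcongr
          calc _ ≤ ∏ _i : Fin d, G := Finset.prod_le_prod' fun i _ => hle _ _
            _ = G ^ d := by simp
      _ ≤ G * G ^ d := by
          rw [ENNReal.tsum_mul_right]
          gcongr
          exact tsum_decayFactor_left_le t (k 0)
      _ = G ^ (d + 1) := by ring

theorem decayFactor_rpow (t : ℝ) (j κ : ℕ) {e : ℝ} (he : 0 < e) :
    decayFactor t j κ ^ e = decayFactor (t * e) j κ := by
  unfold decayFactor
  split_ifs with h
  · rw [← ENNReal.rpow_mul]; congr 1; ring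
  · exact ENNReal.zero_rpow_of_pos he

theorem prod_two_rpow {ι : Type*} (S : Finset ι) (e : ι → ℝ) :
    ∏ i ∈ S, (2 : ℝ≥0∞) ^ e i = 2 ^ ∑ i ∈ S, e i := by
  classical
  induction S using Finset.induction_on with
  | empty => simp
  | insert i S hi ih =>
    rw [Finset.prod_insert hi, Finset.sum_insert hi, ih,
      ENNReal.rpow_add _ _ two_ne_zero ENNReal.ofNat_ne_top]

/-- This exchange of weights is where the isotropic smoothness td comes from: each of the d
coordinates contributes 2^(jt). -/
theorem prod_decayFactor_eq {d : ℕ} (t : ℝ) (j : ℕ) {k : Fin d → ℕ} (hk : ∀ i, k i ≤ j + 1) :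
    ∏ i, decayFactor t j (k i) =
      (2 : ℝ≥0∞) ^ ((j : ℝ) * (t * d)) * (2 : ℝ≥0∞) ^ (-(((∑ i, k i : ℕ) : ℝ) * t)) := by
  have e : ∀ i, decayFactor t j (k i) =
      (2 : ℝ≥0∞) ^ (j * t) * (2 : ℝ≥0∞) ^ (-((k i : ℝ) * t)) := by
    intro i
    rw [decayFactor, if_pos (hk i), ← ENNReal.rpow_add _ _ two_ne_zero ENNReal.ofNat_ne_top,
      Nat.cast_sub (hk i)]
    congr 1
    push_cast
    ring
  simp_rw [e]
  rw [Finset.prod_mul_distrib]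
  congr 1
  · rw [Finset.prod_const, Finset.card_univ, Fintype.card_fin, ← ENNReal.rpow_natCast,
      ← ENNReal.rpow_mul]
    congr 1; ring
  · rw [Nat.cast_sum, Finset.sum_mul, ← Finset.sum_neg_distrib]
    exact prod_two_rpow _ _

theorem enorm_two_rpow_mul (s : ℝ) (z : ℂ) :
    ‖(((2 : ℝ) ^ s : ℝ) : ℂ) * z‖ₑ = (2 : ℝ≥0∞) ^ s * ‖z‖ₑ := by
  rw [enorm_mul]
  congr 1
  rw [← ofReal_norm, Complex.norm_real, Real.norm_of_nonneg (by positivity),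
    ← ENNReal.ofReal_rpow_of_pos two_pos]
  simp

theorem isoNorm_eq {d : ℕ} (Φ : IsotropicGenerator d) (s p : ℝ) (q : ℝ≥0∞) (f : 𝓢'(Rd d, ℂ)) :
    isoNorm Φ s p q f = (∫⁻ x, lq q (fun j : ℕ => (2 : ℝ≥0∞) ^ ((j : ℝ) * s) *
      ‖piece (Φ.system j) (Φ.system_hasCompactSupport j) (Φ.system_contDiff j) f x‖ₑ) ^ p) ^ (1 / p) := by
  unfold isoNorm LpLqNorm
  simp_rw [lqNorm_eq_lq, enorm_two_rpow_mul]

theorem mixedNorm_eq {d : ℕ} (Ψ : LineGenerator) (t p : ℝ) (q : ℝ≥0∞) (f : 𝓢'(Rd d, ℂ)) :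
    mixedNorm Ψ t p q f = (∫⁻ x, lq q (fun k : Fin d → ℕ =>
      (2 : ℝ≥0∞) ^ (((∑ i, k i : ℕ) : ℝ) * t) * ‖piece (Ψ.system k) (Ψ.system_hasCompactSupport k)
        (Ψ.system_contDiff k) f x‖ₑ) ^ p) ^ (1 / p) := by
  unfold mixedNorm LpLqNorm
  simp_rw [lqNorm_eq_lq, enorm_two_rpow_mul]

/-- The isotropic pieces are controlled by the Peetre maximal functions of the tensor pieces. -/
theorem exists_two_rpow_mul_enorm_piece_le {d : ℕ} (Φ : IsotropicGenerator d) (Ψ : LineGenerator)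
    {a : ℝ} (ha : 0 ≤ a) (t : ℝ) :
    ∃ A : ℝ≥0∞, A ≠ ⊤ ∧ ∀ (f : 𝓢'(Rd d, ℂ)) (j : ℕ) (x : Rd d),
      (2 : ℝ≥0∞) ^ ((j : ℝ) * (t * d)) *
        ‖piece (Φ.system j) (Φ.system_hasCompactSupport j) (Φ.system_contDiff j) f x‖ₑ ≤
      ∑' k : Fin d → ℕ, (∏ i, decayFactor t j (k i)) * (A * ((2 : ℝ≥0∞) ^ (((∑ i, k i : ℕ) : ℝ) * t) *
        peetre (maxIndex k) a (fun y => ‖piece (Ψ.system k) (Ψ.system_hasCompactSupport k)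
          (Ψ.system_contDiff k) f y‖ₑ) x)) := by
  obtain ⟨A, hA, h⟩ := exists_enorm_piece_system_mul_le Φ Ψ ha
  refine ⟨A, hA, fun f j x => ?_⟩
  rw [piece_eq_sum _ (Φ.system_hasCompactSupport j) (Φ.system_contDiff j)
    (system_mul_hasCompactSupport Φ Ψ j) (system_mul_contDiff Φ Ψ j) (system_eq_sum Φ Ψ j)]
  refine (mul_le_mul_right (enorm_sum_le _ _) _).trans ?_
  rw [Finset.mul_sum]
  refine le_trans (Finset.sum_le_sum fun k hk => ?_) (ENNReal.sum_le_tsum _)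
  have hk' : ∀ i, k i ≤ j + 1 := fun i => by
    have := Fintype.mem_piFinset.1 hk i
    rw [Finset.mem_range] at this
    omega
  rw [prod_decayFactor_eq t j hk']
  refine (mul_le_mul_right (h f j k (Finset.sup_le fun i _ => hk' i) x) _).trans (le_of_eq ?_)
  set e := ((∑ i, k i : ℕ) : ℝ) * t
  have e1 : (2 : ℝ≥0∞) ^ (-e) * 2 ^ e = 1 := by
    rw [← ENNReal.rpow_add _ _ two_ne_zero ENNReal.ofNat_ne_top, neg_add_cancel, ENNReal.rpow_zero]
  calc _ = (2 : ℝ≥0∞) ^ ((j : ℝ) * (t * d)) * ((2 ^ (-e) * 2 ^ e) * (A * peetre (maxIndex k) a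
        (fun y => ‖piece (Ψ.system k) (Ψ.system_hasCompactSupport k)
          (Ψ.system_contDiff k) f y‖ₑ) x)) := by rw [e1, one_mul]
    _ = _ := by ring

theorem kernelConv_const_mul {d : ℕ} (n : ℕ) (b : ℝ) {c : ℝ≥0∞} (hc : c ≠ ⊤) (g : Rd d → ℝ≥0∞)
    (x : Rd d) : kernelConv n b (fun y => c * g y) x = c * kernelConv n b g x := by
  unfold kernelConv
  rw [← lintegral_const_mul' _ _ hc]
  refine lintegral_congr fun y => ?_
  ring

/-- For negative smoothness the isotropic quasi-norm is dominated by the mixed one. -/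
theorem exists_isoNorm_le_mixedNorm {d : ℕ} (hd : 0 < d) (Φ : IsotropicGenerator d)
    (Ψ : LineGenerator) {p t : ℝ} {q : ℝ≥0∞} (hp : 0 < p) (hq : 0 < q) (ht : t < 0) :
    ∃ C : ℝ≥0∞, C ≠ ⊤ ∧ ∀ f : 𝓢'(Rd d, ℂ), isoNorm Φ (t * d) p q f ≤ C * mixedNorm Ψ t p q f := by
  -- A finite s strictly between 0 and q treats q < ∞ and q = ∞ alike.
  obtain ⟨r, hr0, hrp, hrq, hr1⟩ : ∃ r : ℝ, 0 < r ∧ r < p ∧ ENNReal.ofReal r < q ∧ r ≤ 1 := by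
    obtain ⟨s, hs0, hsq⟩ := exists_between hq
    have hs : s ≠ ⊤ := hsq.ne_top
    have hs' : 0 < s.toReal := ENNReal.toReal_pos hs0.ne' hs
    refine ⟨min (min (p / 2) 1) s.toReal, by positivity, ?_, ?_, ?_⟩
    · exact ((min_le_left _ _).trans (min_le_left _ _)).trans_lt (by linarith)
    · refine lt_of_le_of_lt ?_ hsq
      exact (ENNReal.ofReal_le_ofReal (min_le_right _ _)).trans_eq (ENNReal.ofReal_toReal hs)
    · exact (min_le_left _ _).trans (min_le_right _ _)
  -- Chosen so that a r = d + 1 exceeds d, as integrability of the kernel demands.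
  set a : ℝ := (d + 1) / r with ha
  have ha0 : 0 ≤ a := by positivity
  have har : a * r = d + 1 := div_mul_cancel₀ _ hr0.ne'
  obtain ⟨A, hA, hAf⟩ := exists_two_rpow_mul_enorm_piece_le Φ Ψ ha0 t
  obtain ⟨B, hB, hBf⟩ := exists_peetre_piece_rpow_le (d := d) Ψ ha0 hr0 hr1
  obtain ⟨C, hC, hCf⟩ := exists_lintegral_lq_le_of_rpow_le_kernelConv d (p := p) (r := r)
    (b := a * r) (q := q) (by linarith) hr0 hrp hrq hB
  obtain ⟨D, hD, hDf⟩ := exists_lq_le_of_matrix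
    (fun (j : ℕ) (k : Fin d → ℕ) => ∏ i, decayFactor t j (k i)) (fun e he => by
      simp_rw [← ENNReal.prod_rpow_of_nonneg he.le, decayFactor_rpow _ _ _ he]
      exact exists_decay_matrix_bound hd (mul_neg_of_neg_of_pos ht he)) hq.ne'
  have hDA : D * A ≠ ⊤ := ENNReal.mul_ne_top hD hA
  refine ⟨((D * A) ^ p * C) ^ (1 / p), by finiteness, fun f => ?_⟩
  rw [isoNorm_eq, mixedNorm_eq, ← ENNReal.mul_rpow_of_nonneg _ _ (by positivity)]
  refine ENNReal.rpow_le_rpow ?_ (by positivity)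
  have key := hCf (ι := Fin d → ℕ) maxIndex
    (fun k x => (2 : ℝ≥0∞) ^ (((∑ i, k i : ℕ) : ℝ) * t) *
        peetre (maxIndex k) a (fun y => ‖piece (Ψ.system k) (Ψ.system_hasCompactSupport k)
          (Ψ.system_contDiff k) f y‖ₑ) x)
    (fun k x => (2 : ℝ≥0∞) ^ (((∑ i, k i : ℕ) : ℝ) * t) *
      ‖piece (Ψ.system k) (Ψ.system_hasCompactSupport k) (Ψ.system_contDiff k) f x‖ₑ)
    (fun k => (measurable_enorm_piece _ _ _ f).const_mul _) (fun k x => by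
      simp_rw [ENNReal.mul_rpow_of_nonneg _ _ hr0.le]
      rw [kernelConv_const_mul _ _ (by finiteness), mul_left_comm]
      exact mul_le_mul_right (hBf f k x) _)
  rw [mul_assoc]
  refine le_trans ?_ (mul_le_mul_right key _)
  rw [← lintegral_const_mul' _ _ (by finiteness)]
  refine lintegral_mono fun x => ?_
  rw [← ENNReal.mul_rpow_of_nonneg _ _ hp.le]
  refine ENNReal.rpow_le_rpow ?_ hp.le
  refine (hDf _ _ fun j => hAf f j x).trans ?_
  rw [lq_const_mul hq.ne', mul_assoc]

theorem continuouslyEmbeds_mixedNorm_isoNorm {d : ℕ} (hd : 0 < d) (Φ : IsotropicGenerator d)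
    (Ψ : LineGenerator) {p t : ℝ} {q : ℝ≥0∞} (hp : 0 < p) (hq : 0 < q) (ht : t < 0) :
    ContinuouslyEmbeds (mixedNorm (d := d) Ψ t p q) (isoNorm Φ (t * d) p q) := by
  obtain ⟨C, hC, h⟩ := exists_isoNorm_le_mixedNorm hd Φ Ψ hp hq ht
  refine ⟨fun f hf => (h f).trans_lt (ENNReal.mul_lt_top hC.lt_top hf), C.toNNReal, fun f _ => ?_⟩
  rw [ENNReal.coe_toNNReal hC]
  exact h f

/-! ### Distributions with a prescribed spectral density -/

/-- A left inverse of the Fourier transform on the Schwartz space. -/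
def fourierInvSchwartz (d : ℕ) : 𝓢(Rd d, ℂ) →L[ℂ] 𝓢(Rd d, ℂ) :=
  (((2 * Real.pi) ^ (-(d : ℝ) / 2) : ℝ) : ℂ)⁻¹ •
    (FourierTransform.fourierInvCLM ℂ 𝓢(Rd d, ℂ)).comp
      (SchwartzMap.compCLMOfContinuousLinearEquiv ℂ (dilation d).symm)

theorem fourierInvSchwartz_fourierSchwartz {d : ℕ} (θ : 𝓢(Rd d, ℂ)) :
    fourierInvSchwartz d (fourierSchwartz d θ) = θ := by
  have hc : (((2 * Real.pi) ^ (-(d : ℝ) / 2) : ℝ) : ℂ) ≠ 0 := by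
    exact_mod_cast (Real.rpow_pos_of_pos (by positivity) _).ne'
  have e : SchwartzMap.compCLMOfContinuousLinearEquiv ℂ (dilation d).symm
      (SchwartzMap.compCLMOfContinuousLinearEquiv ℂ (dilation d) (𝓕 θ)) = 𝓕 θ := by
    ext ξ
    simp [SchwartzMap.compCLMOfContinuousLinearEquiv_apply]
  change (((2 * Real.pi) ^ (-(d : ℝ) / 2) : ℝ) : ℂ)⁻¹ •
    FourierTransform.fourierInvCLM ℂ 𝓢(Rd d, ℂ)
      (SchwartzMap.compCLMOfContinuousLinearEquiv ℂ (dilation d).symm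
        ((((2 * Real.pi) ^ (-(d : ℝ) / 2) : ℝ) : ℂ) •
          SchwartzMap.compCLMOfContinuousLinearEquiv ℂ (dilation d) (𝓕 θ))) = θ
  rw [map_smul, map_smul, smul_smul, inv_mul_cancel₀ hc, one_smul, e]
  change 𝓕⁻ (𝓕 θ) = θ
  exact FourierTransform.fourierInv_fourier_eq θ

/-- The inverse Fourier integral `(2π)^(-d/2) ∫ e^(i x·ξ) g(ξ) dξ`. -/
def spectralIntegral {d : ℕ} (g : Rd d → ℂ) (x : Rd d) : ℂ :=
  (((2 * Real.pi) ^ (-(d : ℝ) / 2) : ℝ) : ℂ) *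
    ∫ ξ, Complex.exp (Complex.I * ((inner ℝ x ξ : ℝ) : ℂ)) * g ξ

theorem spectralIntegral_zero {d : ℕ} (x : Rd d) : spectralIntegral (fun _ : Rd d => (0 : ℂ)) x = 0 := by
  simp [spectralIntegral]

theorem spectralIntegral_const_mul {d : ℕ} (c : ℂ) (g : Rd d → ℂ) (x : Rd d) :
    spectralIntegral (fun ξ => c * g ξ) x = c * spectralIntegral g x := by
  unfold spectralIntegral
  simp_rw [mul_left_comm _ c]
  rw [integral_const_mul]
  ring

/-- A nonnegative function of polynomial growth is the Fourier transform of a tempered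
distribution. -/
theorem exists_piece_eq_spectralIntegral {d : ℕ} {G : Rd d → ℝ≥0} (hG : Measurable G) {C : ℝ} {K : ℕ}
    (hGC : ∀ ξ, (G ξ : ℝ) ≤ C * (1 + ‖ξ‖) ^ K) :
    ∃ f : 𝓢'(Rd d, ℂ), ∀ (m : Rd d → ℂ) (hc : HasCompactSupport m) (hs : ContDiff ℝ ∞ m) (x : Rd d),
      piece m hc hs f x = spectralIntegral (fun ξ => m ξ * ((G ξ : ℝ) : ℂ)) x := by
  set μ : Measure (Rd d) := volume.withDensity fun ξ => (G ξ : ℝ≥0∞) with hμ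
  have hμt : μ.HasTemperateGrowth := by
    refine ⟨⟨K + d + 1, ?_⟩⟩
    rw [hμ, integrable_withDensity_iff_integrable_smul hG]
    refine Integrable.mono' (g := fun ξ : Rd d => C * (1 + ‖ξ‖) ^ (-((d + 1 : ℕ) : ℝ))) ?_ ?_ ?_
    · refine Integrable.const_mul (integrable_one_add_norm ?_) C
      simp
    · refine AEStronglyMeasurable.fun_smul hG.aestronglyMeasurable ?_
      exact (Measurable.pow_const (by fun_prop) _).aestronglyMeasurable
    · refine Filter.Eventually.of_forall fun ξ => ?_
      have h1 : 0 < 1 + ‖ξ‖ := by positivity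
      rw [NNReal.smul_def, smul_eq_mul, Real.norm_of_nonneg (by positivity)]
      calc (G ξ : ℝ) * (1 + ‖ξ‖) ^ (-((K + d + 1 : ℕ) : ℝ)) ≤
          C * (1 + ‖ξ‖) ^ K * (1 + ‖ξ‖) ^ (-((K + d + 1 : ℕ) : ℝ)) := by
            gcongr; exact hGC ξ
        _ = _ := by
          rw [mul_assoc, ← Real.rpow_natCast, ← Real.rpow_add h1]
          congr 2; push_cast; ring
  -- The measure G dξ is tempered by the growth bound; composing with the inverse transform makes it
  -- the Fourier transform of f.
  refine ⟨PointwiseConvergenceCLM.precomp ℂ (fourierInvSchwartz d) μ.toTemperedDistribution,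
    fun m hc hs x => ?_⟩
  have e : fourierTempered (PointwiseConvergenceCLM.precomp ℂ (fourierInvSchwartz d)
      μ.toTemperedDistribution) (modulate m hc hs x) = ∫ ξ, modulate m hc hs x ξ ∂μ := by
    change μ.toTemperedDistribution (fourierInvSchwartz d (fourierSchwartz d (modulate m hc hs x))) = _
    rw [fourierInvSchwartz_fourierSchwartz]
    exact Measure.toTemperedDistribution_apply μ _
  rw [piece, e, spectralIntegral, hμ, integral_withDensity_eq_integral_smul hG]
  congr 2
  funext ξ
  change G ξ • (Complex.exp (Complex.I * ((inner ℝ x ξ : ℝ) : ℂ)) * m ξ) = _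
  rw [NNReal.smul_def, Complex.real_smul]
  ring

/-! ### Superposition of blocks -/

/-- Each entry is charged to one of the sequences b m, so the q-th powers add over m. The factor 2^m
makes these powers summable for every q, however small. -/
theorem exists_lq_le_iSup {q : ℝ≥0∞} (hq : q ≠ 0) : ∃ C : ℝ≥0∞, C ≠ ⊤ ∧ ∀ {ι : Type}
    (c : ι → ℝ≥0∞) (b : ℕ → ι → ℝ≥0∞), (∀ α, ∃ m, c α ≤ b m α) →
      lq q c ≤ C * ⨆ m : ℕ, 2 ^ m * lq q (b m) := by
  by_cases hqt : q = ⊤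
  · refine ⟨1, ENNReal.one_ne_top, fun c b h => ?_⟩
    subst hqt
    rw [one_mul, lq_top]
    refine iSup_le fun α => ?_
    obtain ⟨m, hm⟩ := h α
    calc c α ≤ 1 * lq ⊤ (b m) := by rw [one_mul]; exact hm.trans (le_lq hq _ α)
      _ ≤ 2 ^ m * lq ⊤ (b m) := by gcongr; exact one_le_pow₀ (by norm_num)
      _ ≤ _ := le_iSup (fun m : ℕ => 2 ^ m * lq ⊤ (b m)) m
  · have hpos : 0 < q.toReal := ENNReal.toReal_pos hq hqt
    set S : ℝ≥0∞ := ∑' m : ℕ, ((2 : ℝ≥0∞) ^ (-q.toReal)) ^ m with hS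
    have hStop : S ≠ ⊤ := by
      rw [hS, ENNReal.tsum_geometric, ENNReal.inv_ne_top]
      exact (tsub_pos_iff_lt.2 (ENNReal.rpow_lt_one_of_one_lt_of_neg ENNReal.one_lt_two
        (by linarith))).ne'
    refine ⟨S ^ (1 / q.toReal), by finiteness, fun c b h => ?_⟩
    set Z := ⨆ m : ℕ, 2 ^ m * lq q (b m) with hZ
    have hb : ∀ m, ∑' α, b m α ^ q.toReal = lq q (b m) ^ q.toReal := fun m => by
      rw [lq_of_ne_top hqt, ← ENNReal.rpow_mul, one_div_mul_cancel hpos.ne', ENNReal.rpow_one]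
    have hbZ : ∀ m, lq q (b m) ^ q.toReal ≤ ((2 : ℝ≥0∞) ^ (-q.toReal)) ^ m * Z ^ q.toReal := by
      intro m
      have h1 : lq q (b m) ≤ ((2 : ℝ≥0∞) ^ m)⁻¹ * Z := by
        rw [mul_comm, ← div_eq_mul_inv, ENNReal.le_div_iff_mul_le (Or.inl (by positivity))
          (Or.inl (by finiteness)), mul_comm]
        exact le_iSup (fun m : ℕ => 2 ^ m * lq q (b m)) m
      calc lq q (b m) ^ q.toReal ≤ (((2 : ℝ≥0∞) ^ m)⁻¹ * Z) ^ q.toReal := by gcongr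
        _ = _ := by
          rw [ENNReal.mul_rpow_of_nonneg _ _ hpos.le]
          congr 1
          rw [← ENNReal.rpow_natCast, ← ENNReal.rpow_natCast, ← ENNReal.rpow_neg, ← ENNReal.rpow_mul,
            ← ENNReal.rpow_mul]
          congr 1; ring
    have main : ∑' α, c α ^ q.toReal ≤ S * Z ^ q.toReal := by
      calc ∑' α, c α ^ q.toReal ≤ ∑' α, ∑' m, b m α ^ q.toReal := by
            refine ENNReal.tsum_le_tsum fun α => ?_
            obtain ⟨m, hm⟩ := h α
            exact (ENNReal.rpow_le_rpow hm hpos.le).trans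
              (ENNReal.le_tsum (f := fun m => b m α ^ q.toReal) m)
        _ = ∑' m, ∑' α, b m α ^ q.toReal := ENNReal.tsum_comm
        _ ≤ ∑' m, ((2 : ℝ≥0∞) ^ (-q.toReal)) ^ m * Z ^ q.toReal := by
            refine ENNReal.tsum_le_tsum fun m => ?_
            rw [hb]; exact hbZ m
        _ = _ := ENNReal.tsum_mul_right
    rw [lq_of_ne_top hqt]
    calc _ ≤ (S * Z ^ q.toReal) ^ (1 / q.toReal) := by gcongr
      _ = _ := by
        rw [ENNReal.mul_rpow_of_nonneg _ _ (by positivity), ← ENNReal.rpow_mul,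
          mul_one_div_cancel hpos.ne', ENNReal.rpow_one]

theorem measurable_lq {ι X : Type*} [Countable ι] [MeasurableSpace X] {q : ℝ≥0∞}
    {g : ι → X → ℝ≥0∞} (hg : ∀ k, Measurable (g k)) : Measurable fun x => lq q fun k => g k x := by
  by_cases hqt : q = ⊤
  · subst hqt
    simp_rw [lq_top]
    exact .iSup hg
  · simp_rw [lq_of_ne_top hqt]
    exact (Measurable.tsum fun k => (hg k).pow_const _).pow_const _

/-- The weighted `ℓ_q`-sum of the pieces of the distribution with spectral density `G`. -/
def blockNorm {d : ℕ} {ι : Type} (q : ℝ≥0∞) (μ : ι → Rd d → ℂ) (w : ι → ℝ≥0∞) (G : Rd d → ℝ≥0)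
    (x : Rd d) : ℝ≥0∞ :=
  lq q fun α => w α * ‖spectralIntegral (fun ξ => μ α ξ * ((G ξ : ℝ) : ℂ)) x‖ₑ

theorem lintegral_iSup_rpow_le {X : Type*} [MeasurableSpace X] {ν : Measure X} {p : ℝ} (hp : 0 < p)
    {Z : ℕ → X → ℝ≥0∞} (hZ : ∀ m, Measurable (Z m)) :
    ∫⁻ x, (⨆ m, Z m x) ^ p ∂ν ≤ ∑' m, ∫⁻ x, Z m x ^ p ∂ν := by
  rw [← lintegral_tsum fun m => ((hZ m).pow_const p).aemeasurable]
  refine lintegral_mono fun x => ?_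
  rw [← ENNReal.le_rpow_inv_iff hp]
  refine iSup_le fun m => ?_
  rw [ENNReal.le_rpow_inv_iff hp]
  exact ENNReal.le_tsum (f := fun m => Z m x ^ p) m

/-- Let `G M` be spectral densities each member of the two systems sees at most one of. If they are
bounded with respect to the first quasi-norm and large with respect to the second one, then
a lacunary superposition of them separates the two spaces. -/
theorem exists_separating_distribution {d : ℕ} {p : ℝ} {q : ℝ≥0∞} (hp : 0 < p) (hp1 : p < 1)
    (hq : q ≠ 0) {G : ℕ → Rd d → ℝ≥0} (hG : ∀ M, Measurable (G M)) {C : ℝ} {K : ℕ} (hC : 0 ≤ C)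
    (hGC : ∀ M ξ, (G M ξ : ℝ) ≤ C * (1 + ‖ξ‖) ^ K)
    (hdisj : ∀ M M' ξ, G M ξ ≠ 0 → G M' ξ ≠ 0 → M = M')
    {ι κ : Type} [Countable ι] [Countable κ] {μ : ι → Rd d → ℂ} {ν : κ → Rd d → ℂ}
    (hμc : ∀ α, HasCompactSupport (μ α)) (hμs : ∀ α, ContDiff ℝ ∞ (μ α))
    (hνc : ∀ α, HasCompactSupport (ν α)) (hνs : ∀ α, ContDiff ℝ ∞ (ν α))
    (w : ι → ℝ≥0∞) (v : κ → ℝ≥0∞) (ℓ : ι → ℕ) (ℓ' : κ → ℕ)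
    (hℓ : ∀ α M ξ, G M ξ ≠ 0 → μ α ξ ≠ 0 → ℓ α = M)
    (hℓ' : ∀ α M ξ, G M ξ ≠ 0 → ν α ξ ≠ 0 → ℓ' α = M)
    {A a : ℝ≥0∞} (hA : A ≠ ⊤) (ha : a ≠ 0)
    (hX : ∀ M, ∫⁻ x, blockNorm q μ w (G M) x ^ p ≤ A)
    (hY : ∀ M : ℕ, a * M ≤ ∫⁻ x, blockNorm q ν v (G M) x ^ p) :
    ∃ f : 𝓢'(Rd d, ℂ),
      ∫⁻ x, lq q (fun α => w α * ‖piece (μ α) (hμc α) (hμs α) f x‖ₑ) ^ p < ⊤ ∧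
      ∫⁻ x, lq q (fun α => v α * ‖piece (ν α) (hνc α) (hνs α) f x‖ₑ) ^ p = ⊤ := by
  -- At each frequency at most one summand is nonzero. The index 4^m is matched to the coefficient
  -- 4^(-m) so that growth linear in the index wins when p < 1.
  set g : Rd d → ℝ≥0∞ := fun ξ => ∑' m : ℕ, ((4 : ℝ≥0) ^ m)⁻¹ * G (4 ^ m) ξ with hg
  have hinj : Function.Injective fun m : ℕ => 4 ^ m := Nat.pow_right_injective (by norm_num)
  have hg_of : ∀ m ξ, G (4 ^ m) ξ ≠ 0 → g ξ = (((4 : ℝ≥0) ^ m)⁻¹ * G (4 ^ m) ξ : ℝ≥0) := by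
    intro m ξ h
    rw [hg]
    simp only
    rw [tsum_eq_single m]
    · push_cast; rfl
    · intro m' hm'
      have : G (4 ^ m') ξ = 0 := by
        by_contra h'
        exact hm' (hinj (hdisj _ _ ξ h' h))
      rw [this, ENNReal.coe_zero, mul_zero]
  have hg_zero : ∀ ξ, (∀ m, G (4 ^ m) ξ = 0) → g ξ = 0 := by
    intro ξ h
    simp [hg, h]
  have hgm : Measurable g := by
    refine Measurable.tsum fun m => ?_
    exact (hG _).coe_nnreal_ennreal.const_mul _
  obtain ⟨f, hf⟩ := exists_piece_eq_spectralIntegral (G := fun ξ => (g ξ).toNNReal)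
    hgm.ennreal_toNNReal (C := C) (K := K) (fun ξ => by
      by_cases h : ∀ m, G (4 ^ m) ξ = 0
      · rw [hg_zero ξ h]; simp; positivity
      · push Not at h
        obtain ⟨m, hm⟩ := h
        rw [hg_of m ξ hm, ENNReal.toNNReal_coe]
        refine le_trans ?_ (hGC (4 ^ m) ξ)
        rw [NNReal.coe_mul]
        refine mul_le_of_le_one_left (NNReal.coe_nonneg _) ?_
        push_cast
        exact inv_le_one_of_one_le₀ (one_le_pow₀ (by norm_num)))
  -- Such a σ meets no density except possibly the one of index L, so multiplying by it reduces the
  -- superposition to a multiple of a single block, or to zero.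
  have key : ∀ (σ : Rd d → ℂ) (L : ℕ), (∀ M ξ, G M ξ ≠ 0 → σ ξ ≠ 0 → L = M) →
      (∀ m, 4 ^ m = L → ∀ ξ, σ ξ * (((g ξ).toNNReal : ℝ) : ℂ) =
        ((4 : ℂ) ^ m)⁻¹ * (σ ξ * ((G (4 ^ m) ξ : ℝ) : ℂ))) ∧
      ((∀ m, 4 ^ m ≠ L) → ∀ ξ, σ ξ * (((g ξ).toNNReal : ℝ) : ℂ) = 0) ∧
      (∀ m, 4 ^ m ≠ L → ∀ ξ, σ ξ * ((G (4 ^ m) ξ : ℝ) : ℂ) = 0) := by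
    intro σ L hL
    refine ⟨fun m hm ξ => ?_, fun hm ξ => ?_, fun m hm ξ => ?_⟩
    · by_cases hσ : σ ξ = 0
      · simp [hσ]
      by_cases hGm : G (4 ^ m) ξ = 0
      · have : g ξ = 0 := hg_zero ξ fun m' => by
          by_contra h'
          have h1 := hL _ ξ h' hσ
          have h2 : m = m' := hinj (hm.trans h1)
          exact h' (h2 ▸ hGm)
        simp [this, hGm]
      · rw [hg_of m ξ hGm, ENNReal.toNNReal_coe]
        push_cast
        ring
    · by_cases hσ : σ ξ = 0
      · simp [hσ]
      have : g ξ = 0 := hg_zero ξ fun m' => by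
        by_contra h'
        exact hm m' (hL _ ξ h' hσ).symm
      simp [this]
    · by_cases hσ : σ ξ = 0
      · simp [hσ]
      by_cases hGm : G (4 ^ m) ξ = 0
      · simp [hGm]
      · exact absurd (hL _ ξ hGm hσ).symm hm
  have hnorm : ∀ m : ℕ, ‖((4 : ℂ) ^ m)⁻¹‖ₑ = ((4 : ℝ≥0∞) ^ m)⁻¹ := by
    intro m
    rw [enorm_inv (pow_ne_zero m (by norm_num)), enorm_pow]
    congr 2
    rw [← ofReal_norm]
    simp
  refine ⟨f, ?_, ?_⟩
  · obtain ⟨D, hD, hDf⟩ := exists_lq_le_iSup hq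
    have h1 : ∀ x, lq q (fun α => w α * ‖piece (μ α) (hμc α) (hμs α) f x‖ₑ) ≤
        D * ⨆ m : ℕ, 2 ^ m * (((4 : ℝ≥0∞) ^ m)⁻¹ * blockNorm q μ w (G (4 ^ m)) x) := by
      intro x
      have := hDf (fun α => w α * ‖piece (μ α) (hμc α) (hμs α) f x‖ₑ)
        (fun m α => ((4 : ℝ≥0∞) ^ m)⁻¹ *
          (w α * ‖spectralIntegral (fun ξ => μ α ξ * ((G (4 ^ m) ξ : ℝ) : ℂ)) x‖ₑ)) (fun α => ?_)
      · simp_rw [lq_const_mul hq] at this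
        exact this
      · obtain ⟨k1, k2, -⟩ := key (μ α) (ℓ α) (hℓ α)
        by_cases h : ∃ m, 4 ^ m = ℓ α
        · obtain ⟨m, hm⟩ := h
          refine ⟨m, le_of_eq ?_⟩
          simp_rw [hf, k1 m hm, spectralIntegral_const_mul, enorm_mul, hnorm]
          ring
        · push Not at h
          refine ⟨0, ?_⟩
          simp_rw [hf, k2 h, spectralIntegral_zero]
          simp
    have hbm : ∀ m, Measurable fun x => blockNorm q μ w (G (4 ^ m)) x := by
      intro m
      obtain ⟨f', hf'⟩ := exists_piece_eq_spectralIntegral (hG (4 ^ m)) (hGC (4 ^ m))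
      unfold blockNorm
      simp_rw [← hf' _ (hμc _) (hμs _)]
      exact measurable_lq fun α => (measurable_enorm_piece _ _ _ f').const_mul _
    calc _ ≤ ∫⁻ x, D ^ p * (⨆ m : ℕ, 2 ^ m * (((4 : ℝ≥0∞) ^ m)⁻¹ * blockNorm q μ w (G (4 ^ m)) x)) ^ p := by
          refine lintegral_mono fun x => ?_
          rw [← ENNReal.mul_rpow_of_nonneg _ _ hp.le]
          exact ENNReal.rpow_le_rpow (h1 x) hp.le
      _ ≤ D ^ p * ∑' m : ℕ, ∫⁻ x, (2 ^ m * (((4 : ℝ≥0∞) ^ m)⁻¹ * blockNorm q μ w (G (4 ^ m)) x)) ^ p := by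
          rw [lintegral_const_mul' _ _ (by finiteness)]
          gcongr
          exact lintegral_iSup_rpow_le hp fun m => ((hbm m).const_mul _).const_mul _
      -- The loss 2^m against the coefficient 4^(-m) leaves 2^(-m), which is summable in the p-th
      -- power.
      _ ≤ D ^ p * ∑' m : ℕ, ((2 : ℝ≥0∞) ^ (-p)) ^ m * A := by
          gcongr with m
          have e : ∀ x, (2 ^ m * (((4 : ℝ≥0∞) ^ m)⁻¹ * blockNorm q μ w (G (4 ^ m)) x)) ^ p =
              ((2 : ℝ≥0∞) ^ (-p)) ^ m * blockNorm q μ w (G (4 ^ m)) x ^ p := by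
            intro x
            have e4 : (4 : ℝ≥0∞) = 2 ^ 2 := by norm_num
            rw [← mul_assoc, ENNReal.mul_rpow_of_nonneg _ _ hp.le]
            congr 1
            rw [e4, ← pow_mul, ← ENNReal.rpow_natCast, ← ENNReal.rpow_natCast, ← ENNReal.rpow_neg,
              ← ENNReal.rpow_add _ _ two_ne_zero ENNReal.ofNat_ne_top, ← ENNReal.rpow_mul,
              ← ENNReal.rpow_natCast, ← ENNReal.rpow_mul]
            congr 1; push_cast; ring
          simp_rw [e]
          rw [lintegral_const_mul' _ _ (by finiteness)]
          gcongr
          exact hX _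
      _ < ⊤ := by
          rw [ENNReal.tsum_mul_right, ENNReal.tsum_geometric]
          refine ENNReal.mul_lt_top (by finiteness) (ENNReal.mul_lt_top ?_ hA.lt_top)
          rw [ENNReal.inv_lt_top]
          exact tsub_pos_iff_lt.2 (ENNReal.rpow_lt_one_of_one_lt_of_neg ENNReal.one_lt_two
            (by linarith))
  -- The m-th block alone contributes 4^(-mp) · a · 4^m, and this is unbounded because p < 1.
  · have h2 : ∀ m : ℕ, a * ((4 : ℝ≥0∞) ^ (1 - p)) ^ m ≤
        ∫⁻ x, lq q (fun α => v α * ‖piece (ν α) (hνc α) (hνs α) f x‖ₑ) ^ p := by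
      intro m
      have h3 : ∀ x, ((4 : ℝ≥0∞) ^ m)⁻¹ * blockNorm q ν v (G (4 ^ m)) x ≤
          lq q (fun α => v α * ‖piece (ν α) (hνc α) (hνs α) f x‖ₑ) := by
        intro x
        rw [blockNorm, ← lq_const_mul hq]
        refine lq_mono q fun α => ?_
        obtain ⟨k1, -, k3⟩ := key (ν α) (ℓ' α) (hℓ' α)
        by_cases h : 4 ^ m = ℓ' α
        · simp_rw [hf, k1 m h, spectralIntegral_const_mul, enorm_mul, hnorm]
          exact le_of_eq (by ring)
        · simp_rw [k3 m h, spectralIntegral_zero]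
          simp
      calc a * ((4 : ℝ≥0∞) ^ (1 - p)) ^ m = (((4 : ℝ≥0∞) ^ m)⁻¹) ^ p * (a * ((4 ^ m : ℕ) : ℝ≥0∞)) := by
            rw [mul_left_comm]
            congr 1
            push_cast
            rw [← ENNReal.rpow_natCast, ← ENNReal.rpow_natCast, ← ENNReal.rpow_neg, ← ENNReal.rpow_mul,
              ← ENNReal.rpow_mul, ← ENNReal.rpow_add _ _ (by norm_num) ENNReal.ofNat_ne_top]
            congr 1; ring
        _ ≤ (((4 : ℝ≥0∞) ^ m)⁻¹) ^ p * ∫⁻ x, blockNorm q ν v (G (4 ^ m)) x ^ p := by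
            gcongr; exact hY _
        _ = ∫⁻ x, (((4 : ℝ≥0∞) ^ m)⁻¹ * blockNorm q ν v (G (4 ^ m)) x) ^ p := by
            rw [← lintegral_const_mul' _ _ (by finiteness)]
            simp_rw [ENNReal.mul_rpow_of_nonneg _ _ hp.le]
        _ ≤ _ := lintegral_mono fun x => ENNReal.rpow_le_rpow (h3 x) hp.le
    have hone : 1 < (4 : ℝ≥0∞) ^ (1 - p) := ENNReal.one_lt_rpow (by norm_num) (by linarith)
    have h4 := ENNReal.tendsto_pow_atTop_nhds_top_iff.2 hone
    have h5 := ENNReal.Tendsto.const_mul (a := a) h4 (Or.inl ENNReal.top_ne_zero)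
    rw [ENNReal.mul_top ha] at h5
    exact top_le_iff.1 (le_of_tendsto' h5 h2)

/-! ### Tensor products -/

theorem lintegral_fin_prod_eq_prod {n : ℕ} {f : Fin n → ℝ → ℝ≥0∞} (hf : ∀ i, Measurable (f i)) :
    ∫⁻ x : Fin n → ℝ, ∏ i, f i (x i) = ∏ i, ∫⁻ s, f i s := by
  induction n with
  | zero => simp [volume_pi]
  | succ n ih =>
    rw [← ((volume_preserving_piFinSuccAbove (fun _ : Fin (n + 1) => ℝ) 0).symm).lintegral_comp_emb
      (MeasurableEquiv.measurableEmbedding _)]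
    simp only [MeasurableEquiv.piFinSuccAbove_symm_apply, Fin.insertNthEquiv, Fin.prod_univ_succ,
      Fin.insertNth_zero, Equiv.coe_fn_mk, Fin.cons_succ, Fin.zero_succAbove, Fin.cons_zero]
    rw [← ih fun i => hf i.succ]
    exact lintegral_prod_mul (hf 0).aemeasurable
      (Finset.univ.measurable_fun_prod fun (i : Fin n) _ =>
        (hf i.succ).comp (measurable_pi_apply i)).aemeasurable

theorem lintegral_prod_eq_prod {d : ℕ} {f : Fin d → ℝ → ℝ≥0∞} (hf : ∀ i, Measurable (f i)) :
    ∫⁻ x : Rd d, ∏ i, f i (x i) = ∏ i, ∫⁻ s, f i s := by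
  rw [← lintegral_fin_prod_eq_prod hf,
    ← (EuclideanSpace.volume_preserving_symm_measurableEquiv_toLp (Fin d)).lintegral_comp_emb
      (MeasurableEquiv.measurableEmbedding _)]
  rfl

theorem integral_prod_eq_prod {d : ℕ} (f : Fin d → ℝ → ℂ) :
    ∫ x : Rd d, ∏ i, f i (x i) = ∏ i, ∫ s, f i s := by
  rw [← integral_fintype_prod_volume_eq_prod,
    ← (EuclideanSpace.volume_preserving_symm_measurableEquiv_toLp (Fin d)).integral_comp
      (MeasurableEquiv.measurableEmbedding _)]
  rfl

/-- The integral `∫ e^(iys) η(s) ds`. -/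
def lineIntegral (η : ℝ → ℂ) (y : ℝ) : ℂ :=
  ∫ s : ℝ, Complex.exp (Complex.I * ((y * s : ℝ) : ℂ)) * η s

theorem lineIntegral_comp_scale (η : ℝ → ℂ) (n : ℕ) (y : ℝ) :
    lineIntegral (fun s => η ((2 : ℝ) ^ (-(n : ℤ)) * s)) y = 2 ^ n * lineIntegral η (2 ^ n * y) := by
  unfold lineIntegral
  have h := Measure.integral_comp_mul_left
    (fun s => Complex.exp (Complex.I * ((2 ^ n * y * s : ℝ) : ℂ)) * η s) ((2 : ℝ) ^ (-(n : ℤ)))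
  have e : |((2 : ℝ) ^ (-(n : ℤ)))⁻¹| = 2 ^ n := by
    rw [zpow_neg, inv_inv, zpow_natCast, abs_of_pos (by positivity)]
  rw [e, Complex.real_smul] at h
  push_cast at h
  push_cast
  rw [← h]
  refine integral_congr_ae (Filter.Eventually.of_forall fun s => ?_)
  have : (2 : ℂ) ^ n * y * ((2 : ℂ) ^ (-(n : ℤ)) * s) = y * s := by
    rw [zpow_neg, zpow_natCast]
    field_simp
  simp only [this]

theorem spectralIntegral_prod {d : ℕ} (η : Fin d → ℝ → ℂ) (x : Rd d) :
    spectralIntegral (fun ξ => ∏ i, η i (ξ i)) x =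
      (((2 * Real.pi) ^ (-(d : ℝ) / 2) : ℝ) : ℂ) * ∏ i, lineIntegral (η i) (x i) := by
  unfold spectralIntegral lineIntegral
  rw [← integral_prod_eq_prod]
  congr 2
  funext ξ
  rw [Finset.prod_mul_distrib, ← Complex.exp_sum]
  congr 2
  rw [PiLp.inner_apply, ← Finset.mul_sum]
  push_cast
  congr 1
  refine Finset.sum_congr rfl fun i _ => ?_
  simp [mul_comm]

theorem lineIntegral_eq_fourier {η : ℝ → ℂ} (hc : HasCompactSupport η) (hs : ContDiff ℝ ∞ η) (y : ℝ) :
    lineIntegral η y = 𝓕 (hc.toSchwartzMap hs) (-(2 * Real.pi)⁻¹ * y) := by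
  rw [SchwartzMap.fourier_coe, Real.fourier_eq']
  unfold lineIntegral
  refine integral_congr_ae (Filter.Eventually.of_forall fun s => ?_)
  simp only [smul_eq_mul]
  congr 2
  have : (Real.pi : ℂ) ≠ 0 := by exact_mod_cast Real.pi_ne_zero
  simp only [RCLike.inner_apply, conj_trivial]
  push_cast
  field_simp

theorem continuous_lineIntegral {η : ℝ → ℂ} (hc : HasCompactSupport η) (hs : ContDiff ℝ ∞ η) :
    Continuous (lineIntegral η) := by
  have : lineIntegral η = fun y => 𝓕 (hc.toSchwartzMap hs) (-(2 * Real.pi)⁻¹ * y) :=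
    funext (lineIntegral_eq_fourier hc hs)
  rw [this]
  exact (𝓕 (hc.toSchwartzMap hs)).continuous.comp (by fun_prop)

/-- The transform is a Schwartz function; decay of an order L > 1/p makes its p-th power integrable
even for small p. -/
theorem lintegral_enorm_lineIntegral_rpow_lt_top {η : ℝ → ℂ} (hc : HasCompactSupport η)
    (hs : ContDiff ℝ ∞ η) {p : ℝ} (hp : 0 < p) : ∫⁻ y, ‖lineIntegral η y‖ₑ ^ p < ⊤ := by
  set h := 𝓕 (hc.toSchwartzMap hs) with hh
  obtain ⟨L, hL⟩ := exists_nat_gt (1 / p)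
  obtain ⟨C, hC⟩ : ∃ C : ℝ, ∀ y, (1 + ‖y‖) ^ L * ‖h y‖ ≤ C := by
    have := SchwartzMap.one_add_le_sup_seminorm_apply (𝕜 := ℝ) (m := (L, 0)) le_rfl le_rfl h
    simp_rw [norm_iteratedFDeriv_zero] at this
    exact ⟨_, this⟩
  have hC0 : 0 ≤ C := le_trans (by positivity) (hC 0)
  have hInt : Integrable fun y => ‖h y‖ ^ p := by
    refine Integrable.mono' (g := fun y : ℝ => C ^ p * (1 + ‖y‖) ^ (-(L * p : ℝ))) ?_ ?_ ?_
    · refine Integrable.const_mul (integrable_one_add_norm ?_) _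
      rw [div_lt_iff₀ hp] at hL
      simpa using hL
    · exact (h.continuous.norm.rpow_const fun _ => Or.inr hp.le).aestronglyMeasurable
    · refine Filter.Eventually.of_forall fun y => ?_
      have h1 : 0 < 1 + ‖y‖ := by positivity
      rw [Real.norm_of_nonneg (by positivity)]
      have h2 : ‖h y‖ ≤ C * (1 + ‖y‖) ^ (-(L : ℝ)) := by
        rw [Real.rpow_neg h1.le, Real.rpow_natCast, ← div_eq_mul_inv, le_div_iff₀ (by positivity),
          mul_comm]
        exact hC y
      calc ‖h y‖ ^ p ≤ (C * (1 + ‖y‖) ^ (-(L : ℝ))) ^ p := by gcongr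
        _ = _ := by
          rw [Real.mul_rpow hC0 (by positivity), ← Real.rpow_mul h1.le, neg_mul]
  have hIntScaled := hInt.comp_mul_left' (R := -(2 * Real.pi)⁻¹) (by
    rw [neg_ne_zero]; positivity)
  refine lt_of_le_of_lt (lintegral_mono fun y => ?_) hIntScaled.hasFiniteIntegral
  rw [lineIntegral_eq_fourier hc hs, ← hh, Real.enorm_of_nonneg (by positivity),
    ← ENNReal.ofReal_rpow_of_nonneg (norm_nonneg _) hp.le, ofReal_norm]

/-- By continuity vanishing almost everywhere is vanishing everywhere, and the Fourier transform is
injective. -/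
theorem not_ae_lineIntegral_eq_zero {η : ℝ → ℂ} (hc : HasCompactSupport η) (hs : ContDiff ℝ ∞ η)
    {s₀ : ℝ} (h : η s₀ ≠ 0) : ¬ ∀ᵐ y, lineIntegral η y = 0 := by
  intro h0
  have h1 : lineIntegral η = fun _ => 0 :=
    (Continuous.ae_eq_iff_eq volume (continuous_lineIntegral hc hs) continuous_const).1 h0
  have h2 : 𝓕 (hc.toSchwartzMap hs) = 0 := by
    ext w
    have h3 := congrFun h1 (-(2 * Real.pi) * w)
    rw [lineIntegral_eq_fourier hc hs] at h3
    have : -(2 * Real.pi)⁻¹ * (-(2 * Real.pi) * w) = w := by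
      field_simp
    rw [this] at h3
    exact h3
  have h3 : hc.toSchwartzMap hs = 0 := by
    have h4 : 𝓕⁻ (𝓕 (hc.toSchwartzMap hs)) = hc.toSchwartzMap hs :=
      FourierTransform.fourierInv_fourier_eq _
    rw [h2] at h4
    rw [← h4]
    exact map_zero (FourierTransform.fourierInvCLM ℂ 𝓢(ℝ, ℂ))
  exact h (congrArg (fun g : 𝓢(ℝ, ℂ) => g s₀) h3)

theorem lintegral_comp_two_pow_mul (n : ℕ) {f : ℝ → ℝ≥0∞} (hf : Measurable f) :
    ∫⁻ s, f (2 ^ n * s) = ((2 : ℝ≥0∞) ^ n)⁻¹ * ∫⁻ s, f s := by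
  have h := Measure.map_addHaar_smul (volume : Measure ℝ) (r := (2 : ℝ) ^ n) (by positivity)
  have h2 : ∫⁻ y, f ((2 : ℝ) ^ n • y) = ∫⁻ y, f y ∂(Measure.map (fun x => (2 : ℝ) ^ n • x) volume) :=
    (lintegral_map hf (by fun_prop)).symm
  simp_rw [smul_eq_mul] at h2
  simp_rw [smul_eq_mul] at h
  rw [h2, h, lintegral_smul_measure, smul_eq_mul, Module.finrank_self, pow_one,
    abs_of_nonneg (by positivity), ENNReal.ofReal_inv_of_pos (by positivity),
    ENNReal.ofReal_pow (by norm_num), ENNReal.ofReal_ofNat]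

/-- The `L_p`-integral of a scaled tensor product over a scaled box. -/
theorem setLIntegral_spectralIntegral_prod {d : ℕ} {η : Fin d → ℝ → ℂ}
    (hc : ∀ i, HasCompactSupport (η i)) (hs : ∀ i, ContDiff ℝ ∞ (η i)) (n : Fin d → ℕ)
    {S : Fin d → Set ℝ} (hS : ∀ i, MeasurableSet (S i)) {p : ℝ} (hp : 0 < p) :
    ∫⁻ x in {x : Rd d | ∀ i, 2 ^ n i * x i ∈ S i},
      ‖spectralIntegral (fun ξ : Rd d => ∏ i, η i ((2 : ℝ) ^ (-(n i : ℤ)) * ξ i)) x‖ₑ ^ p =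
    ENNReal.ofReal ((2 * Real.pi) ^ (-(d : ℝ) / 2)) ^ p *
      ((2 : ℝ≥0∞) ^ (((∑ i, n i : ℕ) : ℝ) * (p - 1)) *
        ∏ i, ∫⁻ y in S i, ‖lineIntegral (η i) y‖ₑ ^ p) := by
  have hmeas : ∀ i, Measurable fun y => ‖lineIntegral (η i) y‖ₑ ^ p := fun i =>
    (continuous_lineIntegral (hc i) (hs i)).measurable.enorm.pow_const _
  have hbox : MeasurableSet {x : Rd d | ∀ i, 2 ^ n i * x i ∈ S i} := by
    rw [Set.ofPred_forall]
    exact MeasurableSet.iInter fun i =>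
      (hS i).preimage (f := fun x : Rd d => 2 ^ n i * x i) (by fun_prop)
  rw [← lintegral_indicator hbox]
  have e : ∀ x : Rd d, {x : Rd d | ∀ i, 2 ^ n i * x i ∈ S i}.indicator (fun x =>
      ‖spectralIntegral (fun ξ : Rd d => ∏ i, η i ((2 : ℝ) ^ (-(n i : ℤ)) * ξ i)) x‖ₑ ^ p) x =
      ENNReal.ofReal ((2 * Real.pi) ^ (-(d : ℝ) / 2)) ^ p * ∏ i, ((2 : ℝ≥0∞) ^ ((n i : ℝ) * p) *
        (S i).indicator (fun y => ‖lineIntegral (η i) y‖ₑ ^ p) (2 ^ n i * x i)) := by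
    intro x
    by_cases hx : ∀ i, 2 ^ n i * x i ∈ S i
    · rw [Set.indicator_of_mem (show x ∈ {x : Rd d | ∀ i, 2 ^ n i * x i ∈ S i} from hx)]
      simp_rw [fun i => Set.indicator_of_mem (hx i) (fun y => ‖lineIntegral (η i) y‖ₑ ^ p)]
      rw [spectralIntegral_prod (fun i s => η i ((2 : ℝ) ^ (-(n i : ℤ)) * s))]
      simp_rw [lineIntegral_comp_scale]
      rw [enorm_mul, ENNReal.mul_rpow_of_nonneg _ _ hp.le]
      congr 1
      · rw [← ofReal_norm, Complex.norm_real, Real.norm_of_nonneg (by positivity)]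
      · rw [← ofReal_norm, norm_prod, ENNReal.ofReal_prod_of_nonneg fun _ _ => norm_nonneg _,
          ← ENNReal.prod_rpow_of_nonneg hp.le]
        refine Finset.prod_congr rfl fun i _ => ?_
        rw [ofReal_norm, enorm_mul, ENNReal.mul_rpow_of_nonneg _ _ hp.le, enorm_pow]
        congr 1
        have : ‖(2 : ℂ)‖ₑ = 2 := by rw [← ofReal_norm]; simp
        rw [this, ← ENNReal.rpow_natCast, ← ENNReal.rpow_mul]
    · rw [Set.indicator_of_notMem (show x ∉ {x : Rd d | ∀ i, 2 ^ n i * x i ∈ S i} from hx)]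
      push Not at hx
      obtain ⟨i, hi⟩ := hx
      rw [Finset.prod_eq_zero (Finset.mem_univ i), mul_zero]
      rw [Set.indicator_of_notMem hi, mul_zero]
  simp_rw [e]
  have hmi : ∀ i, Measurable ((S i).indicator fun y => ‖lineIntegral (η i) y‖ₑ ^ p) := fun i =>
    (hmeas i).indicator (hS i)
  rw [lintegral_const_mul' _ _ (by finiteness), lintegral_prod_eq_prod (f := fun i s =>
    (2 : ℝ≥0∞) ^ ((n i : ℝ) * p) * (S i).indicator (fun y => ‖lineIntegral (η i) y‖ₑ ^ p) (2 ^ n i * s))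
    (fun i => ((hmi i).comp (measurable_const_mul _)).const_mul _)]
  congr 1
  -- Dilating the frequency by 2^n multiplies the transform by 2^n and compresses it by 2^(-n); the
  -- p-th power therefore gains 2^(n(p-1)).
  have e2 : ∀ i, ∫⁻ s, (2 : ℝ≥0∞) ^ ((n i : ℝ) * p) *
      (S i).indicator (fun y => ‖lineIntegral (η i) y‖ₑ ^ p) (2 ^ n i * s) =
      (2 : ℝ≥0∞) ^ ((n i : ℝ) * (p - 1)) * ∫⁻ y in S i, ‖lineIntegral (η i) y‖ₑ ^ p := by
    intro i
    rw [lintegral_const_mul' _ _ (by finiteness), lintegral_comp_two_pow_mul _ (hmi i),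
      lintegral_indicator (hS i), ← mul_assoc]
    congr 1
    rw [← ENNReal.rpow_natCast, ← ENNReal.rpow_neg, ← ENNReal.rpow_add _ _ two_ne_zero
      ENNReal.ofNat_ne_top]
    congr 1; ring
  simp_rw [e2]
  rw [Finset.prod_mul_distrib, Nat.cast_sum, Finset.sum_mul]
  congr 1
  exact prod_two_rpow _ _

/-! ### Frequency blocks -/

section Shell

variable {V : Type*} [NormedAddCommGroup V] [NormedSpace ℝ V] {φ₀ : V → ℂ}

theorem norm_zpow_smul (n : ℤ) (x : V) : ‖(2 : ℝ) ^ n • x‖ = (2 : ℝ) ^ n * ‖x‖ := by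
  rw [norm_smul, Real.norm_of_nonneg (by positivity)]

/-- In the shell between (3/4) 2^j and 2^j the first term of φ_j is one and the second vanishes. All
other members vanish there for every admissible generator, so blocks placed in such shells are
treated identically by all of them. -/
theorem dyadic_eq_one_of_shell (h1 : ∀ x, ‖x‖ ≤ 1 → φ₀ x = 1) (h0 : ∀ x, 3 / 2 < ‖x‖ → φ₀ x = 0)
    {j : ℕ} (hj : j ≠ 0) {x : V} (hx : 3 / 4 * 2 ^ j < ‖x‖) (hx' : ‖x‖ ≤ 2 ^ j) :
    dyadic φ₀ j x = 1 := by
  have hpos : (0 : ℝ) < 2 ^ j := by positivity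
  rw [dyadic, if_neg hj, h1, h0, sub_zero]
  · rw [norm_zpow_smul, zpow_add₀ two_ne_zero, zpow_neg, zpow_natCast, zpow_one, mul_assoc,
      inv_mul_eq_div, lt_div_iff₀ hpos]
    linarith
  · rw [norm_zpow_smul, zpow_neg, zpow_natCast, inv_mul_eq_div, div_le_one hpos]
    exact hx'

theorem dyadic_eq_zero_of_norm_le (h1 : ∀ x, ‖x‖ ≤ 1 → φ₀ x = 1) {j k : ℕ} (hk : j < k) {x : V}
    (hx' : ‖x‖ ≤ 2 ^ j) : dyadic φ₀ k x = 0 := by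
  have hpos : (0 : ℝ) < 2 ^ k := by positivity
  have hle : (2 : ℝ) * 2 ^ j ≤ 2 ^ k := by
    rw [← pow_succ']
    exact pow_le_pow_right₀ (by norm_num) hk
  rw [dyadic, if_neg (by omega), h1, h1, sub_self]
  · rw [norm_zpow_smul, zpow_add₀ two_ne_zero, zpow_neg, zpow_natCast, zpow_one, mul_assoc,
      inv_mul_eq_div, div_le_one hpos]
    linarith
  · rw [norm_zpow_smul, zpow_neg, zpow_natCast, inv_mul_eq_div, div_le_one hpos]
    linarith [norm_nonneg x]

theorem dyadic_eq_zero_of_shell (h1 : ∀ x, ‖x‖ ≤ 1 → φ₀ x = 1) (h0 : ∀ x, 3 / 2 < ‖x‖ → φ₀ x = 0)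
    {j k : ℕ} (hk : k ≠ j) {x : V} (hx : 3 / 4 * 2 ^ j < ‖x‖) (hx' : ‖x‖ ≤ 2 ^ j) :
    dyadic φ₀ k x = 0 := by
  rcases lt_or_gt_of_ne hk with hlt | hgt
  · have hpos : (0 : ℝ) < 2 ^ k := by positivity
    have hle : (2 : ℝ) * 2 ^ k ≤ 2 ^ j := by
      rw [← pow_succ']
      exact pow_le_pow_right₀ (by norm_num) hlt
    rcases Nat.eq_zero_or_pos k with rfl | hkpos
    · rw [dyadic, if_pos rfl, h0]
      norm_num at hle
      linarith
    · rw [dyadic, if_neg hkpos.ne', h0, h0, sub_zero]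
      · rw [norm_zpow_smul, zpow_add₀ two_ne_zero, zpow_neg, zpow_natCast, zpow_one, mul_assoc,
          inv_mul_eq_div, lt_div_iff₀ hpos]
        linarith [norm_nonneg x]
      · rw [norm_zpow_smul, zpow_neg, zpow_natCast, inv_mul_eq_div, lt_div_iff₀ hpos]
        linarith
  · exact dyadic_eq_zero_of_norm_le h1 hgt hx'

end Shell

theorem LineGenerator.eq_one_of_norm_le (Ψ : LineGenerator) (s : ℝ) (hs : ‖s‖ ≤ 1) : Ψ.φ₀ s = 1 :=
  Ψ.eq_one s (abs_le.1 hs)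

theorem LineGenerator.eq_zero_of_lt_norm (Ψ : LineGenerator) (s : ℝ) (hs : 3 / 2 < ‖s‖) :
    Ψ.φ₀ s = 0 := Ψ.eq_zero hs

theorem IsotropicGenerator.coe_eq_one {d : ℕ} (Φ : IsotropicGenerator d) (x : Rd d) (hx : ‖x‖ ≤ 1) :
    ((Φ.φ₀ x : ℝ) : ℂ) = 1 := by rw [Φ.eq_one x hx, Complex.ofReal_one]

theorem IsotropicGenerator.coe_eq_zero {d : ℕ} (Φ : IsotropicGenerator d) (x : Rd d)
    (hx : 3 / 2 < ‖x‖) : ((Φ.φ₀ x : ℝ) : ℂ) = 0 := by rw [Φ.eq_zero x hx.le, Complex.ofReal_zero]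

/-- A bump function on the line, as a function with values in `ℝ≥0`. -/
def lineBump {c : ℝ} (β : ContDiffBump c) (s : ℝ) : ℝ≥0 := (β s).toNNReal

section lineBump

variable {c : ℝ} (β : ContDiffBump c)

theorem coe_lineBump (s : ℝ) : (lineBump β s : ℝ) = β s := Real.coe_toNNReal _ β.nonneg

theorem measurable_lineBump : Measurable (lineBump β) :=
  (β.contDiff (n := 0)).continuous.measurable.real_toNNReal

theorem lineBump_le_one (s : ℝ) : lineBump β s ≤ 1 := by
  rw [← NNReal.coe_le_coe, coe_lineBump]
  exact β.le_one

theorem abs_sub_lt_of_lineBump_ne_zero {s : ℝ} (h : lineBump β s ≠ 0) : |s - c| < β.rOut := by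
  by_contra hlt
  refine h ?_
  rw [← NNReal.coe_eq_zero, coe_lineBump]
  exact β.zero_of_le_dist (not_lt.1 hlt)

theorem lineBump_eq_one {s : ℝ} (h : |s - c| ≤ β.rIn) : lineBump β s = 1 := by
  rw [← NNReal.coe_inj, coe_lineBump]
  exact β.one_of_mem_closedBall h

theorem hasCompactSupport_lineBump : HasCompactSupport fun s => ((lineBump β s : ℝ) : ℂ) := by
  simp_rw [coe_lineBump]
  exact β.hasCompactSupport.comp_left (g := fun r : ℝ => (r : ℂ)) Complex.ofReal_zero

theorem contDiff_lineBump : ContDiff ℝ ∞ fun s => ((lineBump β s : ℝ) : ℂ) := by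
  simp_rw [coe_lineBump]
  exact Complex.ofRealCLM.contDiff.comp β.contDiff

end lineBump

/-- A bump function supported in `[13/16, 15/16]`. -/
def topBump : ℝ → ℝ≥0 :=
  lineBump (⟨1 / 32, 1 / 16, by norm_num, by norm_num⟩ : ContDiffBump (7 / 8 : ℝ))

/-- A bump function supported in `[-1, 1]` and equal to one on `[-1/2, 1/2]`. -/
def lowBump : ℝ → ℝ≥0 :=
  lineBump (⟨1 / 2, 1, by norm_num, by norm_num⟩ : ContDiffBump (0 : ℝ))

theorem mem_of_topBump_ne_zero {s : ℝ} (h : topBump s ≠ 0) : 13 / 16 < s ∧ s < 15 / 16 := by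
  have := abs_lt.1 (abs_sub_lt_of_lineBump_ne_zero _ h)
  simp only at this
  constructor <;> linarith [this.1, this.2]

theorem abs_lt_one_of_topBump_ne_zero {s : ℝ} (h : topBump s ≠ 0) : |s| < 1 := by
  obtain ⟨h1, h2⟩ := mem_of_topBump_ne_zero h
  rw [abs_lt]
  constructor <;> linarith

theorem abs_lt_one_of_lowBump_ne_zero {s : ℝ} (h : lowBump s ≠ 0) : |s| < 1 := by
  have := abs_sub_lt_of_lineBump_ne_zero _ h
  rwa [sub_zero] at this

theorem lowBump_eq_one {s : ℝ} (h : |s| ≤ 1 / 2) : lowBump s = 1 :=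
  lineBump_eq_one _ (by rwa [sub_zero])

theorem topBump_eq_one : topBump (7 / 8) = 1 :=
  lineBump_eq_one _ (by rw [sub_self, abs_zero]; positivity)

/-- The function `A ∏ b_i(2^(-n_i) ξ_i)`. -/
def tensorDensity {d : ℕ} (A : ℝ≥0) (b : Fin d → ℝ → ℝ≥0) (n : Fin d → ℕ) (ξ : Rd d) : ℝ≥0 :=
  A * ∏ i, b i ((2 : ℝ) ^ (-(n i : ℤ)) * ξ i)

/-- The dilated tensor products of bump functions whose factor in the direction `i₀` dominates. -/
structure IsBlockFamily {d : ℕ} (i₀ : Fin d) (c : ℕ) (b : Fin d → ℝ → ℝ≥0) (n : ℕ → Fin d → ℕ) :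
    Prop where
  pos : c ≠ 0
  top : b i₀ = topBump
  measurable : ∀ i, Measurable (b i)
  le_one : ∀ i s, b i s ≤ 1
  small : ∀ i s, b i s ≠ 0 → |s| < 1
  scale : ∀ M, n M i₀ = M + c
  size : ∀ M i, i ≠ i₀ → 16 * d * 2 ^ n M i ≤ 2 ^ (M + c)

/-- The `M`-th block. -/
def block {d : ℕ} (i₀ : Fin d) (σ : ℝ) (b : Fin d → ℝ → ℝ≥0) (n : ℕ → Fin d → ℕ) (M : ℕ) :
    Rd d → ℝ≥0 :=
  tensorDensity ((2 : ℝ≥0) ^ ((n M i₀ : ℝ) * σ)) b (n M)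

namespace IsBlockFamily

variable {d : ℕ} {i₀ : Fin d} {c : ℕ} {b : Fin d → ℝ → ℝ≥0} {n : ℕ → Fin d → ℕ} {σ : ℝ}

theorem measurable_block (h : IsBlockFamily i₀ c b n) (M : ℕ) : Measurable (block i₀ σ b n M) := by
  refine Measurable.const_mul (Finset.univ.measurable_fun_prod fun i _ => ?_) _
  exact (h.measurable i).comp (by fun_prop)

theorem ne_zero (M : ℕ) {ξ : Rd d} (hξ : block i₀ σ b n M ξ ≠ 0) (i : Fin d) :
    b i ((2 : ℝ) ^ (-(n M i : ℤ)) * ξ i) ≠ 0 := by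
  intro h
  exact hξ (by rw [block, tensorDensity, Finset.prod_eq_zero (Finset.mem_univ i) h, mul_zero])

theorem abs_lt (h : IsBlockFamily i₀ c b n) {M : ℕ} {ξ : Rd d} (hξ : block i₀ σ b n M ξ ≠ 0)
    (i : Fin d) : |ξ i| < 2 ^ n M i := by
  have := h.small i _ (ne_zero M hξ i)
  rwa [abs_mul, abs_of_pos (by positivity), zpow_neg, zpow_natCast, inv_mul_eq_div,
    div_lt_one (by positivity)] at this

theorem coordinate_mem (h : IsBlockFamily i₀ c b n) {M : ℕ} {ξ : Rd d}
    (hξ : block i₀ σ b n M ξ ≠ 0) : 13 / 16 * 2 ^ (M + c) < ξ i₀ ∧ ξ i₀ < 15 / 16 * 2 ^ (M + c) := by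
  have h1 := ne_zero M hξ i₀
  rw [h.top] at h1
  have h2 := mem_of_topBump_ne_zero h1
  rwa [h.scale, zpow_neg, zpow_natCast, inv_mul_eq_div, lt_div_iff₀ (by positivity),
    div_lt_iff₀ (by positivity)] at h2

theorem coordinate_shell (h : IsBlockFamily i₀ c b n) {M : ℕ} {ξ : Rd d}
    (hξ : block i₀ σ b n M ξ ≠ 0) : 3 / 4 * 2 ^ (M + c) < ‖ξ i₀‖ ∧ ‖ξ i₀‖ ≤ 2 ^ (M + c) := by
  obtain ⟨h1, h2⟩ := h.coordinate_mem hξ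
  have hpos : (0 : ℝ) < 2 ^ (M + c) := by positivity
  rw [Real.norm_of_nonneg (by linarith)]
  constructor <;> linarith

/-- The distinguished coordinate lies between 13/16 and 15/16 of 2^(M+c). The others are each below
2^(M+c)/(16d) and fill at most the remaining 1/16. -/
theorem norm_shell (h : IsBlockFamily i₀ c b n) {M : ℕ} {ξ : Rd d}
    (hξ : block i₀ σ b n M ξ ≠ 0) : 3 / 4 * 2 ^ (M + c) < ‖ξ‖ ∧ ‖ξ‖ ≤ 2 ^ (M + c) := by
  obtain ⟨h1, h2⟩ := h.coordinate_mem hξ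
  have hpos : (0 : ℝ) < 2 ^ (M + c) := by positivity
  refine ⟨(h.coordinate_shell hξ).1.trans_le (PiLp.norm_apply_le ξ i₀), ?_⟩
  have hd : 0 < d := i₀.pos
  have hd' : (0 : ℝ) < d := by exact_mod_cast hd
  have h3 : ‖ξ‖ ≤ ∑ i, |ξ i| := norm_le_sum_abs ξ
  rw [← Finset.add_sum_erase _ _ (Finset.mem_univ i₀)] at h3
  have h4 : ∑ i ∈ Finset.univ.erase i₀, |ξ i| ≤
      ∑ i ∈ Finset.univ.erase i₀, (2 : ℝ) ^ (M + c) / (16 * d) := by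
    refine Finset.sum_le_sum fun i hi => (h.abs_lt hξ i).le.trans ?_
    rw [le_div_iff₀ (by positivity), mul_comm]
    exact_mod_cast h.size M i (Finset.ne_of_mem_erase hi)
  have h5 : ∑ i ∈ Finset.univ.erase i₀, (2 : ℝ) ^ (M + c) / (16 * d) ≤ 2 ^ (M + c) / 16 := by
    rw [Finset.sum_const, nsmul_eq_mul]
    calc ((Finset.univ.erase i₀).card : ℝ) * (2 ^ (M + c) / (16 * d)) ≤ d * (2 ^ (M + c) / (16 * d)) := by
          gcongr
          exact (Finset.card_erase_le).trans (by simp)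
      _ = _ := by field_simp
  rw [abs_of_pos (by linarith)] at h3
  linarith

theorem disjoint (h : IsBlockFamily i₀ c b n) (M M' : ℕ) (ξ : Rd d)
    (hξ : block i₀ σ b n M ξ ≠ 0) (hξ' : block i₀ σ b n M' ξ ≠ 0) : M = M' := by
  have key : ∀ {M M' : ℕ}, block i₀ σ b n M ξ ≠ 0 → block i₀ σ b n M' ξ ≠ 0 → M ≤ M' := by
    intro M M' h1 h2
    by_contra hlt
    have h3 := (h.norm_shell h1).1
    have h4 := (h.norm_shell h2).2
    have h5 : (2 : ℝ) * 2 ^ (M' + c) ≤ 2 ^ (M + c) := by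
      rw [← pow_succ']
      exact pow_le_pow_right₀ (by norm_num) (by omega)
    have hpos : (0 : ℝ) < 2 ^ (M' + c) := by positivity
    linarith
  exact le_antisymm (key hξ hξ') (key hξ' hξ)

/-- On the support the frequency is comparable to 2^(M+c), so the amplitude 2^((M+c)σ) is at most
polynomial in it, uniformly in M. -/
theorem exists_growth (h : IsBlockFamily i₀ c b n) (σ : ℝ) : ∃ (C : ℝ) (K : ℕ), 0 ≤ C ∧
    ∀ M ξ, (block i₀ σ b n M ξ : ℝ) ≤ C * (1 + ‖ξ‖) ^ K := by
  obtain ⟨K, hK⟩ := exists_nat_ge σ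
  refine ⟨2 ^ K, K, by positivity, fun M ξ => ?_⟩
  by_cases hξ : block i₀ σ b n M ξ = 0
  · rw [hξ, NNReal.coe_zero]; positivity
  have h1 := (h.norm_shell hξ).1
  have h2 : (block i₀ σ b n M ξ : ℝ) ≤ 2 ^ (((M + c : ℕ) : ℝ) * σ) := by
    have : block i₀ σ b n M ξ ≤ (2 : ℝ≥0) ^ (((M + c : ℕ) : ℝ) * σ) := by
      rw [block, tensorDensity, h.scale]
      exact mul_le_of_le_one_right (by positivity) (Finset.prod_le_one' fun i _ => h.le_one i _)
    exact_mod_cast this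
  calc _ ≤ _ := h2
    _ ≤ (2 : ℝ) ^ (((M + c : ℕ) : ℝ) * K) := by
        gcongr
        norm_num
    _ = (2 ^ (M + c)) ^ K := by
        rw [Real.rpow_mul (by norm_num), Real.rpow_natCast, Real.rpow_natCast]
    _ ≤ (2 * (1 + ‖ξ‖)) ^ K := by
        gcongr
        linarith [norm_nonneg ξ]
    _ = _ := mul_pow _ _ _

theorem isotropic_level (h : IsBlockFamily i₀ c b n) (Φ : IsotropicGenerator d) (j M : ℕ) (ξ : Rd d)
    (hξ : block i₀ σ b n M ξ ≠ 0) (hj : Φ.system j ξ ≠ 0) : j = M + c := by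
  by_contra hne
  exact hj (dyadic_eq_zero_of_shell Φ.coe_eq_one Φ.coe_eq_zero hne (h.norm_shell hξ).1
    (h.norm_shell hξ).2)

theorem isotropic_eq_one (h : IsBlockFamily i₀ c b n) (Φ : IsotropicGenerator d) (M : ℕ) (ξ : Rd d)
    (hξ : block i₀ σ b n M ξ ≠ 0) : Φ.system (M + c) ξ = 1 :=
  dyadic_eq_one_of_shell Φ.coe_eq_one Φ.coe_eq_zero (by have := h.pos; omega) (h.norm_shell hξ).1
    (h.norm_shell hξ).2

theorem mixed_level (h : IsBlockFamily i₀ c b n) (Ψ : LineGenerator) (k : Fin d → ℕ) (M : ℕ)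
    (ξ : Rd d) (hξ : block i₀ σ b n M ξ ≠ 0) (hk : Ψ.system k ξ ≠ 0) : k i₀ = M + c := by
  by_contra hne
  exact hk (Finset.prod_eq_zero (Finset.mem_univ i₀) (dyadic_eq_zero_of_shell Ψ.eq_one_of_norm_le
    Ψ.eq_zero_of_lt_norm hne (h.coordinate_shell hξ).1 (h.coordinate_shell hξ).2))

end IsBlockFamily

theorem lq_eq_single {ι : Type*} {q : ℝ≥0∞} (hq : q ≠ 0) {a : ι → ℝ≥0∞} (k₀ : ι)
    (h : ∀ k, k ≠ k₀ → a k = 0) : lq q a = a k₀ := by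
  refine le_antisymm ?_ (le_lq hq a k₀)
  by_cases hqt : q = ⊤
  · subst hqt
    rw [lq_top]
    refine iSup_le fun k => ?_
    by_cases hk : k = k₀
    · rw [hk]
    · rw [h k hk]; exact zero_le
  · have hpos : 0 < q.toReal := ENNReal.toReal_pos hq hqt
    rw [lq_of_ne_top hqt, tsum_eq_single k₀ fun k hk => by rw [h k hk, ENNReal.zero_rpow_of_pos hpos],
      ← ENNReal.rpow_mul, mul_one_div_cancel hpos.ne', ENNReal.rpow_one]

/-- A block that is seen by a single member of the system. -/
theorem blockNorm_eq_single {d : ℕ} {ι : Type} {q : ℝ≥0∞} (hq : q ≠ 0) {μ : ι → Rd d → ℂ}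
    {w : ι → ℝ≥0∞} {G : Rd d → ℝ≥0} (α₀ : ι) (h : ∀ α ξ, G ξ ≠ 0 → μ α ξ ≠ 0 → α = α₀)
    (h₀ : ∀ ξ, G ξ ≠ 0 → μ α₀ ξ = 1) (x : Rd d) :
    blockNorm q μ w G x = w α₀ * ‖spectralIntegral (fun ξ => ((G ξ : ℝ) : ℂ)) x‖ₑ := by
  rw [blockNorm, lq_eq_single hq α₀]
  · have : (fun ξ => μ α₀ ξ * ((G ξ : ℝ) : ℂ)) = fun ξ => ((G ξ : ℝ) : ℂ) := by
      funext ξ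
      by_cases hG : G ξ = 0
      · simp [hG]
      · rw [h₀ ξ hG, one_mul]
    rw [this]
  · intro α hα
    have : (fun ξ => μ α ξ * ((G ξ : ℝ) : ℂ)) = fun _ => 0 := by
      funext ξ
      by_cases hG : G ξ = 0
      · simp [hG]
      by_cases hm : μ α ξ = 0
      · simp [hm]
      · exact absurd (h α ξ hG hm) hα
    rw [this, spectralIntegral_zero, enorm_zero, mul_zero]

/-! ### The spaces are not comparable -/

theorem lintegral_enorm_lineIntegral_rpow_ne_zero {η : ℝ → ℂ} (hc : HasCompactSupport η)
    (hs : ContDiff ℝ ∞ η) {s₀ : ℝ} (h : η s₀ ≠ 0) {p : ℝ} (hp : 0 < p) :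
    ∫⁻ y, ‖lineIntegral η y‖ₑ ^ p ≠ 0 := by
  intro h0
  rw [lintegral_eq_zero_iff ((continuous_lineIntegral hc hs).measurable.enorm.pow_const _)] at h0
  refine not_ae_lineIntegral_eq_zero hc hs h ?_
  filter_upwards [h0] with y hy
  simpa [ENNReal.rpow_eq_zero_iff, hp, hp.not_gt] using hy

/-- The dyadic annulus `2^z ≤ |y| < 2^(z+1)` on the line. -/
def annulus (z : ℤ) : Set ℝ := {y | (2 : ℝ) ^ z ≤ |y| ∧ |y| < (2 : ℝ) ^ (z + 1)}

theorem measurableSet_annulus (z : ℤ) : MeasurableSet (annulus z) :=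
  (measurableSet_le (f := fun _ : ℝ => (2 : ℝ) ^ z) (g := fun y => |y|) (by fun_prop)
    (by fun_prop)).inter (measurableSet_lt (f := fun y : ℝ => |y|) (by fun_prop) measurable_const)

/-- Different dyadic dilates of one annulus are disjoint. This separates the supports of the lower
bounds for different tensor pieces. -/
theorem eq_of_mem_annulus {z : ℤ} {m n : ℕ} {y : ℝ} (hm : 2 ^ m * y ∈ annulus z)
    (hn : 2 ^ n * y ∈ annulus z) : m = n := by
  have key : ∀ {m n : ℕ}, 2 ^ m * y ∈ annulus z → 2 ^ n * y ∈ annulus z → n ≤ m := by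
    intro m n hm hn
    by_contra hlt
    have h1 := hm.1
    have h2 := hn.2
    rw [abs_mul, abs_of_pos (by positivity)] at h1 h2
    rw [zpow_add₀ two_ne_zero, zpow_one] at h2
    have h3 : (2 : ℝ) * 2 ^ m ≤ 2 ^ n := by
      rw [← pow_succ']
      exact pow_le_pow_right₀ (by norm_num) (by omega)
    nlinarith [abs_nonneg y]
  exact le_antisymm (key hn hm) (key hm hn)

theorem exists_setLIntegral_annulus_ne_zero {g : ℝ → ℝ≥0∞}
    (h : ∫⁻ y, g y ≠ 0) : ∃ z, ∫⁻ y in annulus z, g y ≠ 0 := by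
  by_contra! h0
  refine h ?_
  have hcover : (⋃ z, annulus z) = {0}ᶜ := by
    ext y
    simp only [Set.mem_iUnion, Set.mem_compl_iff, Set.mem_singleton_iff]
    constructor
    · rintro ⟨z, hz, -⟩ rfl
      rw [abs_zero] at hz
      exact absurd hz (not_le.2 (by positivity))
    · intro hy
      obtain ⟨z, hz⟩ := exists_mem_Ico_zpow (abs_pos.2 hy) (one_lt_two : (1 : ℝ) < 2)
      exact ⟨z, hz⟩
  have h1 : ∫⁻ y, g y = ∫⁻ y in ⋃ z, annulus z, g y := by
    rw [hcover, restrict_compl_singleton]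
  rw [h1]
  refine le_antisymm ((lintegral_iUnion_le _ _).trans ?_) zero_le
  simp [h0]

theorem lintegral_spectralIntegral_tensorDensity {d : ℕ} {b : Fin d → ℝ → ℝ≥0}
    (hc : ∀ i, HasCompactSupport fun s => ((b i s : ℝ) : ℂ))
    (hs : ∀ i, ContDiff ℝ ∞ fun s => ((b i s : ℝ) : ℂ)) (n : Fin d → ℕ) (e : ℝ) {p : ℝ} (hp : 0 < p) :
    ∫⁻ x, ‖spectralIntegral (fun ξ => ((tensorDensity ((2 : ℝ≥0) ^ e) b n ξ : ℝ) : ℂ)) x‖ₑ ^ p =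
      (2 : ℝ≥0∞) ^ (e * p + ((∑ i, n i : ℕ) : ℝ) * (p - 1)) *
      (ENNReal.ofReal ((2 * Real.pi) ^ (-(d : ℝ) / 2)) ^ p *
        ∏ i, ∫⁻ y, ‖lineIntegral (fun s => ((b i s : ℝ) : ℂ)) y‖ₑ ^ p) := by
  have h := setLIntegral_spectralIntegral_prod hc hs n (S := fun _ => Set.univ)
    (fun _ => MeasurableSet.univ) hp
  simp only [Set.mem_univ, implies_true, Set.ofPred_true, Measure.restrict_univ] at h
  have e1 : ∀ x, ‖spectralIntegral (fun ξ => ((tensorDensity ((2 : ℝ≥0) ^ e) b n ξ : ℝ) : ℂ)) x‖ₑ ^ p =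
      (2 : ℝ≥0∞) ^ (e * p) * ‖spectralIntegral
        (fun ξ : Rd d => ∏ i, ((b i ((2 : ℝ) ^ (-(n i : ℤ)) * ξ i) : ℝ) : ℂ)) x‖ₑ ^ p := by
    intro x
    have : (fun ξ : Rd d => ((tensorDensity ((2 : ℝ≥0) ^ e) b n ξ : ℝ) : ℂ)) = fun ξ =>
        (((2 : ℝ) ^ e : ℝ) : ℂ) * ∏ i, ((b i ((2 : ℝ) ^ (-(n i : ℤ)) * ξ i) : ℝ) : ℂ) := by
      funext ξ
      rw [tensorDensity]
      push_cast
      rfl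
    rw [this, spectralIntegral_const_mul, enorm_two_rpow_mul, ENNReal.mul_rpow_of_nonneg _ _ hp.le,
      ← ENNReal.rpow_mul]
  simp_rw [e1]
  rw [lintegral_const_mul' _ _ (by finiteness), h, ENNReal.rpow_add _ _ two_ne_zero
    ENNReal.ofNat_ne_top]
  ring

theorem hasCompactSupport_topBump : HasCompactSupport fun s => ((topBump s : ℝ) : ℂ) :=
  hasCompactSupport_lineBump _

theorem contDiff_topBump : ContDiff ℝ ∞ fun s => ((topBump s : ℝ) : ℂ) := contDiff_lineBump _

theorem hasCompactSupport_lowBump : HasCompactSupport fun s => ((lowBump s : ℝ) : ℂ) :=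
  hasCompactSupport_lineBump _

theorem contDiff_lowBump : ContDiff ℝ ∞ fun s => ((lowBump s : ℝ) : ℂ) := contDiff_lineBump _

/-- The factor 64d is 16d · 2^2: the block condition for side directions dilated by 2^(M+2) against
a main direction dilated by 2^(M+c). -/
theorem exists_sixty_four_mul_le (d : ℕ) : ∃ c : ℕ, 2 ≤ c ∧ 64 * d ≤ 2 ^ c := by
  refine ⟨64 * d + 2, by omega, ?_⟩
  have : 64 * d + 2 < 2 ^ (64 * d + 2) := Nat.lt_two_pow_self
  omega

theorem ofReal_mul_le_two_rpow {τ : ℝ} (hτ : 0 < τ) (M : ℕ) :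
    ENNReal.ofReal (τ * Real.log 2) * M ≤ (2 : ℝ≥0∞) ^ ((M : ℝ) * τ) := by
  have h1 : τ * Real.log 2 * M ≤ (2 : ℝ) ^ ((M : ℝ) * τ) := by
    rw [Real.rpow_def_of_pos two_pos]
    have := Real.add_one_le_exp (Real.log 2 * ((M : ℝ) * τ))
    linarith
  have h2 := ENNReal.ofReal_le_ofReal h1
  rwa [ENNReal.ofReal_mul (by positivity), ENNReal.ofReal_natCast,
    ← ENNReal.ofReal_rpow_of_pos two_pos, ENNReal.ofReal_ofNat] at h2

theorem isBlockFamily_line {d : ℕ} (i₀ : Fin d) {c : ℕ} (hc2 : 2 ≤ c) (hc : 64 * d ≤ 2 ^ c) :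
    IsBlockFamily i₀ c (fun i => if i = i₀ then topBump else lowBump)
      (fun M i => if i = i₀ then M + c else 0) where
  pos := by omega
  top := if_pos rfl
  measurable i := by
    split_ifs
    exacts [measurable_lineBump _, measurable_lineBump _]
  le_one i s := by
    split_ifs
    exacts [lineBump_le_one _ s, lineBump_le_one _ s]
  small i s h := by
    split_ifs at h
    exacts [abs_lt_one_of_topBump_ne_zero h, abs_lt_one_of_lowBump_ne_zero h]
  scale M := if_pos rfl
  size M i hi := by
    rw [if_neg hi, pow_add]
    nlinarith [Nat.one_le_two_pow (n := M)]

theorem isBlockFamily_cube {d : ℕ} {i₀ i₁ : Fin d} (hi : i₀ ≠ i₁) {c : ℕ} (hc2 : 2 ≤ c)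
    (hc : 64 * d ≤ 2 ^ c) :
    IsBlockFamily i₀ c (fun i => if i = i₁ then lowBump else topBump)
      (fun M i => if i = i₀ then M + c else M + 2) where
  pos := by omega
  top := if_neg hi
  measurable i := by
    split_ifs
    exacts [measurable_lineBump _, measurable_lineBump _]
  le_one i s := by
    split_ifs
    exacts [lineBump_le_one _ s, lineBump_le_one _ s]
  small i s h := by
    split_ifs at h
    exacts [abs_lt_one_of_lowBump_ne_zero h, abs_lt_one_of_topBump_ne_zero h]
  scale M := if_pos rfl
  size M i hi := by
    rw [if_neg hi, pow_add, pow_add]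
    nlinarith [Nat.one_le_two_pow (n := M)]

theorem isoNorm_lt_top_of {d : ℕ} {Φ : IsotropicGenerator d} {s p : ℝ} {q : ℝ≥0∞} (hp : 0 < p)
    {f : 𝓢'(Rd d, ℂ)} (h : ∫⁻ x, lq q (fun j : ℕ => (2 : ℝ≥0∞) ^ ((j : ℝ) * s) *
      ‖piece (Φ.system j) (Φ.system_hasCompactSupport j) (Φ.system_contDiff j) f x‖ₑ) ^ p < ⊤) :
    isoNorm Φ s p q f < ⊤ := by
  rw [isoNorm_eq]
  exact ENNReal.rpow_lt_top_of_nonneg (by positivity) h.ne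

theorem mixedNorm_lt_top_of {d : ℕ} {Ψ : LineGenerator} {t p : ℝ} {q : ℝ≥0∞} (hp : 0 < p)
    {f : 𝓢'(Rd d, ℂ)} (h : ∫⁻ x, lq q (fun k : Fin d → ℕ =>
      (2 : ℝ≥0∞) ^ (((∑ i, k i : ℕ) : ℝ) * t) * ‖piece (Ψ.system k) (Ψ.system_hasCompactSupport k)
        (Ψ.system_contDiff k) f x‖ₑ) ^ p < ⊤) :
    mixedNorm Ψ t p q f < ⊤ := by
  rw [mixedNorm_eq]
  exact ENNReal.rpow_lt_top_of_nonneg (by positivity) h.ne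

/-- Functions concentrated in frequency along one axis distinguish the two smoothness scales. -/
theorem not_mixed_subset_iso {d : ℕ} (hd : 2 ≤ d) (Φ : IsotropicGenerator d) (Ψ : LineGenerator)
    {p t : ℝ} {q : ℝ≥0∞} (hp : 0 < p) (hp1 : p < 1) (hq : 0 < q) (ht : 0 < t) :
    ¬ spaceOf (mixedNorm (d := d) Ψ t p q) ⊆ spaceOf (isoNorm Φ (t * d) p q) := by
  obtain ⟨c, hc2, hc⟩ := exists_sixty_four_mul_le d
  set i₀ : Fin d := ⟨0, by omega⟩ with hi₀
  -- The amplitude that normalizes the blocks in the mixed quasi-norm: the block has L_p quasi-norm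
  -- proportional to 2^(-(M+c)t).
  set σ : ℝ := -t - (1 - 1 / p) with hσ
  set b : Fin d → ℝ → ℝ≥0 := fun i => if i = i₀ then topBump else lowBump with hb
  set n : ℕ → Fin d → ℕ := fun M i => if i = i₀ then M + c else 0 with hn
  have hF : IsBlockFamily i₀ c b n := isBlockFamily_line i₀ hc2 hc
  have hbc : ∀ i, HasCompactSupport fun s => ((b i s : ℝ) : ℂ) := by
    intro i
    simp only [hb]
    split_ifs
    exacts [hasCompactSupport_topBump, hasCompactSupport_lowBump]
  have hbs : ∀ i, ContDiff ℝ ∞ fun s => ((b i s : ℝ) : ℂ) := by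
    intro i
    simp only [hb]
    split_ifs
    exacts [contDiff_topBump, contDiff_lowBump]
  set J : ℝ≥0∞ := ENNReal.ofReal ((2 * Real.pi) ^ (-(d : ℝ) / 2)) ^ p *
        ∏ i, ∫⁻ y, ‖lineIntegral (fun s => ((b i s : ℝ) : ℂ)) y‖ₑ ^ p with hJ
  have hJtop : J ≠ ⊤ := ENNReal.mul_ne_top (by finiteness) (ENNReal.prod_ne_top fun i _ =>
    (lintegral_enorm_lineIntegral_rpow_lt_top (hbc i) (hbs i) hp).ne)
  have hJ0 : J ≠ 0 := by
    refine mul_ne_zero ?_ (Finset.prod_ne_zero_iff.2 fun i _ => ?_)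
    · have : 0 < (2 * Real.pi) ^ (-(d : ℝ) / 2) := by positivity
      simp [ENNReal.rpow_eq_zero_iff, this, hp.not_gt]
    · refine lintegral_enorm_lineIntegral_rpow_ne_zero (hbc i) (hbs i)
        (s₀ := if i = i₀ then 7 / 8 else 0) ?_ hp
      simp only [hb]
      split_ifs
      · simp [topBump_eq_one]
      · simp [lowBump_eq_one]
  have hsum : ∀ M, ((∑ i, n M i : ℕ) : ℝ) = (M : ℝ) + c := by
    intro M
    simp [hn]
  have hbase : ∀ M, ∫⁻ x, ‖spectralIntegral (fun ξ => ((block i₀ σ b n M ξ : ℝ) : ℂ)) x‖ₑ ^ p =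
      (2 : ℝ≥0∞) ^ (-(((M : ℝ) + c) * t * p)) * J := by
    intro M
    unfold block
    rw [lintegral_spectralIntegral_tensorDensity hbc hbs _ _ hp, hsum, hF.scale]
    congr 2
    rw [hσ]
    push_cast
    field_simp
    ring
  clear_value J
  have hmix : ∀ M x, blockNorm q (fun k : Fin d → ℕ => Ψ.system k)
      (fun k => (2 : ℝ≥0∞) ^ (((∑ i, k i : ℕ) : ℝ) * t)) (block i₀ σ b n M) x =
      (2 : ℝ≥0∞) ^ (((M : ℝ) + c) * t) *
        ‖spectralIntegral (fun ξ => ((block i₀ σ b n M ξ : ℝ) : ℂ)) x‖ₑ := by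
    intro M x
    have hlow : ∀ i, i ≠ i₀ → ∀ ξ, block i₀ σ b n M ξ ≠ 0 → ‖ξ i‖ ≤ 2 ^ 0 := by
      intro i hi ξ hξ
      have := hF.abs_lt hξ i
      simp only [hn, if_neg hi] at this
      exact this.le
    rw [blockNorm_eq_single hq.ne' (n M), hsum]
    · intro k ξ hξ hk
      funext i
      by_cases hi : i = i₀
      · rw [hi, hF.scale, hF.mixed_level Ψ k M ξ hξ hk]
      · simp only [hn, if_neg hi]
        by_contra hki
        exact hk (Finset.prod_eq_zero (Finset.mem_univ i) (dyadic_eq_zero_of_norm_le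
          Ψ.eq_one_of_norm_le (Nat.pos_of_ne_zero hki) (hlow i hi ξ hξ)))
    · intro ξ hξ
      refine Finset.prod_eq_one fun i _ => ?_
      by_cases hi : i = i₀
      · rw [hi, hF.scale]
        exact dyadic_eq_one_of_shell Ψ.eq_one_of_norm_le Ψ.eq_zero_of_lt_norm (by omega)
          (hF.coordinate_shell hξ).1 (hF.coordinate_shell hξ).2
      · simp only [hn, if_neg hi]
        rw [dyadic, if_pos rfl]
        exact Ψ.eq_one_of_norm_le _ (by simpa using hlow i hi ξ hξ)
  have hiso : ∀ M x, blockNorm q (fun j : ℕ => Φ.system j)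
      (fun j => (2 : ℝ≥0∞) ^ ((j : ℝ) * (t * d))) (block i₀ σ b n M) x =
      (2 : ℝ≥0∞) ^ (((M : ℝ) + c) * (t * d)) *
        ‖spectralIntegral (fun ξ => ((block i₀ σ b n M ξ : ℝ) : ℂ)) x‖ₑ := by
    intro M x
    rw [blockNorm_eq_single hq.ne' (M + c) (fun j ξ => hF.isotropic_level Φ j M ξ)
      (hF.isotropic_eq_one Φ M)]
    push_cast
    rfl
  obtain ⟨C, K, hC0, hCK⟩ := hF.exists_growth σ
  have hτ : 0 < t * (d - 1) * p := by
    have : (2 : ℝ) ≤ d := by exact_mod_cast hd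
    have : 0 < (d : ℝ) - 1 := by linarith
    positivity
  obtain ⟨f, hfX, hfY⟩ := exists_separating_distribution hp hp1 hq.ne'
    (fun M => hF.measurable_block M) hC0 hCK hF.disjoint
    (μ := fun k : Fin d → ℕ => Ψ.system k) (ν := fun j : ℕ => Φ.system j)
    Ψ.system_hasCompactSupport Ψ.system_contDiff Φ.system_hasCompactSupport Φ.system_contDiff
    (fun k => (2 : ℝ≥0∞) ^ (((∑ i, k i : ℕ) : ℝ) * t)) (fun j => (2 : ℝ≥0∞) ^ ((j : ℝ) * (t * d)))
    -- A member of either system that meets the M-th block has (distinguished) index M + c, so the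
    -- level is recovered by subtracting c.
    (fun k => k i₀ - c) (fun j => j - c)
    (fun k M ξ hξ hk => by rw [hF.mixed_level Ψ k M ξ hξ hk]; omega)
    (fun j M ξ hξ hj => by rw [hF.isotropic_level Φ j M ξ hξ hj]; omega)
    -- The gap between the weights is 2^((M+c)t(d-1)p) in the p-th power; 1 + x ≤ e^x reduces this
    -- exponential growth to the linear growth required.
    hJtop (a := ENNReal.ofReal (t * (d - 1) * p * Real.log 2) * J)
    (mul_ne_zero (by simpa using mul_pos hτ (Real.log_pos one_lt_two)) hJ0)
    (fun M => by
      simp_rw [hmix, ENNReal.mul_rpow_of_nonneg _ _ hp.le]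
      rw [lintegral_const_mul' _ _ (by finiteness), hbase, ← ENNReal.rpow_mul, ← mul_assoc,
        ← ENNReal.rpow_add _ _ two_ne_zero ENNReal.ofNat_ne_top, add_neg_cancel, ENNReal.rpow_zero,
        one_mul])
    (fun M => by
      simp_rw [hiso, ENNReal.mul_rpow_of_nonneg _ _ hp.le]
      rw [lintegral_const_mul' _ _ (by finiteness), hbase, ← ENNReal.rpow_mul, ← mul_assoc,
        ← ENNReal.rpow_add _ _ two_ne_zero ENNReal.ofNat_ne_top, mul_right_comm]
      gcongr
      refine (ofReal_mul_le_two_rpow hτ M).trans ?_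
      refine ENNReal.rpow_le_rpow_of_exponent_le (by norm_num) ?_
      have : (0 : ℝ) ≤ c * (t * (d - 1) * p) := by positivity
      linarith)
  intro hsub
  have h1 : isoNorm Φ (t * d) p q f < ⊤ := hsub (mixedNorm_lt_top_of hp hfX)
  rw [isoNorm_eq, hfY, ENNReal.top_rpow_of_pos (by positivity)] at h1
  exact lt_irrefl _ h1

/-- The function `φ₀ - φ₀(2 ·)` whose dilations are the members of the decomposition of unity. -/
def LineGenerator.shell (Ψ : LineGenerator) (s : ℝ) : ℂ := Ψ.φ₀ s - Ψ.φ₀ ((2 : ℝ) • s)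

theorem LineGenerator.hasCompactSupport (Ψ : LineGenerator) : HasCompactSupport Ψ.φ₀ :=
  isCompact_Icc.of_isClosed_subset (isClosed_tsupport _) Ψ.tsupport_subset

theorem LineGenerator.shell_hasCompactSupport (Ψ : LineGenerator) : HasCompactSupport Ψ.shell :=
  Ψ.hasCompactSupport.sub (Ψ.hasCompactSupport.comp_smul two_ne_zero)

theorem LineGenerator.shell_contDiff (Ψ : LineGenerator) : ContDiff ℝ ∞ Ψ.shell :=
  Ψ.smooth.sub (Ψ.smooth.comp (contDiff_const_smul _))

theorem LineGenerator.shell_eq_one (Ψ : LineGenerator) : Ψ.shell (7 / 8) = 1 := by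
  rw [LineGenerator.shell, Ψ.eq_one_of_norm_le _ (by norm_num [abs_of_pos]),
    Ψ.eq_zero_of_lt_norm _ (by norm_num [abs_of_pos]), sub_zero]

theorem LineGenerator.dyadic_succ (Ψ : LineGenerator) (κ : ℕ) (s : ℝ) :
    dyadic Ψ.φ₀ (κ + 1) s = Ψ.shell ((2 : ℝ) ^ (-((κ + 1 : ℕ) : ℤ)) * s) := by
  rw [dyadic, if_neg (Nat.succ_ne_zero κ), LineGenerator.shell, zpow_add₀ two_ne_zero, zpow_one,
    smul_eq_mul, smul_eq_mul, smul_eq_mul]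
  congr 2
  ring

/-- Functions concentrated in a dyadic cube of frequencies which touches a coordinate hyperplane
have many tensor pieces living on disjoint sets. -/
theorem not_iso_subset_mixed {d : ℕ} (hd : 2 ≤ d) (Φ : IsotropicGenerator d) (Ψ : LineGenerator)
    {p t : ℝ} {q : ℝ≥0∞} (hp : 0 < p) (hp1 : p < 1) (hq : 0 < q) (htp : t ≤ 1 / p - 1) :
    ¬ spaceOf (isoNorm Φ (t * d) p q) ⊆ spaceOf (mixedNorm (d := d) Ψ t p q) := by
  obtain ⟨c, hc2, hc⟩ := exists_sixty_four_mul_le d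
  obtain ⟨i₀, i₁, hi⟩ : ∃ i₀ i₁ : Fin d, i₀ ≠ i₁ := ⟨⟨0, by omega⟩, ⟨1, by omega⟩, by simp⟩
  -- The amplitude that normalizes the blocks in the isotropic quasi-norm: all d directions have
  -- size about 2^M.
  set σ : ℝ := -(t * d + d * (1 - 1 / p)) with hσ
  set b : Fin d → ℝ → ℝ≥0 := fun i => if i = i₁ then lowBump else topBump with hb
  set n : ℕ → Fin d → ℕ := fun M i => if i = i₀ then M + c else M + 2 with hn
  have hF : IsBlockFamily i₀ c b n := isBlockFamily_cube hi hc2 hc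
  have hbc : ∀ i, HasCompactSupport fun s => ((b i s : ℝ) : ℂ) := by
    intro i
    simp only [hb]
    split_ifs
    exacts [hasCompactSupport_lowBump, hasCompactSupport_topBump]
  have hbs : ∀ i, ContDiff ℝ ∞ fun s => ((b i s : ℝ) : ℂ) := by
    intro i
    simp only [hb]
    split_ifs
    exacts [contDiff_lowBump, contDiff_topBump]
  have hc0 : ENNReal.ofReal ((2 * Real.pi) ^ (-(d : ℝ) / 2)) ^ p ≠ 0 := by
    have : 0 < (2 * Real.pi) ^ (-(d : ℝ) / 2) := by positivity
    simp [ENNReal.rpow_eq_zero_iff, this, hp.not_gt]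
  obtain ⟨J, hJtop, hbase⟩ : ∃ J : ℝ≥0∞, J ≠ ⊤ ∧ ∀ M, ∫⁻ x,
      ‖spectralIntegral (fun ξ => ((block i₀ σ b n M ξ : ℝ) : ℂ)) x‖ₑ ^ p =
      (2 : ℝ≥0∞) ^ (((M : ℝ) + c) * σ * p + ((∑ i, n M i : ℕ) : ℝ) * (p - 1)) * J := by
    refine ⟨ENNReal.ofReal ((2 * Real.pi) ^ (-(d : ℝ) / 2)) ^ p *
      ∏ i, ∫⁻ y, ‖lineIntegral (fun s => ((b i s : ℝ) : ℂ)) y‖ₑ ^ p,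
      ENNReal.mul_ne_top (by finiteness) (ENNReal.prod_ne_top fun i _ =>
      (lintegral_enorm_lineIntegral_rpow_lt_top (hbc i) (hbs i) hp).ne), fun M => ?_⟩
    unfold block
    rw [lintegral_spectralIntegral_tensorDensity hbc hbs _ _ hp, hF.scale, Nat.cast_add]
  have hsum : ∀ M, ((∑ i, n M i : ℕ) : ℝ) = d * ((M : ℝ) + 2) + (c - 2) := by
    intro M
    have e : ∀ i, ((n M i : ℕ) : ℝ) = ((M : ℝ) + 2) + if i = i₀ then (c - 2 : ℝ) else 0 := by
      intro i
      simp only [hn]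
      split_ifs <;> push_cast <;> ring
    rw [Nat.cast_sum]
    simp_rw [e]
    rw [Finset.sum_add_distrib, Finset.sum_const, Finset.card_univ, Fintype.card_fin, nsmul_eq_mul]
    simp
  have hiso : ∀ M x, blockNorm q (fun j : ℕ => Φ.system j)
      (fun j => (2 : ℝ≥0∞) ^ ((j : ℝ) * (t * d))) (block i₀ σ b n M) x =
      (2 : ℝ≥0∞) ^ (((M : ℝ) + c) * (t * d)) *
        ‖spectralIntegral (fun ξ => ((block i₀ σ b n M ξ : ℝ) : ℂ)) x‖ₑ := by
    intro M x
    rw [blockNorm_eq_single hq.ne' (M + c) (fun j ξ => hF.isotropic_level Φ j M ξ)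
      (hF.isotropic_eq_one Φ M)]
    push_cast
    rfl
  -- The profile of a tensor piece of a block: in direction i₁ the decomposition itself cuts out a
  -- shell, in the others the block lies where the selected tensor factor is one.
  set η : Fin d → ℝ → ℂ := fun i => if i = i₁ then Ψ.shell else fun s => ((topBump s : ℝ) : ℂ) with hη
  have hηc : ∀ i, HasCompactSupport (η i) := by
    intro i
    simp only [hη]
    split_ifs
    exacts [Ψ.shell_hasCompactSupport, hasCompactSupport_topBump]
  have hηs : ∀ i, ContDiff ℝ ∞ (η i) := by
    intro i
    simp only [hη]
    split_ifs
    exacts [Ψ.shell_contDiff, contDiff_topBump]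
  have hη0 : ∀ i, ∫⁻ y, ‖lineIntegral (η i) y‖ₑ ^ p ≠ 0 := by
    intro i
    refine lintegral_enorm_lineIntegral_rpow_ne_zero (hηc i) (hηs i) (s₀ := 7 / 8) ?_ hp
    simp only [hη]
    split_ifs
    · rw [Ψ.shell_eq_one]; exact one_ne_zero
    · simp [topBump_eq_one]
  -- The profile in direction i₁ has positive mass on some dyadic annulus, since the annuli cover
  -- the line up to the null set {0}. Restricting to it makes the pieces disjointly supported in x.
  obtain ⟨z, hz⟩ := exists_setLIntegral_annulus_ne_zero (hη0 i₁)
  set S : Fin d → Set ℝ := fun i => if i = i₁ then annulus z else Set.univ with hS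
  have hSm : ∀ i, MeasurableSet (S i) := by
    intro i
    simp only [hS]
    split_ifs
    exacts [measurableSet_annulus z, MeasurableSet.univ]
  -- For κ < M the function of index κ + 1 lives on |ξ_(i₁)| ≤ (3/2) 2^M, inside |ξ_(i₁)| ≤ 2^(M+1),
  -- where the low bump dilated by 2^(M+2) is one. The shift by one avoids the index 0, which has a
  -- different profile.
  set k : ℕ → ℕ → Fin d → ℕ := fun M κ i => if i = i₁ then κ + 1 else n M i with hk
  have hprod : ∀ M κ, κ < M → ∀ ξ : Rd d, Ψ.system (k M κ) ξ * ((block i₀ σ b n M ξ : ℝ) : ℂ) =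
      (((2 : ℝ) ^ (((M : ℝ) + c) * σ) : ℝ) : ℂ) * ∏ i, η i ((2 : ℝ) ^ (-(k M κ i : ℤ)) * ξ i) := by
    intro M κ hκ ξ
    rw [LineGenerator.system, block, tensorDensity, hF.scale]
    push_cast
    rw [mul_left_comm, ← Finset.prod_mul_distrib]
    congr 1
    refine Finset.prod_congr rfl fun i _ => ?_
    by_cases h1 : i = i₁
    · simp only [hk, hη, hb, if_pos h1]
      rw [← Ψ.dyadic_succ]
      by_cases h0 : dyadic Ψ.φ₀ (κ + 1) (ξ i) = 0
      · rw [h0, zero_mul]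
      · have h2 : |ξ i| ≤ 3 / 2 * 2 ^ (κ + 1) := by
          by_contra hlt
          exact h0 (Ψ.dyadic_eq_zero _ (not_le.1 hlt))
        have h3 : (2 : ℝ) ^ (κ + 1) ≤ 2 ^ M := pow_le_pow_right₀ (by norm_num) hκ
        have h4 : n M i = M + 2 := by
          simp only [hn]
          rw [if_neg (by rw [h1]; exact hi.symm)]
        rw [lowBump_eq_one, NNReal.coe_one, Complex.ofReal_one, mul_one]
        rw [h4, abs_mul, abs_of_pos (by positivity), zpow_neg, zpow_natCast, inv_mul_eq_div,
          div_le_iff₀ (by positivity), pow_add]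
        linarith [pow_pos (two_pos : (0 : ℝ) < 2) M]
    · simp only [hk, hη, hb, if_neg h1]
      by_cases h0 : topBump ((2 : ℝ) ^ (-(n M i : ℤ)) * ξ i) = 0
      · rw [h0]; simp
      · obtain ⟨h2, h3⟩ := mem_of_topBump_ne_zero h0
        rw [zpow_neg, zpow_natCast, inv_mul_eq_div, lt_div_iff₀ (by positivity)] at h2
        rw [zpow_neg, zpow_natCast, inv_mul_eq_div, div_lt_iff₀ (by positivity)] at h3
        have hpos : (0 : ℝ) < 2 ^ n M i := by positivity
        have hnz : n M i ≠ 0 := by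
          simp only [hn]
          split_ifs <;> omega
        have habs : ‖ξ i‖ = ξ i := Real.norm_of_nonneg (by linarith)
        rw [dyadic_eq_one_of_shell Ψ.eq_one_of_norm_le Ψ.eq_zero_of_lt_norm hnz
          (by rw [habs]; linarith) (by rw [habs]; linarith), one_mul]
  set a : ℝ≥0∞ := ENNReal.ofReal ((2 * Real.pi) ^ (-(d : ℝ) / 2)) ^ p *
    ∏ i, ∫⁻ y in S i, ‖lineIntegral (η i) y‖ₑ ^ p with ha
  have ha0 : a ≠ 0 := by
    refine mul_ne_zero hc0 (Finset.prod_ne_zero_iff.2 fun i _ => ?_)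
    by_cases h1 : i = i₁
    · rw [h1]
      simp only [hS, if_true]
      exact hz
    · simp only [hS, if_neg h1, Measure.restrict_univ]
      exact hη0 i
  set N : ℕ → Rd d → ℝ≥0∞ := fun M => blockNorm q (fun k : Fin d → ℕ => Ψ.system k)
      (fun k => (2 : ℝ≥0∞) ^ (((∑ i, k i : ℕ) : ℝ) * t)) (block i₀ σ b n M) with hN
  set B : ℕ → ℕ → Set (Rd d) := fun M κ => {x : Rd d | ∀ i, 2 ^ k M κ i * x i ∈ S i} with hB
  have hBm : ∀ M κ, MeasurableSet (B M κ) := by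
    intro M κ
    simp only [hB]
    rw [Set.ofPred_forall]
    exact MeasurableSet.iInter fun i =>
      (hSm i).preimage (f := fun x : Rd d => 2 ^ k M κ i * x i) (by fun_prop)
  have hBd : ∀ M κ κ', κ ≠ κ' → Disjoint (B M κ) (B M κ') := by
    intro M κ κ' hne
    rw [Set.disjoint_left]
    intro x hx hx'
    have h1 := hx i₁
    have h2 := hx' i₁
    simp only [hS, hk, if_true] at h1 h2
    have := eq_of_mem_annulus h1 h2
    omega
  have hterm : ∀ M κ, κ < M → a ≤ ∫⁻ x in B M κ, N M x ^ p := by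
    intro M κ hκ
    have hle : ((∑ i, k M κ i : ℕ) : ℝ) ≤ d * ((M : ℝ) + c) := by
      have : ∑ i, k M κ i ≤ ∑ _i : Fin d, (M + c) := by
        refine Finset.sum_le_sum fun i _ => ?_
        simp only [hk, hn]
        split_ifs <;> omega
      rw [Finset.sum_const, Finset.card_univ, Fintype.card_fin, smul_eq_mul] at this
      exact_mod_cast this
    -- On the κ-th box only the κ-th term of the ℓ_q norm is retained, which is why q plays no role.
    have hsing : ∀ x, (2 : ℝ≥0∞) ^ (((∑ i, k M κ i : ℕ) : ℝ) * t + ((M : ℝ) + c) * σ) *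
        ‖spectralIntegral (fun ξ : Rd d => ∏ i, η i ((2 : ℝ) ^ (-(k M κ i : ℤ)) * ξ i)) x‖ₑ ≤ N M x := by
      intro x
      refine le_trans (le_of_eq ?_) (le_lq hq.ne' _ (k M κ))
      simp_rw [hprod M κ hκ]
      rw [spectralIntegral_const_mul, enorm_two_rpow_mul, ENNReal.rpow_add _ _ two_ne_zero
        ENNReal.ofNat_ne_top, mul_assoc]
    have hset := setLIntegral_spectralIntegral_prod hηc hηs (k M κ) hSm hp
    change ∫⁻ x in B M κ, _ = _ at hset
    -- Here the condition on t enters: |k| ≤ d(M + c), and t p + p - 1 ≤ 0 is t ≤ 1/p - 1, so the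
    -- total exponent is nonnegative. At the endpoint it is zero and every κ contributes exactly the
    -- same amount.
    have hexp : (((∑ i, k M κ i : ℕ) : ℝ) - d * ((M : ℝ) + c)) * (t * p + p - 1) =
        (((∑ i, k M κ i : ℕ) : ℝ) * t + ((M : ℝ) + c) * σ) * p +
          ((∑ i, k M κ i : ℕ) : ℝ) * (p - 1) := by
      rw [hσ]
      field_simp
      ring
    calc a ≤ (2 : ℝ≥0∞) ^ ((((∑ i, k M κ i : ℕ) : ℝ) - d * ((M : ℝ) + c)) * (t * p + p - 1)) * a := by
          refine le_mul_of_one_le_left zero_le ?_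
          rw [← ENNReal.rpow_zero (x := 2)]
          refine ENNReal.rpow_le_rpow_of_exponent_le (by norm_num)
            (mul_nonneg_of_nonpos_of_nonpos (sub_nonpos.2 hle) ?_)
          have := mul_le_mul_of_nonneg_right htp hp.le
          rw [sub_mul, one_div_mul_cancel hp.ne', one_mul] at this
          linarith
      _ = ∫⁻ x in B M κ, ((2 : ℝ≥0∞) ^ (((∑ i, k M κ i : ℕ) : ℝ) * t + ((M : ℝ) + c) * σ) *
        ‖spectralIntegral (fun ξ : Rd d => ∏ i, η i ((2 : ℝ) ^ (-(k M κ i : ℤ)) * ξ i)) x‖ₑ) ^ p := by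
          simp_rw [ENNReal.mul_rpow_of_nonneg _ _ hp.le]
          rw [lintegral_const_mul' _ _ (by finiteness), hset, hexp, ENNReal.rpow_add _ _ two_ne_zero
            ENNReal.ofNat_ne_top, ENNReal.rpow_mul, ha]
          ring
      _ ≤ _ := lintegral_mono fun x => ENNReal.rpow_le_rpow (hsing x) hp.le
  obtain ⟨C, K, hC0, hCK⟩ := hF.exists_growth σ
  obtain ⟨f, hfX, hfY⟩ := exists_separating_distribution hp hp1 hq.ne'
    (fun M => hF.measurable_block M) hC0 hCK hF.disjoint
    (μ := fun j : ℕ => Φ.system j) (ν := fun k : Fin d → ℕ => Ψ.system k)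
    Φ.system_hasCompactSupport Φ.system_contDiff Ψ.system_hasCompactSupport Ψ.system_contDiff
    (fun j => (2 : ℝ≥0∞) ^ ((j : ℝ) * (t * d))) (fun k => (2 : ℝ≥0∞) ^ (((∑ i, k i : ℕ) : ℝ) * t))
    (fun j => j - c) (fun k => k i₀ - c)
    (fun j M ξ hξ hj => by rw [hF.isotropic_level Φ j M ξ hξ hj]; omega)
    (fun k M ξ hξ hk => by rw [hF.mixed_level Ψ k M ξ hξ hk]; omega)
    -- The constant left by the normalization: the scales of a block add up to d(M + 2) + (c - 2),
    -- which differs from d(M + c) by an amount independent of M.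
    (A := (2 : ℝ≥0∞) ^ ((p - 1) * (c - 2) * (1 - d)) * J) (ENNReal.mul_ne_top (by finiteness) hJtop)
    ha0
    (fun M => by
      simp_rw [hiso, ENNReal.mul_rpow_of_nonneg _ _ hp.le]
      rw [lintegral_const_mul' _ _ (by finiteness), hbase, ← ENNReal.rpow_mul, ← mul_assoc,
        ← ENNReal.rpow_add _ _ two_ne_zero ENNReal.ofNat_ne_top, hsum]
      refine le_of_eq ?_
      congr 2
      rw [hσ]
      field_simp
      ring)
    (fun M => by
      change a * M ≤ ∫⁻ x, N M x ^ p
      calc a * M = ∑ κ ∈ Finset.range M, a := by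
            rw [Finset.sum_const, Finset.card_range, nsmul_eq_mul, mul_comm]
        _ ≤ ∑ κ ∈ Finset.range M, ∫⁻ x in B M κ, N M x ^ p :=
            Finset.sum_le_sum fun κ hκ => hterm M κ (Finset.mem_range.1 hκ)
        _ = ∫⁻ x in ⋃ κ ∈ Finset.range M, B M κ, N M x ^ p :=
            (lintegral_biUnion_finset (fun κ _ κ' _ hne => hBd M κ κ' hne)
              (fun κ _ => hBm M κ) _).symm
        _ ≤ _ := setLIntegral_le_lintegral _ _)
  intro hsub
  have h1 : mixedNorm Ψ t p q f < ⊤ := hsub (isoNorm_lt_top_of hp hfX)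
  rw [mixedNorm_eq, hfY, ENNReal.top_rpow_of_pos (by positivity)] at h1
  exact lt_irrefl _ h1

theorem notComparable_mixedNorm_isoNorm {d : ℕ} (hd : 2 ≤ d) (Φ : IsotropicGenerator d)
    (Ψ : LineGenerator) {p t : ℝ} {q : ℝ≥0∞} (hp : 0 < p) (hp1 : p < 1) (hq : 0 < q) (ht : 0 < t)
    (htp : t ≤ 1 / p - 1) :
    NotComparable (mixedNorm (d := d) Ψ t p q) (isoNorm Φ (t * d) p q) :=
  ⟨not_mixed_subset_iso hd Φ Ψ hp hp1 hq ht, not_iso_subset_mixed hd Φ Ψ hp hp1 hq htp⟩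

end LizorkinTriebel

end

theorem proposition3p10 (d : ℕ) (hd : 2 ≤ d) (Φ : LizorkinTriebel.IsotropicGenerator d)
    (Ψ : LizorkinTriebel.LineGenerator) :
    (∀ (p t : ℝ) (q : ENNReal), 0 < p → p < 1 → 0 < q → 0 < t → t ≤ 1 / p - 1 →
      LizorkinTriebel.NotComparable
        (LizorkinTriebel.mixedNorm (d := d) Ψ t p q)
        (LizorkinTriebel.isoNorm Φ (t * d) p q)) ∧
    (∀ (p t : ℝ) (q : ENNReal), 0 < p → 0 < q → t < 0 →
      LizorkinTriebel.ContinuouslyEmbeds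
        (LizorkinTriebel.mixedNorm (d := d) Ψ t p q)
        (LizorkinTriebel.isoNorm Φ (t * d) p q)) := by
  refine ⟨fun p t q hp hp1 hq ht htp => ?_, fun p t q hp hq ht => ?_⟩
  · exact LizorkinTriebel.notComparable_mixedNorm_isoNorm hd Φ Ψ hp hp1 hq ht htp
  · exact LizorkinTriebel.continuouslyEmbeds_mixedNorm_isoNorm (by omega) Φ Ψ hp hq ht
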